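/- Let $p\ge 3$ and $n\ge 1$ be integers and let $f:[0,\infty)\to[0,\infty)$ be a measurable function such that $(x,z)\mapsto f(\|x\|^2+\|z\|^2)$ is a probability density on $\mathbb R^p\times\mathbb R^n$. Let $(X,Z)\in\mathbb R^p\times\mathbb R^n$ have the density $$\eta^{(p+n)/2} f\bigl(\eta\{\|x-\theta\|^2+\|z\|^2\}\bigr)$$ with $\theta\in\mathbb R^p$ and $\eta=\sigma^{-2}>0$ both unknown. Consider estimation of $\theta$ under the loss $\eta\|d-\theta\|^2$. An estimator $\delta(X,Z)$ is minimax if its maximal risk $\sup_{\theta,\eta}E_{\theta,\eta}[\eta\|\delta(X,Z)-\theta\|^2]\in[0,\infty]$ does not exceed that of any other (measurable) estimator. For real $a,e$ take the improper prior density $$\pi_{a,e}(\theta,\eta)=\|\theta\|^{-2(p/2+a+1)}\,\eta^{-a-1+e}$$ with respect to $d\theta\,d\eta$ on $\mathbb R^p\times(0,\infty)$. The generalized Bayes estimator with respect to $\pi_{a,e}$ is the minimizer of the posterior expected loss, namely $$\delta_{a,e}(x,z)=\frac{\int_{\mathbb R^p}\int_0^\infty \theta\,\eta\cdot\eta^{(p+n)/2}f(\eta\{\|x-\theta\|^2+\|z\|^2\})\,\pi_{a,e}(\theta,\eta)\,d\eta\,d\theta}{\int_{\mathbb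 R^p}\int_0^\infty \eta\cdot\eta^{(p+n)/2}f(\eta\{\|x-\theta\|^2+\|z\|^2\})\,\pi_{a,e}(\theta,\eta)\,d\eta\,d\theta}.$$ Put $c(p,n)=2(p-2)/(n+2)$, $$u_*(p,n,e)=\frac{c(p,n)(n/2+e)-p/2-1}{1+c(p,n)},$$ $$\begin{aligned}g(a)={}&(2p+2n+4e+4)a^2+\{2p^2+2pn+12p+7n+4(p+3)e+10\}a\\&+4p^2+\tfrac72pn+6(p+2)e+7n+13p+10,\end{aligned}$$ and consider the moment condition $$\int_0^\infty \eta^{(n+p)/2-a+e}f(\eta)\,d\eta<\infty.\tag{M}$$ (i) Suppose $-p/2-n/2-1<e\le -n/4-3/2$ and $-p/2-1<a\le u_*(p,n,e)$. Then for every $f$ as above that satisfies (M), $\delta_{a,e}(x,z)$ is, for all $x$ and all $z\ne0$, the unique minimizer of the posterior expected loss, with finite minimum, and $\delta_{a,e}$ is minimax. (ii) Suppose $e>-n/4-3/2$ and $n\ge 2$. Then $g$ has exactly two real zeros, the larger of which, $a_*$, lies in $(-2,-1)$; and if $-p/2-1<a\le a_*$, then for every $f$ as above that satisfies (M), $\delta_{a,e}(x,z)$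 is, for all $x$ and all $z\ne0$, the unique minimizer of the posterior expected loss, with finite minimum, and $\delta_{a,e}$ is minimax. -/

import Mathlib

open MeasureTheory Set
open scoped ENNReal

/-- `d`-dimensional Euclidean space. -/
abbrev Euc (d : ℕ) : Type := EuclideanSpace ℝ (Fin d)

namespace SphericalModel

variable {p n : ℕ}

/-- `f : [0, ∞) → [0, ∞)` (values at negative reals are irrelevant) is such that
`(x, z) ↦ f (‖x‖² + ‖z‖²)` is a probability density on `ℝ^p × ℝ^n`. -/
structure IsErrorDensity (p n : ℕ) (f : ℝ → ℝ) : Prop where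
  measurable : Measurable f
  nonneg : ∀ t, 0 ≤ t → 0 ≤ f t
  lintegral_eq_one :
    ∫⁻ y : Euc p × Euc n, ENNReal.ofReal (f (‖y.1‖ ^ 2 + ‖y.2‖ ^ 2)) = 1

/-- The density at `y = (x, z)` of the observation `(X, Z)` with location `θ` and precision
`η = σ⁻²`, that is, `σ^{-(p+n)} f ((‖x - θ‖² + ‖z‖²) / σ²)`. -/
noncomputable def density (f : ℝ → ℝ) (θ : Euc p) (η : ℝ) (y : Euc p × Euc n) : ℝ :=
  η ^ (((p : ℝ) + n) / 2) * f (η * (‖y.1 - θ‖ ^ 2 + ‖y.2‖ ^ 2))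

/-- The scale-invariant quadratic loss `‖d - θ‖² / σ² = η ‖d - θ‖²`. -/
noncomputable def loss (d θ : Euc p) (η : ℝ) : ℝ := η * ‖d - θ‖ ^ 2

/-- The risk `E[loss (δ (X, Z), θ, η)]`, as an extended nonnegative real. -/
noncomputable def risk (f : ℝ → ℝ) (δ : Euc p × Euc n → Euc p) (θ : Euc p) (η : ℝ) : ℝ≥0∞ :=
  ∫⁻ y, ENNReal.ofReal (loss (δ y) θ η * density f θ η y)

/-- The supremum of the risk over all locations `θ` and all scales (`η > 0`). -/
noncomputable def maxRisk (f : ℝ → ℝ) (δ : Euc p × Euc n → Euc p) : ℝ≥0∞ :=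
  ⨆ (θ : Euc p) (η : ℝ) (_ : 0 < η), risk f δ θ η

/-- `δ` is a minimax estimator of `θ`: its maximal risk is the least among all estimators. -/
def IsMinimax (f : ℝ → ℝ) (δ : Euc p × Euc n → Euc p) : Prop :=
  Measurable δ ∧
    ∀ δ' : Euc p × Euc n → Euc p, Measurable δ' → maxRisk f δ ≤ maxRisk f δ'

/-- The (unnormalized) posterior density of `(θ, η)` given `y`, for the improper prior density
`π` with respect to `dθ dη`. -/
noncomputable def posterior (f : ℝ → ℝ) (π : Euc p → ℝ → ℝ) (y : Euc p × Euc n)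
    (θ : Euc p) (η : ℝ) : ℝ :=
  density f θ η y * π θ η

/-- The (unnormalized) posterior expected loss of the decision `d` given `y`. -/
noncomputable def posteriorLoss (f : ℝ → ℝ) (π : Euc p → ℝ → ℝ) (y : Euc p × Euc n)
    (d : Euc p) : ℝ≥0∞ :=
  ∫⁻ θ : Euc p, ∫⁻ η in Ioi (0 : ℝ), ENNReal.ofReal (loss d θ η * posterior f π y θ η)

/-- The estimator `E(η θ | y) / E(η | y)`, expectations under the posterior. -/
noncomputable def genBayes (f : ℝ → ℝ) (π : Euc p → ℝ → ℝ) (y : Euc p × Euc n) : Euc p :=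
  (∫ q : Euc p × ℝ, q.2 * posterior f π y q.1 q.2
      ∂((volume : Measure (Euc p)).prod (volume.restrict (Ioi (0 : ℝ)))))⁻¹ •
    ∫ q : Euc p × ℝ, (q.2 * posterior f π y q.1 q.2) • q.1
      ∂((volume : Measure (Euc p)).prod (volume.restrict (Ioi (0 : ℝ))))

/-- `δ` is the generalized Bayes estimator for the prior density `π`: for all data `(x, z)` with
`z ≠ 0` (hence almost surely) `δ (x, z)` is the unique minimizer of the posterior expected loss,
which is finite there. -/
def IsGeneralizedBayes (f : ℝ → ℝ) (π : Euc p → ℝ → ℝ) (δ : Euc p × Euc n → Euc p) : Prop :=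
  ∀ (x : Euc p) (z : Euc n), z ≠ 0 → ∀ d : Euc p, d ≠ δ (x, z) →
    posteriorLoss f π (x, z) (δ (x, z)) < posteriorLoss f π (x, z) d

/-- The improper prior density `‖θ‖^{-2(p/2+a+1)} η^{-a-1+e}`. -/
noncomputable def prior (a e : ℝ) (θ : Euc p) (η : ℝ) : ℝ :=
  ‖θ‖ ^ (-2 * ((p : ℝ) / 2 + a + 1)) * η ^ (-a - 1 + e)

/-- The moment condition `∫₀^∞ η^{(n+p)/2-a+e} f(η) dη < ∞`. -/
def MomentCondition (p n : ℕ) (a e : ℝ) (f : ℝ → ℝ) : Prop :=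
  IntegrableOn (fun t : ℝ => t ^ (((n : ℝ) + p) / 2 - a + e) * f t) (Ioi 0)

/-- `c(p, n) = 2(p-2)/(n+2)`. -/
noncomputable def cConst (p n : ℕ) : ℝ := 2 * ((p : ℝ) - 2) / ((n : ℝ) + 2)

/-- The upper bound `u_*(p, n, e) = (c(p,n)(n/2+e) - p/2 - 1) / (1 + c(p,n))`. -/
noncomputable def uStar (p n : ℕ) (e : ℝ) : ℝ :=
  (cConst p n * ((n : ℝ) / 2 + e) - (p : ℝ) / 2 - 1) / (1 + cConst p n)

/-- The quadratic `g`. -/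
noncomputable def g (p n : ℕ) (e a : ℝ) : ℝ :=
  (2 * p + 2 * n + 4 * e + 4) * a ^ 2
    + a * (2 * (p : ℝ) ^ 2 + 2 * p * n + 12 * p + 7 * n + 4 * (p + 3) * e + 10)
    + (4 * (p : ℝ) ^ 2 + 7 / 2 * p * n + 6 * (p + 2) * e + 7 * n + 13 * p + 10)

end SphericalModel

/-! Write `W = ‖x‖²/‖z‖²`, `k = p/2 + a + 1`, `b = -a - 2` and `N = (p+n)/2 + e + 2`.

The Bayes estimator does not depend on `f`. For fixed `θ`, the substitution `t = η(‖x-θ‖² + ‖z‖²)`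
pulls `f` out of the `η`-integral as the constant `tailMoment`, which (M) makes finite
(`posteriorLoss_eq`). What remains is a second moment of `θ` with weight `‖θ‖^(-2k) (‖x-θ‖² +
‖z‖²)^(-m)`. Writing both powers as gamma integrals with a common precision turns this weight into a
mixture of Gaussians centred at `(1-t)x`, where `t ∈ (0,1)` has density proportional to `t^(k-1)
(1-t)^b (1+Wt)^(-N)`. Hence the estimator is `(1 - ρ(W)) x` with `ρ = shrink k b N` the mean of `t`
(`genBayes_spec`).

The estimator `x` has constant risk, and averaging over `θ` uniform on large balls shows that no
maximal risk is smaller (`constRisk_le_maxRisk`); this also covers infinite risk. So it suffices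
that `(1 - ρ(W)) x` never has larger risk than `x`. Stein's identity with `F(t) = ½∫_t^∞ f` in place
of the Gaussian density, applied in `x` to `ρ(W) x` and in `z` to `Wρ(W)² z`, writes the risk
difference as the integral of `F` times an expression in `ρ, ρ'` alone. It is enough that this
expression is nonpositive (`IsGoodShrinkage.div_nonpos`), which is again a condition free of `f`.
The identity is proved for continuous compactly supported profiles, and the resulting inequality is
transferred to measurable ones (`lintegral_mul_comp_le_of_continuous`).

The expression is nonpositive as soon as `wρ ≤ B`, `wρ' ≥ -(1+L)ρ` and `B(n + 2 + 4L) ≤ 2(p-2) -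
4L`. Both bounds come from integrating by parts in the beta-type integrals (`betaInt_key_bound`,
`betaInt_recurrence`). For `b ≥ 0`, that is `a ≤ -2`, one may take `L = 0` and `B = k/(n/2+e-a)`,
and the requirement reads `a ≤ u_*`. For `-1 < b ≤ 0` there is a loss `L = -b(k+1)/(1+b)`, and the
requirement becomes `g(a) ≤ 0`. The sign of `2e + n/2 + 3` decides on which side of `-2` the
threshold lies. -/

namespace SphericalModel

open Filter Topology

/-! ### Beta-type integrals: integrability, positivity, differentiation in the parameter. -/

section

/-- The (unnormalized) beta density `t^(k-1) (1-t)^b`. -/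
noncomputable def betaWeight (k b t : ℝ) : ℝ := t ^ (k - 1) * (1 - t) ^ b

/-- The integral `∫₀¹ t^(k-1) (1-t)^b (1+wt)^(-N) dt`. -/
noncomputable def betaInt (k b N w : ℝ) : ℝ :=
  ∫ t in Ioo (0 : ℝ) 1, betaWeight k b t * (1 + w * t) ^ (-N)

theorem measurable_betaWeight (k b : ℝ) : Measurable (betaWeight k b) := by
  unfold betaWeight; fun_prop

theorem betaWeight_pos {k b t : ℝ} (ht : t ∈ Ioo (0 : ℝ) 1) : 0 < betaWeight k b t :=
  mul_pos (Real.rpow_pos_of_pos ht.1 _) (Real.rpow_pos_of_pos (by linarith [ht.2]) _)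

theorem betaWeight_succ {k b t : ℝ} (ht : t ∈ Ioo (0 : ℝ) 1) :
    betaWeight (k + 1) b t = betaWeight k b t * t := by
  have h : t ^ (k + 1 - 1) = t ^ (k - 1) * t := by
    rw [show k + 1 - 1 = k - 1 + 1 by ring, Real.rpow_add_one ht.1.ne']
  simp only [betaWeight, h]; ring

theorem betaWeight_succ_right {k b t : ℝ} (ht : t ∈ Ioo (0 : ℝ) 1) :
    betaWeight k (b + 1) t = betaWeight k b t * (1 - t) := by
  have h : (1 - t) ^ (b + 1) = (1 - t) ^ b * (1 - t) := by
    rw [Real.rpow_add_one (by linarith [ht.2])]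
  simp only [betaWeight, h]; ring

theorem integrableOn_betaWeight {k b : ℝ} (hk : 0 < k) (hb : -1 < b) :
    IntegrableOn (betaWeight k b) (Ioo 0 1) := by
  have h := Complex.betaIntegral_convergent (u := k) (v := ((b + 1 : ℝ) : ℂ)) (by simpa using hk)
    (by simp only [Complex.ofReal_re]; linarith)
  rw [intervalIntegrable_iff_integrableOn_Ioo_of_le zero_le_one] at h
  have h2 := h.re
  refine IntegrableOn.congr_fun h2 (fun t ht => ?_) measurableSet_Ioo
  have h0 : (t : ℂ) ^ ((k : ℂ) - 1) = ((t ^ (k - 1) : ℝ) : ℂ) := by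
    rw [Complex.ofReal_cpow ht.1.le]; push_cast; rfl
  have h1 : (1 - (t : ℂ)) ^ (((b + 1 : ℝ) : ℂ) - 1) = (((1 - t) ^ b : ℝ) : ℂ) := by
    rw [Complex.ofReal_cpow (by linarith [ht.2])]; push_cast; ring_nf
  simp only [h0, h1, betaWeight, ← Complex.ofReal_mul]
  exact Complex.ofReal_re _

theorem integrableOn_betaWeight_mul {k b C : ℝ} (hk : 0 < k) (hb : -1 < b) {u : ℝ → ℝ}
    (hu : Measurable u) (hC : ∀ t ∈ Ioo (0 : ℝ) 1, |u t| ≤ C) :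
    IntegrableOn (fun t => betaWeight k b t * u t) (Ioo 0 1) :=
  Integrable.mul_bdd (c := C) (integrableOn_betaWeight hk hb) hu.aestronglyMeasurable
    ((ae_restrict_iff' measurableSet_Ioo).2 (Eventually.of_forall hC))

/-- Only `w ≥ 0` occurs in the estimator. Allowing `w > -1/2` gives a neighbourhood of `w = 0`, so
that two-sided derivatives exist there, while `1 + wt` stays away from zero. -/
theorem half_le_one_add_mul {w t : ℝ} (hw : -(1 / 2) < w) (ht : t ∈ Ioo (0 : ℝ) 1) :
    1 / 2 ≤ 1 + w * t := by
  nlinarith [ht.1, ht.2]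

theorem one_add_mul_rpow_le {w t N : ℝ} (hN : 0 ≤ N) (hw : -(1 / 2) < w)
    (ht : t ∈ Ioo (0 : ℝ) 1) : (1 + w * t) ^ (-N) ≤ (1 / 2) ^ (-N) :=
  Real.rpow_le_rpow_of_nonpos (by norm_num) (half_le_one_add_mul hw ht) (by linarith)

theorem integrableOn_betaInt {k b N w : ℝ} (hk : 0 < k) (hb : -1 < b) (hN : 0 ≤ N)
    (hw : -(1 / 2) < w) :
    IntegrableOn (fun t => betaWeight k b t * (1 + w * t) ^ (-N)) (Ioo 0 1) := by
  refine integrableOn_betaWeight_mul (C := (1 / 2) ^ (-N)) hk hb (by fun_prop) fun t ht => ?_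
  have h := half_le_one_add_mul hw ht
  rw [abs_of_nonneg (Real.rpow_nonneg (by linarith) _)]
  exact one_add_mul_rpow_le hN hw ht

theorem betaInt_pos {k b N w : ℝ} (hk : 0 < k) (hb : -1 < b) (hN : 0 ≤ N)
    (hw : -(1 / 2) < w) : 0 < betaInt k b N w := by
  unfold betaInt
  have hpos : ∀ t ∈ Ioo (0 : ℝ) 1, 0 < betaWeight k b t * (1 + w * t) ^ (-N) := fun t ht =>
    mul_pos (betaWeight_pos ht) (Real.rpow_pos_of_pos
      (by linarith [half_le_one_add_mul hw ht]) _)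
  rw [setIntegral_pos_iff_support_of_nonneg_ae
    ((ae_restrict_iff' measurableSet_Ioo).2 (Eventually.of_forall fun t ht => (hpos t ht).le))
    (integrableOn_betaInt hk hb hN hw)]
  have : Function.support (fun t => betaWeight k b t * (1 + w * t) ^ (-N)) ∩ Ioo (0 : ℝ) 1
      = Ioo 0 1 := inter_eq_right.2 fun t ht => (hpos t ht).ne'
  rw [this]; simp

theorem betaInt_succ_lt {k b N w : ℝ} (hk : 0 < k) (hb : -1 < b) (hN : 0 ≤ N)
    (hw : -(1 / 2) < w) : betaInt (k + 1) b N w < betaInt k b N w := by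
  have h := betaInt_pos (k := k) (b := b + 1) hk (by linarith) hN hw
  have : betaInt k (b + 1) N w = betaInt k b N w - betaInt (k + 1) b N w := by
    unfold betaInt
    rw [← integral_sub (integrableOn_betaInt hk hb hN hw)
      (integrableOn_betaInt (by linarith) hb hN hw)]
    refine setIntegral_congr_fun measurableSet_Ioo fun t ht => ?_
    simp only [betaWeight_succ ht, betaWeight_succ_right ht]; ring
  linarith

theorem betaInt_eq_add {k b N w : ℝ} (hk : 0 < k) (hb : -1 < b) (hN : 0 ≤ N)
    (hw : -(1 / 2) < w) :
    betaInt k b N w = betaInt k b (N + 1) w + w * betaInt (k + 1) b (N + 1) w := by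
  unfold betaInt
  rw [← integral_const_mul, ← integral_add (integrableOn_betaInt hk hb (by linarith) hw)
      ((integrableOn_betaInt (by linarith) hb (by linarith) hw).const_mul w)]
  refine setIntegral_congr_fun measurableSet_Ioo fun t ht => ?_
  have h := half_le_one_add_mul hw ht
  have e : (1 + w * t) ^ (-N) = (1 + w * t) ^ (-(N + 1)) * (1 + w * t) := by
    rw [← Real.rpow_add_one (by linarith)]; ring_nf
  simp only [betaWeight_succ ht, e]; ring

theorem hasDerivAt_betaInt {k b N w : ℝ} (hk : 0 < k) (hb : -1 < b) (hN : 0 ≤ N)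
    (hw : -(1 / 2) < w) :
    HasDerivAt (betaInt k b N) (-N * betaInt (k + 1) b (N + 1) w) w := by
  have key := hasDerivAt_integral_of_dominated_loc_of_deriv_le
    (μ := volume.restrict (Ioo (0 : ℝ) 1)) (𝕜 := ℝ)
    (F := fun w t => betaWeight k b t * (1 + w * t) ^ (-N))
    (F' := fun w t => -N * (betaWeight (k + 1) b t * (1 + w * t) ^ (-(N + 1))))
    (bound := fun t => N * (1 / 2) ^ (-(N + 1)) * betaWeight k b t) (x₀ := w)
    (s := Ioi (-(1 / 2))) (Ioi_mem_nhds hw)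
    (Eventually.of_forall fun w =>
      ((measurable_betaWeight k b).mul (by fun_prop)).aestronglyMeasurable)
    (integrableOn_betaInt hk hb hN hw)
    (((measurable_betaWeight (k + 1) b).mul (by fun_prop)).const_mul _).aestronglyMeasurable
    ((ae_restrict_iff' measurableSet_Ioo).2 (Eventually.of_forall fun t ht w' hw' => ?_))
    ((integrableOn_betaWeight hk hb).const_mul _)
    ((ae_restrict_iff' measurableSet_Ioo).2 (Eventually.of_forall fun t ht w' hw' => ?_))
  · convert! key.2 using 1
    unfold betaInt
    rw [integral_const_mul]
  · have h := half_le_one_add_mul hw' ht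
    have hb' := betaWeight_pos (k := k) (b := b) ht
    have h1 := one_add_mul_rpow_le (N := N + 1) (by linarith) hw' ht
    have h2 : 0 ≤ (1 + w' * t) ^ (-(N + 1)) := Real.rpow_nonneg (by linarith) _
    rw [betaWeight_succ ht, Real.norm_eq_abs, abs_mul, abs_neg, abs_of_nonneg hN,
      abs_of_nonneg (mul_nonneg (mul_nonneg hb'.le ht.1.le) h2), mul_assoc N]
    refine mul_le_mul_of_nonneg_left ?_ hN
    calc betaWeight k b t * t * (1 + w' * t) ^ (-(N + 1))
        ≤ betaWeight k b t * 1 * (1 / 2) ^ (-(N + 1)) := by gcongr; exact ht.2.le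
      _ = (1 / 2) ^ (-(N + 1)) * betaWeight k b t := by ring
  · have h := half_le_one_add_mul hw' ht
    have h1 : HasDerivAt (fun w : ℝ => 1 + w * t) t w' := by
      simpa using ((hasDerivAt_id w').mul_const t).const_add 1
    have h2 := (h1.rpow_const (p := -N) (Or.inl (by linarith))).const_mul (betaWeight k b t)
    convert! h2 using 1
    rw [betaWeight_succ ht, show -(N + 1) = -N - 1 by ring]; ring

end

/-! ### Integration by parts in the beta-type integrals. -/

section

theorem setIntegral_Ioo_deriv_eq_zero {U U' : ℝ → ℝ}
    (hderiv : ∀ t ∈ Ioo (0 : ℝ) 1, HasDerivAt U (U' t) t) (hint : IntegrableOn U' (Ioo 0 1))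
    (h0 : Tendsto U (𝓝[>] 0) (𝓝 0)) (h1 : Tendsto U (𝓝[<] 1) (𝓝 0)) :
    ∫ t in Ioo (0 : ℝ) 1, U' t = 0 := by
  have h := intervalIntegral.integral_eq_sub_of_hasDerivAt_of_tendsto zero_lt_one hderiv
    ((intervalIntegrable_iff_integrableOn_Ioo_of_le zero_le_one).2 hint) h0 h1
  rwa [intervalIntegral.integral_of_le zero_le_one, integral_Ioc_eq_integral_Ioo, sub_zero] at h

theorem tendsto_betaWeight_zero {k b : ℝ} (hk : 0 < k) (hb : -1 < b) :
    Tendsto (betaWeight (k + 1) (b + 1)) (𝓝[>] 0) (𝓝 0) ∧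
      Tendsto (betaWeight (k + 1) (b + 1)) (𝓝[<] 1) (𝓝 0) := by
  have hc : Continuous (betaWeight (k + 1) (b + 1)) := by
    unfold betaWeight
    exact (Real.continuous_rpow_const (by linarith)).mul
      ((Real.continuous_rpow_const (by linarith)).comp (continuous_const.sub continuous_id))
  have h0 : betaWeight (k + 1) (b + 1) 0 = 0 := by
    simp [betaWeight, Real.zero_rpow hk.ne']
  have h1 : betaWeight (k + 1) (b + 1) 1 = 0 := by
    simp [betaWeight, Real.zero_rpow (show b + 1 ≠ 0 by linarith)]
  exact ⟨by simpa [h0] using (hc.tendsto 0).mono_left nhdsWithin_le_nhds,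
    by simpa [h1] using (hc.tendsto 1).mono_left nhdsWithin_le_nhds⟩

theorem hasDerivAt_betaWeight {k b t : ℝ} (ht : t ∈ Ioo (0 : ℝ) 1) :
    HasDerivAt (betaWeight (k + 1) (b + 1))
      (betaWeight k b t * (k * (1 - t) - (b + 1) * t)) t := by
  have h1 := (hasDerivAt_id t).rpow_const (p := k) (Or.inl ht.1.ne')
  have h2 : HasDerivAt (fun t : ℝ => 1 - t) (-1) t := by
    simpa using (hasDerivAt_id t).const_sub 1
  have h3 := h2.rpow_const (p := b + 1) (Or.inl (by linarith [ht.2]))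
  have e : betaWeight (k + 1) (b + 1) = fun t => id t ^ k * (1 - t) ^ (b + 1) := by
    funext t; simp [betaWeight]
  rw [e]
  convert! h1.mul h3 using 1
  have e1 : t ^ k = t ^ (k - 1) * t := by
    rw [← Real.rpow_add_one ht.1.ne']; ring_nf
  have e2 : (1 - t) ^ (b + 1) = (1 - t) ^ b * (1 - t) :=
    Real.rpow_add_one (by linarith [ht.2]) _
  simp only [id, betaWeight, e1, e2, add_sub_cancel_right]; ring

theorem hasDerivAt_one_add_mul_rpow {w t N : ℝ} (hw : -(1 / 2) < w) (ht : t ∈ Ioo (0 : ℝ) 1) :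
    HasDerivAt (fun t => (1 + w * t) ^ (-N)) (-(N * w * (1 + w * t) ^ (-(N + 1)))) t := by
  have h := half_le_one_add_mul hw ht
  have h1 : HasDerivAt (fun t : ℝ => 1 + w * t) w t := by
    simpa using ((hasDerivAt_id t).const_mul w).const_add 1
  convert! h1.rpow_const (p := -N) (Or.inl (by linarith)) using 1
  rw [show -(N + 1) = -N - 1 by ring]; ring

/-- Integration by parts of `t^k (1-t)^(b+1) (1+wt)^(-N)`. -/
theorem betaInt_recurrence {k b N w : ℝ} (hk : 0 < k) (hb : -1 < b) (hN : 0 ≤ N)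
    (hw : -(1 / 2) < w) :
    k * betaInt k b N w - (k + 1 + b) * betaInt (k + 1) b N w
      = N * w * (betaInt (k + 1) b (N + 1) w - betaInt (k + 2) b (N + 1) w) := by
  have i0 := integrableOn_betaInt hk hb hN hw
  have i1 := integrableOn_betaInt (k := k + 1) (by linarith) hb hN hw
  have j1 := integrableOn_betaInt (k := k + 1) (N := N + 1) (by linarith) hb (by linarith) hw
  have j2 := integrableOn_betaInt (k := k + 2) (N := N + 1) (by linarith) hb (by linarith) hw
  obtain ⟨t0, t1⟩ := tendsto_betaWeight_zero hk hb
  have bd : ∀ t ∈ Ioo (0 : ℝ) 1, ‖betaWeight (k + 1) (b + 1) t * (1 + w * t) ^ (-N)‖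
      ≤ betaWeight (k + 1) (b + 1) t * (1 / 2) ^ (-N) := fun t ht => by
    have h := half_le_one_add_mul hw ht
    have h1 := betaWeight_pos (k := k + 1) (b := b + 1) ht
    rw [Real.norm_eq_abs, abs_of_nonneg (mul_nonneg h1.le (Real.rpow_nonneg (by linarith) _))]
    exact mul_le_mul_of_nonneg_left (one_add_mul_rpow_le hN hw ht) h1.le
  have h := setIntegral_Ioo_deriv_eq_zero
    (U := fun t => betaWeight (k + 1) (b + 1) t * (1 + w * t) ^ (-N))
    (U' := fun t => k * (betaWeight k b t * (1 + w * t) ^ (-N))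
      - (k + 1 + b) * (betaWeight (k + 1) b t * (1 + w * t) ^ (-N))
      - N * w * (betaWeight (k + 1) b t * (1 + w * t) ^ (-(N + 1))
        - betaWeight (k + 2) b t * (1 + w * t) ^ (-(N + 1))))
    (fun t ht => ?_)
    (((i0.const_mul _).sub (i1.const_mul _)).sub ((j1.sub j2).const_mul _))
    (squeeze_zero_norm' (by
      filter_upwards [Ioo_mem_nhdsGT (zero_lt_one (α := ℝ))] with t ht using bd t ht)
      (by simpa using t0.mul_const ((1 / 2 : ℝ) ^ (-N))))
    (squeeze_zero_norm' (by
      filter_upwards [Ioo_mem_nhdsLT (zero_lt_one (α := ℝ))] with t ht using bd t ht)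
      (by simpa using t1.mul_const ((1 / 2 : ℝ) ^ (-N))))
  · have a1 : IntegrableOn (fun t => k * (betaWeight k b t * (1 + w * t) ^ (-N))
        - (k + 1 + b) * (betaWeight (k + 1) b t * (1 + w * t) ^ (-N))) (Ioo 0 1) :=
      (i0.const_mul _).sub (i1.const_mul _)
    have a2 : IntegrableOn (fun t => N * w * (betaWeight (k + 1) b t * (1 + w * t) ^ (-(N + 1))
        - betaWeight (k + 2) b t * (1 + w * t) ^ (-(N + 1)))) (Ioo 0 1) :=
      (j1.sub j2).const_mul _
    rw [integral_sub a1 a2,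
      integral_sub (i0.const_mul _) (i1.const_mul _), integral_const_mul, integral_const_mul,
      integral_const_mul, integral_sub j1 j2] at h
    unfold betaInt
    linarith
  · convert! (hasDerivAt_betaWeight ht).mul (hasDerivAt_one_add_mul_rpow (N := N) hw ht) using 1
    rw [show k + 2 = k + 1 + 1 by ring, betaWeight_succ (k := k + 1) ht,
      betaWeight_succ_right (k := k + 1) ht, betaWeight_succ ht]
    ring

/-- Convexity of `G(t) = (1+wt)^(-N)`: the chord from `t` to `1` lies above the tangent at `t`.
After dividing by `G(t)` this is Bernoulli's inequality `(1+s)^(-N) ≥ 1 - Ns`. -/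
theorem rpow_neg_tangent {w t N : ℝ} (hN : 0 ≤ N) (hw : 0 ≤ w) (ht : t ∈ Ioo (0 : ℝ) 1) :
    (1 + w * t) ^ (-N) - (1 + w) ^ (-N) ≤ N * w * (1 + w * t) ^ (-(N + 1)) * (1 - t) := by
  have h0 : 0 < 1 + w * t := by nlinarith [ht.1]
  set s : ℝ := w * (1 - t) / (1 + w * t) with hs
  have hs0 : 0 ≤ s := div_nonneg (mul_nonneg hw (by linarith [ht.2])) h0.le
  have e1 : 1 + w = (1 + w * t) * (1 + s) := by rw [hs]; field_simp; ring
  have e2 : (1 + w) ^ (-N) = (1 + w * t) ^ (-N) * (1 + s) ^ (-N) := by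
    rw [e1, Real.mul_rpow h0.le (by linarith)]
  have e3 : 1 - N * s ≤ (1 + s) ^ (-N) := by
    rw [Real.rpow_def_of_pos (by linarith)]
    have h1 := Real.add_one_le_exp (Real.log (1 + s) * -N)
    have h2 := Real.log_le_sub_one_of_pos (show 0 < 1 + s by linarith)
    nlinarith
  have e4 : (1 + w * t) ^ (-N) = (1 + w * t) ^ (-(N + 1)) * (1 + w * t) := by
    rw [← Real.rpow_add_one h0.ne']; ring_nf
  have h3 := mul_le_mul_of_nonneg_left e3 (Real.rpow_nonneg h0.le (-N))
  rw [e2]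
  calc _ ≤ (1 + w * t) ^ (-N) * (N * s) := by linarith
    _ = _ := by rw [e4, hs]; field_simp

/-- The key bound: integrate `t^k (1-t)^b (G(t) - G(1))` by parts and use that
`G(t) = (1+wt)^(-N)` is convex. -/
theorem betaInt_key_bound {k b N w c : ℝ} (hk : 0 < k) (hb : -1 < b) (hN : 0 ≤ N)
    (hw : 0 ≤ w) (hc1 : c ≤ 1) (hcb : c ≤ 1 + b) :
    c * (N * w * betaInt (k + 1) b (N + 1) w) ≤ k * betaInt k b N w := by
  have hw' : -(1 / 2) < w := by linarith
  have i0 := integrableOn_betaInt hk hb hN hw'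
  have j1 := integrableOn_betaInt (k := k + 1) (N := N + 1) (by linarith) hb (by linarith) hw'
  obtain ⟨t0, t1⟩ := tendsto_betaWeight_zero hk hb
  -- Minus the slope of the chord of `G` from `t` to `1`; it lies between `0` and `-G'(t)`.
  -- Subtracting `G(1)` supplies a factor `1 - t`, so the boundary term at `1` vanishes even for
  -- negative `b`.
  set S : ℝ → ℝ := fun t => ((1 + w * t) ^ (-N) - (1 + w) ^ (-N)) / (1 - t) with hS
  have hS0 : ∀ t ∈ Ioo (0 : ℝ) 1, 0 ≤ S t := fun t ht => by
    refine div_nonneg (sub_nonneg.2 (Real.rpow_le_rpow_of_nonpos ?_ ?_ (by linarith)))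
      (by linarith [ht.2])
    · nlinarith [ht.1]
    · nlinarith [ht.2]
  have hS1 : ∀ t ∈ Ioo (0 : ℝ) 1, S t ≤ N * w * (1 + w * t) ^ (-(N + 1)) := fun t ht => by
    rw [hS]; simp only
    rw [div_le_iff₀ (by linarith [ht.2])]
    exact rpow_neg_tangent hN hw ht
  have hH : ∀ t ∈ Ioo (0 : ℝ) 1, (1 + w * t) ^ (-(N + 1)) ≤ 1 := fun t ht =>
    Real.rpow_le_one_of_one_le_of_nonpos (by nlinarith [ht.1]) (by linarith)
  have hSm : Measurable S := by rw [hS]; fun_prop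
  have hNw : 0 ≤ N * w := mul_nonneg hN hw
  have hS2 : ∀ t ∈ Ioo (0 : ℝ) 1, S t ≤ N * w := fun t ht =>
    (hS1 t ht).trans (mul_le_of_le_one_right hNw (hH t ht))
  have hSt : ∀ t ∈ Ioo (0 : ℝ) 1,
      betaWeight (k + 1) b t * ((1 + w * t) ^ (-N) - (1 + w) ^ (-N))
        = betaWeight (k + 1) (b + 1) t * S t := fun t ht => by
    have : 1 - t ≠ 0 := by linarith [ht.2]
    rw [betaWeight_succ_right ht, hS]; field_simp
  have i2 : IntegrableOn (fun t => betaWeight (k + 1) b t * S t) (Ioo 0 1) :=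
    integrableOn_betaWeight_mul (C := N * w) (by linarith) hb hSm fun t ht => by
      rw [abs_of_nonneg (hS0 t ht)]; exact hS2 t ht
  have i3 : IntegrableOn (fun t => betaWeight k b t) (Ioo 0 1) := integrableOn_betaWeight hk hb
  have bd : ∀ t ∈ Ioo (0 : ℝ) 1, ‖betaWeight (k + 1) b t * ((1 + w * t) ^ (-N) - (1 + w) ^ (-N))‖
      ≤ betaWeight (k + 1) (b + 1) t * (N * w) := fun t ht => by
    have h1 := betaWeight_pos (k := k + 1) (b := b + 1) ht
    rw [hSt t ht, Real.norm_eq_abs, abs_of_nonneg (mul_nonneg h1.le (hS0 t ht))]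
    exact mul_le_mul_of_nonneg_left (hS2 t ht) h1.le
  have hint : IntegrableOn (fun t => k * (betaWeight k b t * (1 + w * t) ^ (-N))
      - k * (1 + w) ^ (-N) * betaWeight k b t
      - N * w * (betaWeight (k + 1) b t * (1 + w * t) ^ (-(N + 1)))
      - b * (betaWeight (k + 1) b t * S t)) (Ioo 0 1) :=
    (((i0.const_mul _).sub (i3.const_mul _)).sub (j1.const_mul _)).sub (i2.const_mul _)
  have h := setIntegral_Ioo_deriv_eq_zero
    (U := fun t => betaWeight (k + 1) b t * ((1 + w * t) ^ (-N) - (1 + w) ^ (-N)))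
    (fun t ht => ?_) hint
    (squeeze_zero_norm' (by
      filter_upwards [Ioo_mem_nhdsGT (zero_lt_one (α := ℝ))] with t ht using bd t ht)
      (by simpa using t0.mul_const (N * w)))
    (squeeze_zero_norm' (by
      filter_upwards [Ioo_mem_nhdsLT (zero_lt_one (α := ℝ))] with t ht using bd t ht)
      (by simpa using t1.mul_const (N * w)))
  · have hle : ∫ t in Ioo (0 : ℝ) 1, (k * (betaWeight k b t * (1 + w * t) ^ (-N))
        - k * (1 + w) ^ (-N) * betaWeight k b t
        - N * w * (betaWeight (k + 1) b t * (1 + w * t) ^ (-(N + 1)))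
        - b * (betaWeight (k + 1) b t * S t))
        ≤ ∫ t in Ioo (0 : ℝ) 1, (k * (betaWeight k b t * (1 + w * t) ^ (-N))
          - c * (N * w) * (betaWeight (k + 1) b t * (1 + w * t) ^ (-(N + 1)))) := by
      refine setIntegral_mono_on hint ((i0.const_mul _).sub (j1.const_mul _)) measurableSet_Ioo
        fun t ht => ?_
      have w0 := betaWeight_pos (k := k) (b := b) ht
      have w1 := betaWeight_pos (k := k + 1) (b := b) ht
      have g1 : 0 ≤ k * (1 + w) ^ (-N) * betaWeight k b t := by positivity
      have g2 : 0 ≤ betaWeight (k + 1) b t *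
          ((1 - c) * (N * w * (1 + w * t) ^ (-(N + 1))) + b * S t) := by
        refine mul_nonneg w1.le ?_
        have s0 := hS0 t ht
        have s1 := hS1 t ht
        -- For `b ≥ 0` the terms are nonnegative by `S ≥ 0` and `c ≤ 1`; for `b ≤ 0` the bound `S ≤
        -- -G'` and `c ≤ 1 + b` are needed.
        rcases le_total 0 b with hb0 | hb0
        · have : 0 ≤ (1 - c) * (N * w * (1 + w * t) ^ (-(N + 1))) :=
            mul_nonneg (by linarith) (s0.trans s1)
          have := mul_nonneg hb0 s0
          linarith
        · nlinarith
      nlinarith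
    rw [h, integral_sub (i0.const_mul _) (j1.const_mul _), integral_const_mul,
      integral_const_mul] at hle
    unfold betaInt
    linarith
  · have h1 := (hasDerivAt_one_add_mul_rpow (N := N) hw' ht).sub_const ((1 + w) ^ (-N))
    have hb1 : HasDerivAt (betaWeight (k + 1) b)
        (betaWeight k (b - 1) t * (k * (1 - t) - b * t)) t := by
      have := hasDerivAt_betaWeight (k := k) (b := b - 1) ht
      simpa using this
    convert! hb1.mul h1 using 1
    have e : betaWeight k b t = betaWeight k (b - 1) t * (1 - t) := by
      have := betaWeight_succ_right (k := k) (b := b - 1) ht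
      simpa using this
    have : 1 - t ≠ 0 := by linarith [ht.2]
    rw [betaWeight_succ ht, e, hS]; field_simp; ring

end

/-! ### The shrinkage factor: bounds on its size and on its logarithmic derivative. -/

section

/-- The shrinkage factor: the mean of the density proportional to
`t^(k-1) (1-t)^b (1+wt)^(-N)` on `(0, 1)`. -/
noncomputable def shrink (k b N w : ℝ) : ℝ := betaInt (k + 1) b N w / betaInt k b N w

/-- The derivative of `shrink k b N`. -/
noncomputable def shrinkDeriv (k b N w : ℝ) : ℝ :=
  (N * betaInt (k + 1) b (N + 1) w * betaInt (k + 1) b N w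
    - N * betaInt (k + 2) b (N + 1) w * betaInt k b N w) / betaInt k b N w ^ 2

theorem measurable_betaInt (k b N : ℝ) : Measurable (betaInt k b N) := by
  have h : StronglyMeasurable (fun q : ℝ × ℝ => betaWeight k b q.2 * (1 + q.1 * q.2) ^ (-N)) :=
    (((measurable_betaWeight k b).comp measurable_snd).mul (by fun_prop)).stronglyMeasurable
  exact (h.integral_prod_right (ν := volume.restrict (Ioo (0 : ℝ) 1))).measurable

theorem measurable_shrink (k b N : ℝ) : Measurable (shrink k b N) :=
  (measurable_betaInt _ _ _).div (measurable_betaInt _ _ _)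

theorem measurable_shrinkDeriv (k b N : ℝ) : Measurable (shrinkDeriv k b N) :=
  ((((measurable_betaInt _ _ _).const_mul _).mul (measurable_betaInt _ _ _)).sub
    (((measurable_betaInt _ _ _).const_mul _).mul (measurable_betaInt _ _ _))).div
    ((measurable_betaInt _ _ _).pow_const _)

theorem shrink_pos {k b N w : ℝ} (hk : 0 < k) (hb : -1 < b) (hN : 0 ≤ N) (hw : -(1 / 2) < w) :
    0 < shrink k b N w :=
  div_pos (betaInt_pos (by linarith) hb hN hw) (betaInt_pos hk hb hN hw)

theorem shrink_lt_one {k b N w : ℝ} (hk : 0 < k) (hb : -1 < b) (hN : 0 ≤ N)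
    (hw : -(1 / 2) < w) : shrink k b N w < 1 :=
  (div_lt_one (betaInt_pos hk hb hN hw)).2 (betaInt_succ_lt hk hb hN hw)

theorem hasDerivAt_shrink {k b N w : ℝ} (hk : 0 < k) (hb : -1 < b) (hN : 0 ≤ N)
    (hw : -(1 / 2) < w) : HasDerivAt (shrink k b N) (shrinkDeriv k b N w) w := by
  have h := (hasDerivAt_betaInt (k := k + 1) (by linarith) hb hN hw).div
    (hasDerivAt_betaInt hk hb hN hw) (betaInt_pos hk hb hN hw).ne'
  convert! h using 1
  rw [shrinkDeriv, show k + 1 + 1 = k + 2 by ring]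
  ring

/-- The key bound is used with exponent `N - 1`, and `betaInt_eq_add` rewrites its right side with
exponent `N`. Both sides then contain `w * betaInt (k + 1) b N w`, and solving for it gives the
estimate. -/
theorem mul_shrink_le {k b N w c : ℝ} (hk : 0 < k) (hb : -1 < b) (hN : 1 ≤ N) (hw : 0 ≤ w)
    (hc1 : c ≤ 1) (hcb : c ≤ 1 + b) (hpos : 0 < c * (N - 1) - k) :
    w * shrink k b N w ≤ k / (c * (N - 1) - k) := by
  have hw' : -(1 / 2) < w := by linarith
  have h := betaInt_key_bound (N := N - 1) hk hb (by linarith) hw hc1 hcb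
  rw [betaInt_eq_add (N := N - 1) hk hb (by linarith) hw', sub_add_cancel] at h
  have h0 := betaInt_pos (N := N) hk hb (by linarith) hw'
  rw [le_div_iff₀ hpos, shrink, mul_div_assoc', div_mul_eq_mul_div, div_le_iff₀ h0]
  linarith

/-- A crude bound, needed only for integrability. By `betaInt_eq_add`, a factor `w` times an
integral of exponent `N + 1` is at most the integral of exponent `N` with first parameter one lower.
-/
theorem abs_mul_shrinkDeriv_le {k b N w : ℝ} (hk : 0 < k) (hb : -1 < b) (hN : 0 ≤ N)
    (hw : 0 ≤ w) : |w * shrinkDeriv k b N w| ≤ N := by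
  have hw' : -(1 / 2) < w := by linarith
  have h0 := betaInt_pos hk hb hN hw'
  have h1 := betaInt_pos (k := k + 1) (by linarith) hb hN hw'
  have h10 := betaInt_succ_lt hk hb hN hw'
  have j0 := betaInt_pos (N := N + 1) hk hb (by linarith) hw'
  have j1 := betaInt_pos (k := k + 1) (N := N + 1) (by linarith) hb (by linarith) hw'
  have j2 := betaInt_pos (k := k + 2) (N := N + 1) (by linarith) hb (by linarith) hw'
  have e0 := betaInt_eq_add hk hb hN hw'
  have e1 := betaInt_eq_add (k := k + 1) (by linarith) hb hN hw'
  rw [show k + 1 + 1 = k + 2 by ring] at e1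
  rw [shrinkDeriv, mul_div_assoc', abs_div, abs_of_pos (pow_pos h0 2), div_le_iff₀ (pow_pos h0 2)]
  have a1 : 0 ≤ w * betaInt (k + 1) b (N + 1) w := mul_nonneg hw j1.le
  have a2 : 0 ≤ w * betaInt (k + 2) b (N + 1) w := mul_nonneg hw j2.le
  have b1 : w * betaInt (k + 1) b (N + 1) w * betaInt (k + 1) b N w ≤ betaInt k b N w ^ 2 := by
    rw [sq]; exact mul_le_mul (by linarith) h10.le h1.le h0.le
  have b2 : w * betaInt (k + 2) b (N + 1) w * betaInt k b N w ≤ betaInt k b N w ^ 2 := by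
    rw [sq]; exact mul_le_mul_of_nonneg_right (by linarith) h0.le
  have c1 := mul_le_mul_of_nonneg_left b1 hN
  have c2 := mul_le_mul_of_nonneg_left b2 hN
  have d1 := mul_nonneg hN (mul_nonneg a1 h1.le)
  have d2 := mul_nonneg hN (mul_nonneg a2 h0.le)
  rw [abs_le]
  constructor <;> nlinarith

/-- `1 + w ρ'/ρ = -b + (1 - ρ) Y / I₁` with `Y = (k+1+b) I₁ - N w J₂`. -/
theorem mul_shrinkDeriv_eq {k b N w : ℝ} (hk : 0 < k) (hb : -1 < b) (hN : 0 ≤ N)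
    (hw : 0 ≤ w) :
    w * shrinkDeriv k b N w = shrink k b N w * (-1 - b + (1 - shrink k b N w) *
      (k * betaInt k b N w - N * w * betaInt (k + 1) b (N + 1) w) / betaInt (k + 1) b N w) := by
  have hw' : -(1 / 2) < w := by linarith
  have h0 := betaInt_pos hk hb hN hw'
  have h1 := betaInt_pos (k := k + 1) (by linarith) hb hN hw'
  have r := betaInt_recurrence hk hb hN hw'
  rw [shrinkDeriv, shrink]
  field_simp
  linear_combination (-betaInt k b N w) * r

/-- Jensen's inequality for the convex function `t/(1-t)` under the density proportional to `t^(k-1)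
(1-t)^b (1+wt)^(-N)`, with denominators cleared. The condition `b > 0` makes the mean of `t/(1-t)`
finite. -/
theorem betaInt_jensen {k b N w : ℝ} (hk : 0 < k) (hb : 0 < b) (hN : 0 ≤ N) (hw : 0 ≤ w) :
    betaInt (k + 1) b N w * betaInt k b N w
      ≤ (betaInt k b N w - betaInt (k + 1) b N w) * betaInt (k + 1) (b - 1) N w := by
  have hw' : -(1 / 2) < w := by linarith
  have i0 := integrableOn_betaInt (N := N) hk (by linarith : -1 < b) hN hw'
  have i1 := integrableOn_betaInt (k := k + 1) (N := N) (by linarith) (by linarith : -1 < b) hN hw'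
  have ix := integrableOn_betaInt (k := k + 1) (N := N) (b := b - 1) (by linarith) (by linarith)
    hN hw'
  have h0 := betaInt_pos (N := N) hk (by linarith : -1 < b) hN hw'
  set m : ℝ := betaInt (k + 1) b N w / betaInt k b N w with hm
  have hm1 : 0 < 1 - m := sub_pos.2 (shrink_lt_one hk (by linarith) hN hw')
  -- The affine function `m/(1-m) + (t-m)/(1-m)²` is the tangent of `t/(1-t)` at the mean `m`.
  have h : ∫ t in Ioo (0 : ℝ) 1, ((m / (1 - m) - m / (1 - m) ^ 2)
        * (betaWeight k b t * (1 + w * t) ^ (-N))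
        + 1 / (1 - m) ^ 2 * (betaWeight (k + 1) b t * (1 + w * t) ^ (-N)))
      ≤ ∫ t in Ioo (0 : ℝ) 1, betaWeight (k + 1) (b - 1) t * (1 + w * t) ^ (-N) := by
    refine setIntegral_mono_on ((i0.const_mul _).add (i1.const_mul _)) ix measurableSet_Ioo
      fun t ht => ?_
    have ht1 : 0 < 1 - t := by linarith [ht.2]
    have e : betaWeight k b t = betaWeight k (b - 1) t * (1 - t) := by
      have := betaWeight_succ_right (k := k) (b := b - 1) ht
      simpa using this
    have hpos : 0 ≤ betaWeight k (b - 1) t * (1 + w * t) ^ (-N) :=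
      mul_nonneg (betaWeight_pos ht).le (Real.rpow_nonneg (by nlinarith [ht.1]) _)
    have key : (1 - t) * ((m / (1 - m) - m / (1 - m) ^ 2) + 1 / (1 - m) ^ 2 * t) ≤ t := by
      have : t - (1 - t) * ((m / (1 - m) - m / (1 - m) ^ 2) + 1 / (1 - m) ^ 2 * t)
          = ((t - m) / (1 - m)) ^ 2 := by
        field_simp; ring
      nlinarith [sq_nonneg ((t - m) / (1 - m))]
    rw [betaWeight_succ ht, betaWeight_succ ht, e]
    have := mul_le_mul_of_nonneg_left key hpos
    linarith
  rw [integral_add (i0.const_mul _) (i1.const_mul _), integral_const_mul,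
    integral_const_mul] at h
  have e1 : betaInt (k + 1) b N w = m * betaInt k b N w := by rw [hm]; field_simp
  have h' : m / (1 - m) * betaInt k b N w ≤ betaInt (k + 1) (b - 1) N w := by
    have : (m / (1 - m) - m / (1 - m) ^ 2) * betaInt k b N w
        + 1 / (1 - m) ^ 2 * betaInt (k + 1) b N w = m / (1 - m) * betaInt k b N w := by
      rw [e1]; ring
    rw [← this]; exact h
  have h2 := mul_le_mul_of_nonneg_left h' (mul_pos hm1 h0).le
  have e2 : (1 - m) * betaInt k b N w * (m / (1 - m) * betaInt k b N w)
      = m * betaInt k b N w * betaInt k b N w := by field_simp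
  rw [e1]
  calc _ = (1 - m) * betaInt k b N w * (m / (1 - m) * betaInt k b N w) := e2.symm
    _ ≤ _ := h2
    _ = _ := by ring

/-- This is the case without loss, `L = 0`: the function `wρ(w)` is nondecreasing on `w ≥ 0`. -/
theorem neg_shrink_le_of_nonneg {k b N w : ℝ} (hk : 0 < k) (hb : 0 ≤ b) (hN : 0 ≤ N)
    (hw : 0 ≤ w) : -shrink k b N w ≤ w * shrinkDeriv k b N w := by
  have hw' : -(1 / 2) < w := by linarith
  have hb1 : -1 < b := by linarith
  have h0 := betaInt_pos hk hb1 hN hw'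
  have h1 := betaInt_pos (k := k + 1) (by linarith) hb1 hN hw'
  have hr0 := shrink_pos hk hb1 hN hw'
  have hr1 := shrink_lt_one hk hb1 hN hw'
  rw [mul_shrinkDeriv_eq hk hb1 hN hw]
  suffices h : b ≤ (1 - shrink k b N w) *
      (k * betaInt k b N w - N * w * betaInt (k + 1) b (N + 1) w) / betaInt (k + 1) b N w by
    nlinarith
  -- At `b = 0` the exponent `b - 1` is not integrable, so the sign is read off the key bound with
  -- `c = 1`. For `b > 0` the recurrence at `b - 1` evaluates the bracket as `b * betaInt (k + 1) (b
  -- - 1) N w`, and Jensen finishes.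
  rcases hb.eq_or_lt with rfl | hb0
  · have := betaInt_key_bound (c := 1) hk hb1 hN hw le_rfl (by simp)
    exact div_nonneg (mul_nonneg (by linarith) (by linarith)) h1.le
  · have r := betaInt_recurrence (b := b - 1) hk (by linarith) hN hw'
    have s1 : ∀ j > 0, ∀ M ≥ 0, betaInt j b M w
        = betaInt j (b - 1) M w - betaInt (j + 1) (b - 1) M w := fun j hj M hM => by
      unfold betaInt
      rw [← integral_sub (integrableOn_betaInt hj (by linarith) hM hw')
        (integrableOn_betaInt (by linarith) (by linarith) hM hw')]
      refine setIntegral_congr_fun measurableSet_Ioo fun t ht => ?_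
      have e := betaWeight_succ_right (k := j) (b := b - 1) ht
      rw [sub_add_cancel] at e
      simp only [betaWeight_succ ht, e]; ring
    have y : k * betaInt k b N w - N * w * betaInt (k + 1) b (N + 1) w
        = b * betaInt (k + 1) (b - 1) N w := by
      rw [s1 k hk N hN, s1 (k + 1) (by linarith) (N + 1) (by linarith),
        show k + 1 + 1 = k + 2 by ring]
      linarith
    have J := betaInt_jensen hk hb0 hN hw
    rw [y, le_div_iff₀ h1, shrink, one_sub_div h0.ne', div_mul_eq_mul_div, le_div_iff₀ h0]
    nlinarith

/-- Here Jensen is unavailable. The recurrence rewrites the bracket of `mul_shrinkDeriv_eq` with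
parameters `k + 1`, `k + 2`, and the key bound at `k + 1` with `c = 1 + b` bounds it below by `b -
L` times `betaInt (k + 1) b N w`, where `L = -b(k+1)/(1+b)`. As `b - L ≤ 0`, the factor `1 - ρ` in
`(0,1)` does no harm. -/
theorem neg_shrink_le_of_neg {k b N w : ℝ} (hk : 0 < k) (hb : -1 < b) (hb0 : b ≤ 0)
    (hN : 0 ≤ N) (hw : 0 ≤ w) :
    -(1 + -b * (k + 1) / (1 + b)) * shrink k b N w ≤ w * shrinkDeriv k b N w := by
  have hw' : -(1 / 2) < w := by linarith
  have h1 := betaInt_pos (k := k + 1) (by linarith) hb hN hw'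
  have hr0 := shrink_pos hk hb hN hw'
  have hr1 := shrink_lt_one hk hb hN hw'
  have hb1 : 0 < 1 + b := by linarith
  have key := betaInt_key_bound (k := k + 1) (c := 1 + b) (by linarith) hb hN hw (by linarith)
    le_rfl
  rw [show k + 1 + 1 = k + 2 by ring] at key
  have r := betaInt_recurrence hk hb hN hw'
  rw [mul_shrinkDeriv_eq hk hb hN hw]
  have Y : b + b * (k + 1) / (1 + b)
      ≤ (k * betaInt k b N w - N * w * betaInt (k + 1) b (N + 1) w) / betaInt (k + 1) b N w := by
    rw [le_div_iff₀ h1]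
    have e : (b + b * (k + 1) / (1 + b)) * betaInt (k + 1) b N w
        = (k + 1 + b) * betaInt (k + 1) b N w - (k + 1) * betaInt (k + 1) b N w / (1 + b) := by
      field_simp; ring
    have h2 : N * w * betaInt (k + 2) b (N + 1) w
        ≤ (k + 1) * betaInt (k + 1) b N w / (1 + b) := by
      rw [le_div_iff₀ hb1]; linarith
    rw [e]; linarith
  have hneg : b + b * (k + 1) / (1 + b) ≤ 0 := by
    have : b * (k + 1) / (1 + b) ≤ 0 :=
      div_nonpos_of_nonpos_of_nonneg (mul_nonpos_of_nonpos_of_nonneg hb0 (by linarith)) hb1.le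
    linarith
  have h3 : b + b * (k + 1) / (1 + b) ≤ (1 - shrink k b N w) *
      (k * betaInt k b N w - N * w * betaInt (k + 1) b (N + 1) w) / betaInt (k + 1) b N w := by
    rw [mul_div_assoc (1 - shrink k b N w)]
    calc b + b * (k + 1) / (1 + b)
        ≤ (1 - shrink k b N w) * (b + b * (k + 1) / (1 + b)) := by nlinarith
      _ ≤ _ := mul_le_mul_of_nonneg_left Y (by linarith)
  have e2 : -b * (k + 1) / (1 + b) = -(b * (k + 1) / (1 + b)) := by ring
  rw [e2]
  nlinarith

/-- The conditions on a shrinkage function `ρ` (with derivative `ρ'`) under which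
`(1 - ρ(‖x‖²/‖z‖²)) x` dominates `x`. -/
structure IsGoodShrinkage (p n : ℕ) (r r' : ℝ → ℝ) : Prop where
  measurable : Measurable r
  measurable_deriv : Measurable r'
  hasDerivAt : ∀ w, 0 ≤ w → HasDerivAt r (r' w) w
  nonneg : ∀ w, 0 ≤ w → 0 ≤ r w
  le_one : ∀ w, 0 ≤ w → r w ≤ 1
  bounded : ∃ B, ∀ w, 0 ≤ w → w * r w ≤ B
  bounded_deriv : ∃ C, ∀ w, 0 ≤ w → |w * r' w| ≤ C
  div_nonpos : ∀ w, 0 ≤ w → -2 * p * r w - 4 * (w * r' w) + (n - 2) * (w * r w) * r w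
    - 4 * (w * r w) * (w * r' w) ≤ 0

/-- Replacing `s` by its lower bound leaves `r` times `-2(p-2) + 4L + wr(n + 2 + 4L)`, which is
nonpositive once `wr ≤ B`. -/
theorem div_nonpos_of_bounds {p n r s w L B : ℝ} (hr : 0 ≤ r) (hw : 0 ≤ w) (hL : 0 ≤ L)
    (hn : 0 ≤ n) (hs : -(1 + L) * r ≤ s) (hB : w * r ≤ B)
    (h : B * (n + 2 + 4 * L) ≤ 2 * (p - 2) - 4 * L) :
    -2 * p * r - 4 * s + (n - 2) * (w * r) * r - 4 * (w * r) * s ≤ 0 := by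
  have h1 : 0 ≤ w * r := mul_nonneg hw hr
  have h2 : w * r * (n + 2 + 4 * L) ≤ 2 * (p - 2) - 4 * L :=
    (mul_le_mul_of_nonneg_right hB (by linarith)).trans h
  have h3 := mul_le_mul_of_nonneg_left hs (show 0 ≤ 4 * (1 + w * r) by linarith)
  have h4 := mul_le_mul_of_nonneg_left h2 hr
  linarith

theorem isGoodShrinkage_of_bounds {p n : ℕ} {k b N L B : ℝ} (hk : 0 < k) (hb : -1 < b)
    (hN : 0 ≤ N) (hL : 0 ≤ L) (hB : ∀ w, 0 ≤ w → w * shrink k b N w ≤ B)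
    (hs : ∀ w, 0 ≤ w → -(1 + L) * shrink k b N w ≤ w * shrinkDeriv k b N w)
    (h : B * (n + 2 + 4 * L) ≤ 2 * (p - 2) - 4 * L) :
    IsGoodShrinkage p n (shrink k b N) (shrinkDeriv k b N) where
  measurable := measurable_shrink _ _ _
  measurable_deriv := measurable_shrinkDeriv _ _ _
  hasDerivAt w hw := hasDerivAt_shrink hk hb hN (by linarith)
  nonneg w hw := (shrink_pos hk hb hN (by linarith)).le
  le_one w hw := (shrink_lt_one hk hb hN (by linarith)).le
  bounded := ⟨B, hB⟩
  bounded_deriv := ⟨N, fun w hw => abs_mul_shrinkDeriv_le hk hb hN hw⟩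
  div_nonpos w hw := div_nonpos_of_bounds (shrink_pos hk hb hN (by linarith)).le hw hL
    (Nat.cast_nonneg n) (hs w hw) (hB w hw) h

/-- With `N = k + 1 + q` and `c = 1` the denominator `c(N-1) - k` of `mul_shrink_le` is `q`; in the
next lemma, `c = 1 + b` makes it `(1+b)q + bk`. -/
theorem isGoodShrinkage_of_nonneg {p n : ℕ} {k b q : ℝ} (hk : 0 < k) (hb : 0 ≤ b) (hq : 0 < q)
    (h : k * (n + 2) ≤ 2 * (p - 2) * q) :
    IsGoodShrinkage p n (shrink k b (k + 1 + q)) (shrinkDeriv k b (k + 1 + q)) := by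
  refine isGoodShrinkage_of_bounds (L := 0) (B := k / q) hk (by linarith) (by linarith) le_rfl
    (fun w hw => ?_) (fun w hw => ?_) ?_
  · have := mul_shrink_le (c := 1) (N := k + 1 + q) hk (by linarith : -1 < b) (by linarith) hw
      le_rfl (by linarith) (by linarith)
    convert! this using 2; ring
  · simpa using neg_shrink_le_of_nonneg hk hb (by linarith : 0 ≤ k + 1 + q) hw
  · rw [div_mul_eq_mul_div, div_le_iff₀ hq]; linarith

theorem isGoodShrinkage_of_neg {p n : ℕ} {k b q L : ℝ} (hk : 0 < k) (hb : -1 < b) (hb0 : b ≤ 0)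
    (hq : 0 < q) (hL : L = -b * (k + 1) / (1 + b)) (hX : 0 < (1 + b) * q + b * k)
    (h : k * (n + 2 + 4 * L) ≤ (2 * (p - 2) - 4 * L) * ((1 + b) * q + b * k)) :
    IsGoodShrinkage p n (shrink k b (k + 1 + q)) (shrinkDeriv k b (k + 1 + q)) := by
  have hL0 : 0 ≤ L := by
    rw [hL]; exact div_nonneg (mul_nonneg (by linarith) (by linarith)) (by linarith)
  refine isGoodShrinkage_of_bounds (L := L) (B := k / ((1 + b) * q + b * k)) hk hb (by linarith)
    hL0 (fun w hw => ?_) (fun w hw => ?_) ?_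
  · have := mul_shrink_le (c := 1 + b) (N := k + 1 + q) hk hb (by linarith) hw
      (by linarith) le_rfl (by linarith)
    convert! this using 2; ring
  · rw [hL]; exact neg_shrink_le_of_neg hk hb hb0 (by linarith) hw
  · rw [div_mul_eq_mul_div, div_le_iff₀ hX]; linarith

end

/-! ### Stein's identity for spherically symmetric densities with compactly supported profile. -/

section

theorem integrable_of_bounded_of_eq_zero {α : Type*} [MeasurableSpace α] {μ : Measure α}
    {h : α → ℝ} {K : Set α} {C : ℝ} (hm : Measurable h) (hK : MeasurableSet K) (hμ : μ K < ∞)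
    (hC : ∀ y ∈ K, |h y| ≤ C) (h0 : ∀ y, y ∉ K → h y = 0) : Integrable h μ := by
  rw [← integrableOn_iff_integrable_of_support_subset
    (s := K) (fun y hy => by_contra fun hn => hy (h0 y hn))]
  exact Measure.integrableOn_of_bounded hμ.ne hm.aestronglyMeasurable
    ((ae_restrict_iff' hK).2 (Eventually.of_forall hC))

/-- `½ ∫_t^T f`. -/
noncomputable def halfTail (f : ℝ → ℝ) (T t : ℝ) : ℝ := (1 / 2) * ∫ s in t..T, f s

theorem hasDerivAt_halfTail {f : ℝ → ℝ} (hf : Continuous f) (T t : ℝ) :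
    HasDerivAt (halfTail f T) (-(f t) / 2) t := by
  have h := (intervalIntegral.integral_hasDerivAt_left (hf.intervalIntegrable t T)
    (hf.stronglyMeasurableAtFilter _ _) hf.continuousAt).const_mul (1 / 2 : ℝ)
  convert! h using 1; ring

theorem continuous_halfTail {f : ℝ → ℝ} (hf : Continuous f) (T : ℝ) :
    Continuous (halfTail f T) :=
  continuous_iff_continuousAt.2 fun t => (hasDerivAt_halfTail hf T t).continuousAt

theorem halfTail_eq_zero {f : ℝ → ℝ} {T t : ℝ} (hT : ∀ s, T ≤ s → f s = 0) (ht : T ≤ t) :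
    halfTail f T t = 0 := by
  rw [halfTail, intervalIntegral.integral_symm,
    intervalIntegral.integral_congr (g := fun _ => 0)]
  · simp
  · intro s hs
    rw [uIcc_of_le ht] at hs
    exact hT s hs.1

theorem halfTail_nonneg {f : ℝ → ℝ} {T : ℝ} (hf0 : ∀ s, 0 ≤ f s) (hT : ∀ s, T ≤ s → f s = 0)
    (t : ℝ) : 0 ≤ halfTail f T t := by
  rcases le_total t T with h | h
  · exact mul_nonneg (by norm_num) (intervalIntegral.integral_nonneg h fun s _ => hf0 s)
  · exact (halfTail_eq_zero hT h).ge

theorem norm_add_single_sq {d : ℕ} (y : Euc d) (i : Fin d) (t : ℝ) :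
    ‖y + t • EuclideanSpace.single i (1 : ℝ)‖ ^ 2 = ‖y‖ ^ 2 + 2 * y i * t + t ^ 2 := by
  rw [norm_add_sq_real, inner_smul_right, norm_smul, PiLp.norm_single]
  have : inner ℝ y (EuclideanSpace.single i (1 : ℝ)) = y i := by
    rw [EuclideanSpace.inner_single_right]; simp
  rw [this]; simp; ring

theorem hasDerivAt_norm_add_single_sq {d : ℕ} (y : Euc d) (i : Fin d) :
    HasDerivAt (fun t : ℝ => ‖y + t • EuclideanSpace.single i (1 : ℝ)‖ ^ 2) (2 * y i) 0 := by
  simp only [norm_add_single_sq]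
  have h := (((hasDerivAt_id (0 : ℝ)).const_mul (2 * y i)).const_add (‖y‖ ^ 2)).add
    ((hasDerivAt_id (0 : ℝ)).pow 2)
  convert! h using 1; simp

/-- A function that is bounded on bounded sets. -/
def BoundedOnBounded {E : Type*} [NormedAddCommGroup E] (g : E → ℝ) : Prop :=
  ∀ R : ℝ, ∃ C : ℝ, ∀ y, ‖y‖ ≤ R → |g y| ≤ C

theorem integrable_mul_radial {E : Type*} [NormedAddCommGroup E] [MeasurableSpace E]
    [BorelSpace E] [ProperSpace E] {μ : Measure E} [IsFiniteMeasureOnCompacts μ]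
    {g m : E → ℝ} {ψ : ℝ → ℝ} {T R : ℝ} (hg : Measurable g) (hgb : BoundedOnBounded g)
    (hψ : Continuous ψ) (hψ0 : ∀ t, T ≤ t → ψ t = 0) (hm : Measurable m) (hm0 : ∀ y, 0 ≤ m y)
    (hR : ∀ y, m y < T → ‖y‖ ≤ R) : Integrable (fun y => g y * ψ (m y)) μ := by
  obtain ⟨C, hC⟩ := hgb R
  obtain ⟨D, hD⟩ := (isCompact_Icc (a := (0 : ℝ)) (b := T)).exists_bound_of_continuousOn
    hψ.continuousOn
  refine integrable_of_bounded_of_eq_zero (K := {y | m y < T} ) (C := C * D)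
    (hg.mul (hψ.measurable.comp hm)) (measurableSet_lt hm measurable_const) ?_ ?_ ?_
  · refine (measure_mono (t := Metric.closedBall 0 R) fun y hy => ?_).trans_lt
      (isCompact_closedBall _ _).measure_lt_top
    simpa using hR y hy
  · intro y hy
    rw [abs_mul]
    exact mul_le_mul (hC y (hR y hy)) (hD _ ⟨hm0 y, le_of_lt hy⟩) (abs_nonneg _)
      ((abs_nonneg _).trans (hC y (hR y hy)))
  · intro y hy
    rw [hψ0 _ (not_lt.1 hy), mul_zero]

theorem boundedOnBounded_mul {E : Type*} [NormedAddCommGroup E] {g h : E → ℝ}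
    (hg : BoundedOnBounded g) (hh : BoundedOnBounded h) :
    BoundedOnBounded (fun y => g y * h y) := fun R => by
  obtain ⟨C, hC⟩ := hg R
  obtain ⟨D, hD⟩ := hh R
  refine ⟨C * D, fun y hy => ?_⟩
  rw [abs_mul]
  exact mul_le_mul (hC y hy) (hD y hy) (abs_nonneg _) ((abs_nonneg _).trans (hC y hy))

theorem boundedOnBounded_of_continuous {E : Type*} [NormedAddCommGroup E] [ProperSpace E]
    {g : E → ℝ} (hg : Continuous g) : BoundedOnBounded g := fun R => by
  obtain ⟨C, hC⟩ := (isCompact_closedBall (0 : E) R).exists_bound_of_continuousOn hg.continuousOn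
  exact ⟨C, fun y hy => hC y (by simpa using hy)⟩

theorem norm_le_of_sub_sq_lt {E : Type*} [NormedAddCommGroup E] {u y : E} {c T : ℝ} (hc : 0 ≤ c)
    (h : ‖y - u‖ ^ 2 + c < T) : ‖y‖ ≤ ‖u‖ + (T + 1) := by
  have h1 : ‖y‖ ≤ ‖u‖ + ‖y - u‖ := by
    simpa using norm_add_le u (y - u)
  nlinarith [sq_nonneg (‖y - u‖ - 1), norm_nonneg (y - u)]

/-- Stein's identity for the spherically symmetric density `f (‖y - u‖² + c)`. -/
theorem integral_mul_coord_mul_radial {d : ℕ} {f : ℝ → ℝ} {T c : ℝ} (hf : Continuous f)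
    (hT : ∀ s, T ≤ s → f s = 0) (hc : 0 ≤ c) (u : Euc d) (i : Fin d) {g g' : Euc d → ℝ}
    (hg : Measurable g) (hgb : BoundedOnBounded g) (hg' : Measurable g')
    (hgb' : BoundedOnBounded g')
    (hd : ∀ y, HasLineDerivAt ℝ g (g' y) y (EuclideanSpace.single i (1 : ℝ))) :
    ∫ y, g y * (y i - u i) * f (‖y - u‖ ^ 2 + c)
      = ∫ y, g' y * halfTail f T (‖y - u‖ ^ 2 + c) := by
  have hm : Measurable fun y : Euc d => ‖y - u‖ ^ 2 + c := by fun_prop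
  have hm0 : ∀ y : Euc d, 0 ≤ ‖y - u‖ ^ 2 + c := fun y => by positivity
  have hR : ∀ y : Euc d, ‖y - u‖ ^ 2 + c < T → ‖y‖ ≤ ‖u‖ + (T + 1) := fun y =>
    norm_le_of_sub_sq_lt hc
  have hF := continuous_halfTail hf T
  have hF0 : ∀ t, T ≤ t → halfTail f T t = 0 := fun t => halfTail_eq_zero hT
  have hcoord : BoundedOnBounded fun y : Euc d => y i - u i :=
    boundedOnBounded_of_continuous (by fun_prop)
  have i1 := integrable_mul_radial (μ := (volume : Measure (Euc d))) hg' hgb' hF hF0 hm hm0 hR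
  have i2 := integrable_mul_radial (μ := (volume : Measure (Euc d))) hg hgb hF hF0 hm hm0 hR
  have i3 := integrable_mul_radial (μ := (volume : Measure (Euc d)))
    (g := fun y => g y * (y i - u i)) (hg.mul (by fun_prop))
    (boundedOnBounded_mul hgb hcoord) hf hT hm hm0 hR
  -- Since the derivative of `halfTail f T` is `-f/2`, the `i`-th partial derivative of `halfTail f
  -- T (‖y-u‖² + c)` is `-(yᵢ - uᵢ) f`; the identity is integration by parts in direction `i`.
  have key := integral_bilinear_hasLineDerivAt_right_eq_neg_left_of_integrable
    (μ := (volume : Measure (Euc d))) (B := ContinuousLinearMap.mul ℝ ℝ) (f := g) (f' := g')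
    (g := fun y => halfTail f T (‖y - u‖ ^ 2 + c))
    (g' := fun y => -((y i - u i) * f (‖y - u‖ ^ 2 + c)))
    (v := EuclideanSpace.single i (1 : ℝ)) i1
    (by
      refine i3.neg.congr (Eventually.of_forall fun y => ?_)
      simp only [Pi.neg_apply, ContinuousLinearMap.mul_apply']; ring)
    i2 (fun y _ => hd y) (fun y _ => ?_)
  · simp only [ContinuousLinearMap.mul_apply'] at key
    rw [← neg_inj, ← key, ← integral_neg]
    refine integral_congr_ae (Eventually.of_forall fun y => ?_)
    simp only; ring
  · have h1 := (hasDerivAt_norm_add_single_sq (y - u) i).add_const c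
    have h2 := (hasDerivAt_halfTail hf T
      (‖y - u + (0 : ℝ) • EuclideanSpace.single i (1 : ℝ)‖ ^ 2 + c)).comp (0 : ℝ) h1
    have e : (fun t : ℝ => halfTail f T (‖y + t • EuclideanSpace.single i (1 : ℝ) - u‖ ^ 2 + c))
        = halfTail f T ∘ fun t : ℝ => ‖y - u + t • EuclideanSpace.single i (1 : ℝ)‖ ^ 2 + c := by
      funext t; simp only [Function.comp, add_sub_right_comm]
    unfold HasLineDerivAt
    rw [e]
    convert! h2 using 1
    simp; ring

end

/-! ### Stein's identity for the location part and for the residual part. -/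

section

variable {p n : ℕ} {r r' : ℝ → ℝ}

theorem sum_mul_sq_coord {d : ℕ} (c : ℝ) (y : Euc d) : ∑ i, c * (y i * y i) = c * ‖y‖ ^ 2 := by
  rw [EuclideanSpace.real_norm_sq_eq, Finset.mul_sum]
  exact Finset.sum_congr rfl fun i _ => by ring

theorem abs_coord_le_norm {d : ℕ} (y : Euc d) (i : Fin d) : |y i| ≤ ‖y‖ :=
  PiLp.norm_apply_le y i

theorem IsGoodShrinkage.abs_le_one (hr : IsGoodShrinkage p n r r') {w : ℝ} (hw : 0 ≤ w) :
    |r w| ≤ 1 := by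
  rw [abs_of_nonneg (hr.nonneg w hw)]; exact hr.le_one w hw

theorem integral_stein_location (hr : IsGoodShrinkage p n r r') {f : ℝ → ℝ} {T : ℝ}
    (hf : Continuous f) (hT : ∀ s, T ≤ s → f s = 0) (u : Euc p) {s : ℝ} (hs : 0 < s) :
    ∫ x : Euc p, r (‖x‖ ^ 2 / s) * inner ℝ x (x - u) * f (‖x - u‖ ^ 2 + s)
      = ∫ x : Euc p, (p * r (‖x‖ ^ 2 / s) + 2 * (‖x‖ ^ 2 / s * r' (‖x‖ ^ 2 / s)))
          * halfTail f T (‖x - u‖ ^ 2 + s) := by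
  have hw : ∀ x : Euc p, 0 ≤ ‖x‖ ^ 2 / s := fun x => by positivity
  obtain ⟨C, hC⟩ := hr.bounded_deriv
  -- The field `r(w) x` with `w = ‖x‖²/s` has divergence `p r + 2 w r'`.
  set G : Fin p → Euc p → ℝ := fun i x => r (‖x‖ ^ 2 / s) * x i with hG
  set G' : Fin p → Euc p → ℝ := fun i x =>
    r (‖x‖ ^ 2 / s) + 2 / s * r' (‖x‖ ^ 2 / s) * (x i * x i) with hG'
  have mG : ∀ i, Measurable (G i) := fun i =>
    (hr.measurable.comp (by fun_prop)).mul (by fun_prop)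
  have mG' : ∀ i, Measurable (G' i) := fun i =>
    (hr.measurable.comp (by fun_prop)).add
      (((hr.measurable_deriv.comp (by fun_prop)).const_mul _).mul (by fun_prop))
  have bG : ∀ i, BoundedOnBounded (G i) := fun i R => ⟨R, fun x hx => by
    rw [hG, abs_mul]
    calc _ ≤ 1 * ‖x‖ := mul_le_mul (hr.abs_le_one (hw x)) (abs_coord_le_norm x i)
            (abs_nonneg _) zero_le_one
      _ ≤ R := by linarith⟩
  have bG' : ∀ i, BoundedOnBounded (G' i) := fun i R => ⟨1 + 2 * C, fun x _ => by
    have h1 := hr.abs_le_one (hw x)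
    have h2 := hC _ (hw x)
    have h3 : |2 / s * r' (‖x‖ ^ 2 / s) * (x i * x i)| ≤ 2 * C := by
      have h4 : |x i * x i| ≤ ‖x‖ ^ 2 := by
        rw [abs_mul, sq]; exact mul_le_mul (abs_coord_le_norm x i) (abs_coord_le_norm x i)
          (abs_nonneg _) (norm_nonneg _)
      calc _ = 2 / s * |r' (‖x‖ ^ 2 / s)| * |x i * x i| := by
              rw [abs_mul, abs_mul, abs_of_pos (div_pos two_pos hs)]
        _ ≤ 2 / s * |r' (‖x‖ ^ 2 / s)| * ‖x‖ ^ 2 := by gcongr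
        _ = 2 * |‖x‖ ^ 2 / s * r' (‖x‖ ^ 2 / s)| := by
              rw [abs_mul, abs_of_nonneg (hw x)]; ring
        _ ≤ 2 * C := by linarith
    exact (abs_add_le _ _).trans (add_le_add h1 h3)⟩
  have hd : ∀ i x, HasLineDerivAt ℝ (G i) (G' i x) x (EuclideanSpace.single i (1 : ℝ)) := by
    intro i x
    have h1 := (hasDerivAt_norm_add_single_sq x i).div_const s
    have h2 := HasDerivAt.comp (0 : ℝ) (by simpa using hr.hasDerivAt _ (hw x)) h1
      (h₂ := r) (h₂' := r' (‖x‖ ^ 2 / s))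
    have h3 : HasDerivAt (fun t : ℝ => (x + t • EuclideanSpace.single i (1 : ℝ)) i) 1 0 := by
      simpa using (hasDerivAt_id (0 : ℝ)).const_add (x i)
    unfold HasLineDerivAt
    convert! h2.mul h3 using 1
    simp [hG']; ring
  have hm : Measurable fun y : Euc p => ‖y - u‖ ^ 2 + s := by fun_prop
  have hm0 : ∀ y : Euc p, 0 ≤ ‖y - u‖ ^ 2 + s := fun y => by positivity
  have hR : ∀ y : Euc p, ‖y - u‖ ^ 2 + s < T → ‖y‖ ≤ ‖u‖ + (T + 1) := fun y =>
    norm_le_of_sub_sq_lt hs.le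
  have key := fun i => integral_mul_coord_mul_radial hf hT hs.le u i (mG i) (bG i) (mG' i) (bG' i)
    (hd i)
  have e1 : ∀ x : Euc p, r (‖x‖ ^ 2 / s) * inner ℝ x (x - u) * f (‖x - u‖ ^ 2 + s)
      = ∑ i, G i x * (x i - u i) * f (‖x - u‖ ^ 2 + s) := fun x => by
    rw [← Finset.sum_mul, PiLp.inner_apply, Finset.mul_sum]
    congr 1
    refine Finset.sum_congr rfl fun i _ => ?_
    simp [hG]; ring
  have e2 : ∀ x : Euc p, (p * r (‖x‖ ^ 2 / s) + 2 * (‖x‖ ^ 2 / s * r' (‖x‖ ^ 2 / s)))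
          * halfTail f T (‖x - u‖ ^ 2 + s)
      = ∑ i, G' i x * halfTail f T (‖x - u‖ ^ 2 + s) := fun x => by
    rw [← Finset.sum_mul, Finset.sum_add_distrib, sum_mul_sq_coord]
    simp; left; ring
  simp only [e1, e2]
  rw [integral_finsetSum, integral_finsetSum]
  · exact Finset.sum_congr rfl fun i _ => key i
  · intro i _
    exact integrable_mul_radial (mG' i) (bG' i) (continuous_halfTail hf T)
      (fun t => halfTail_eq_zero hT) hm hm0 hR
  · intro i _
    exact integrable_mul_radial ((mG i).mul (by fun_prop)) (boundedOnBounded_mul (bG i)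
      (boundedOnBounded_of_continuous (by fun_prop))) hf hT hm hm0 hR

/-- The integrand carries no visible factor `z`, but `r²‖x‖² = w r² ‖z‖²` is the inner product of
`z` with the field `w r(w)² z`, `w = ‖x‖²/‖z‖²`. Stein's identity in `z` then applies. -/
theorem integral_stein_residual (hr : IsGoodShrinkage p n r r') {f : ℝ → ℝ} {T : ℝ}
    (hf : Continuous f) (hT : ∀ s, T ≤ s → f s = 0) (hn : 1 ≤ n) {x : Euc p} (hx : x ≠ 0)
    {c : ℝ} (hc : 0 ≤ c) :
    ∫ z : Euc n, ‖r (‖x‖ ^ 2 / ‖z‖ ^ 2) • x‖ ^ 2 * f (c + ‖z‖ ^ 2)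
      = ∫ z : Euc n, ((n - 2) * (‖x‖ ^ 2 / ‖z‖ ^ 2 * r (‖x‖ ^ 2 / ‖z‖ ^ 2)) * r (‖x‖ ^ 2 / ‖z‖ ^ 2)
          - 4 * (‖x‖ ^ 2 / ‖z‖ ^ 2 * r (‖x‖ ^ 2 / ‖z‖ ^ 2))
            * (‖x‖ ^ 2 / ‖z‖ ^ 2 * r' (‖x‖ ^ 2 / ‖z‖ ^ 2)))
          * halfTail f T (c + ‖z‖ ^ 2) := by
  have hw : ∀ z : Euc n, 0 ≤ ‖x‖ ^ 2 / ‖z‖ ^ 2 := fun x => by positivity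
  obtain ⟨B, hB⟩ := hr.bounded
  obtain ⟨C, hC⟩ := hr.bounded_deriv
  have hB0 : 0 ≤ B := by simpa using hB 0 le_rfl
  have hC0 : 0 ≤ C := (abs_nonneg _).trans (hC 0 le_rfl)
  set W : Euc n → ℝ := fun z => ‖x‖ ^ 2 / ‖z‖ ^ 2 with hW
  have mW : Measurable W := by rw [hW]; fun_prop
  set q : ℝ → ℝ := fun w => w * r w * r w with hq
  have q0 : ∀ w, 0 ≤ w → 0 ≤ q w := fun w h =>
    mul_nonneg (mul_nonneg h (hr.nonneg w h)) (hr.nonneg w h)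
  have qB : ∀ w, 0 ≤ w → q w ≤ B := fun w h =>
    (mul_le_of_le_one_right (mul_nonneg h (hr.nonneg w h)) (hr.le_one w h)).trans (hB w h)
  -- This is `w` times the derivative of `q`. As `w` is homogeneous of degree `-2` in `z`, the
  -- divergence of `q(w) z` is `n q - 2 q'`.
  set q' : ℝ → ℝ := fun w => q w + 2 * (w * r w) * (w * r' w) with hq'
  have qC : ∀ w, 0 ≤ w → |q' w| ≤ B + 2 * B * C := fun w h => by
    refine (abs_add_le _ _).trans (add_le_add ?_ ?_)
    · rw [abs_of_nonneg (q0 w h)]; exact qB w h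
    · rw [abs_mul, abs_mul, abs_two, abs_of_nonneg (mul_nonneg h (hr.nonneg w h))]
      exact mul_le_mul (mul_le_mul_of_nonneg_left (hB w h) two_pos.le) (hC w h) (abs_nonneg _)
        (by linarith)
  have mq : Measurable q := (measurable_id.mul hr.measurable).mul hr.measurable
  have mq' : Measurable q' := mq.add (((measurable_id.mul hr.measurable).const_mul 2).mul
    (measurable_id.mul hr.measurable_deriv))
  set G : Fin n → Euc n → ℝ := fun i z => q (W z) * z i with hG
  set G' : Fin n → Euc n → ℝ := fun i z =>
    q (W z) + -2 * q' (W z) / ‖z‖ ^ 2 * (z i * z i) with hG'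
  have mG : ∀ i, Measurable (G i) := fun i => (mq.comp mW).mul (by fun_prop)
  have mG' : ∀ i, Measurable (G' i) := fun i =>
    (mq.comp mW).add ((((mq'.comp mW).const_mul _).div (by fun_prop)).mul (by fun_prop))
  have bG : ∀ i, BoundedOnBounded (G i) := fun i R => ⟨B * R, fun z hz => by
    rw [hG, abs_mul, abs_of_nonneg (q0 _ (hw z))]
    exact mul_le_mul (qB _ (hw z)) ((abs_coord_le_norm z i).trans hz)
            (abs_nonneg _) hB0⟩
  have bG' : ∀ i, BoundedOnBounded (G' i) := fun i R => ⟨B + 2 * (B + 2 * B * C), fun z _ => by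
    refine (abs_add_le _ _).trans (add_le_add ?_ ?_)
    · rw [abs_of_nonneg (q0 _ (hw z))]; exact qB _ (hw z)
    · have h4 : |z i * z i| ≤ ‖z‖ ^ 2 := by
        rw [abs_mul, sq]; exact mul_le_mul (abs_coord_le_norm z i) (abs_coord_le_norm z i)
          (abs_nonneg _) (norm_nonneg _)
      have h5 : |z i * z i| / ‖z‖ ^ 2 ≤ 1 := div_le_one_of_le₀ h4 (by positivity)
      calc _ = 2 * |q' (W z)| * (|z i * z i| / ‖z‖ ^ 2) := by
              rw [abs_mul, abs_div, abs_mul, abs_neg, abs_two,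
                abs_of_nonneg (show 0 ≤ ‖z‖ ^ 2 by positivity)]; ring
        _ ≤ 2 * (B + 2 * B * C) * 1 := mul_le_mul
              (mul_le_mul_of_nonneg_left (qC _ (hw z)) two_pos.le) h5 (by positivity)
              (by positivity)
        _ = _ := mul_one _⟩
  have hd : ∀ i z, HasLineDerivAt ℝ (G i) (G' i z) z (EuclideanSpace.single i (1 : ℝ)) := by
    intro i z
    unfold HasLineDerivAt
    rcases eq_or_ne z 0 with rfl | hz
    -- At the origin the convention `‖x‖²/0 = 0` makes the field and `G'` vanish. The field is
    -- differentiable there with derivative zero: `wr ≤ B` gives `q(w) ≤ B²/w`, so along the axis it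
    -- is of order `|t|³`.
    · have e0 : G' i 0 = 0 := by simp [hG', hW, hq]
      rw [e0, hasDerivAt_iff_isLittleO_nhds_zero]
      have e1 : ∀ t : ℝ, |G i (0 + t • EuclideanSpace.single i (1 : ℝ))|
          ≤ B ^ 2 / ‖x‖ ^ 2 * |t| ^ 3 := fun t => by
        rcases eq_or_ne t 0 with rfl | ht
        · simp [hG]
        have w0 : 0 < ‖x‖ ^ 2 / t ^ 2 := by positivity
        have e2 : G i (0 + t • EuclideanSpace.single i (1 : ℝ)) = q (‖x‖ ^ 2 / t ^ 2) * t := by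
          simp only [hG, hW, norm_add_single_sq]; simp
        have e3 : q (‖x‖ ^ 2 / t ^ 2) ≤ B ^ 2 * t ^ 2 / ‖x‖ ^ 2 := by
          have h1 := hB _ w0.le
          have h2 : 0 ≤ ‖x‖ ^ 2 / t ^ 2 * r (‖x‖ ^ 2 / t ^ 2) :=
            mul_nonneg w0.le (hr.nonneg _ w0.le)
          have h3 : q (‖x‖ ^ 2 / t ^ 2)
              = (‖x‖ ^ 2 / t ^ 2 * r (‖x‖ ^ 2 / t ^ 2)) ^ 2 * (t ^ 2 / ‖x‖ ^ 2) := by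
            simp only [hq]; field_simp
          rw [h3, mul_div_assoc]
          gcongr
        rw [e2, abs_mul, abs_of_nonneg (q0 _ w0.le)]
        calc _ ≤ B ^ 2 * t ^ 2 / ‖x‖ ^ 2 * |t| := by gcongr
          _ = _ := by rw [← sq_abs t]; ring
      have e4 : (fun t : ℝ => |t| ^ 3) =o[𝓝 0] fun t : ℝ => t := by
        have : (fun t : ℝ => t ^ 3) =o[𝓝 0] fun t : ℝ => t := by
          simpa using Asymptotics.isLittleO_pow_id (𝕜 := ℝ) (show 1 < 3 by norm_num)
        refine Asymptotics.IsLittleO.congr_left (f₁ := fun t : ℝ => ‖t ^ 3‖) this.norm_left ?_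
        intro t; simp
      refine Asymptotics.IsBigO.trans_isLittleO (Asymptotics.IsBigO.of_bound (B ^ 2 / ‖x‖ ^ 2)
        (Eventually.of_forall fun t => ?_)) e4
      have e5 : G i (0 + (0 : ℝ) • EuclideanSpace.single i (1 : ℝ)) = 0 := by simp [hG]
      rw [zero_add t, e5]
      simpa using e1 t
    · have hz0 : ‖z‖ ^ 2 ≠ 0 := by simpa using hz
      have h1 := ((hasDerivAt_const (0 : ℝ) (‖x‖ ^ 2)).div
        (hasDerivAt_norm_add_single_sq z i) (by simpa using hz))
      have hq1 : HasDerivAt q (r (W z) * r (W z) + 2 * (W z * r (W z)) * r' (W z)) (W z) := by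
        have := ((hasDerivAt_id (W z)).mul (hr.hasDerivAt _ (hw z))).mul (hr.hasDerivAt _ (hw z))
        convert! this using 1
        simp only [id, Pi.mul_apply]; ring
      have h2 := HasDerivAt.comp (0 : ℝ) (by simpa using hq1) h1
        (h₂ := q) (h₂' := r (W z) * r (W z) + 2 * (W z * r (W z)) * r' (W z))
      have h3 : HasDerivAt (fun t : ℝ => (z + t • EuclideanSpace.single i (1 : ℝ)) i) 1 0 := by
        simpa using (hasDerivAt_id (0 : ℝ)).const_add (z i)
      convert! h2.mul h3 using 1
      simp [hG', hq', hq, hW]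
      field_simp
      ring
  have hm : Measurable fun z : Euc n => ‖z - 0‖ ^ 2 + c := by fun_prop
  have hm0 : ∀ z : Euc n, 0 ≤ ‖z - 0‖ ^ 2 + c := fun y => by positivity
  have hR : ∀ z : Euc n, ‖z - 0‖ ^ 2 + c < T → ‖z‖ ≤ ‖(0 : Euc n)‖ + (T + 1) := fun y =>
    norm_le_of_sub_sq_lt hc
  have key := fun i => integral_mul_coord_mul_radial hf hT hc 0 i (mG i) (bG i) (mG' i) (bG' i)
    (hd i)
  have : Nonempty (Fin n) := ⟨⟨0, hn⟩⟩
  have hae : ∀ᵐ z : Euc n, z ≠ 0 := by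
    have : Nontrivial (Euc n) := inferInstance
    exact Measure.ae_ne volume 0
  have e1 : ∀ᵐ z : Euc n, ‖r (‖x‖ ^ 2 / ‖z‖ ^ 2) • x‖ ^ 2 * f (c + ‖z‖ ^ 2)
      = ∑ i, G i z * (z i - (0 : Euc n) i) * f (‖z - 0‖ ^ 2 + c) := by
    filter_upwards [hae] with z hz
    have hz0 : ‖z‖ ^ 2 ≠ 0 := by simpa using hz
    rw [← Finset.sum_mul, sub_zero, add_comm]
    congr 1
    have : ∀ i, G i z * (z i - (0 : Euc n) i) = q (W z) * (z i * z i) := fun i => by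
      simp [hG]; ring
    simp only [this]
    rw [sum_mul_sq_coord, norm_smul, mul_pow, Real.norm_eq_abs, sq_abs]
    simp only [hq, hW]; field_simp
  have e2 : ∀ᵐ z : Euc n, ((n - 2) * (W z * r (W z)) * r (W z)
          - 4 * (W z * r (W z)) * (W z * r' (W z))) * halfTail f T (c + ‖z‖ ^ 2)
      = ∑ i, G' i z * halfTail f T (‖z - 0‖ ^ 2 + c) := by
    filter_upwards [hae] with z hz
    have hz0 : ‖z‖ ^ 2 ≠ 0 := by simpa using hz
    rw [← Finset.sum_mul, sub_zero, add_comm c]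
    congr 1
    rw [Finset.sum_add_distrib, sum_mul_sq_coord, div_mul_cancel₀ _ hz0]
    simp [hq', hq]; ring
  rw [integral_congr_ae e1, integral_congr_ae e2, integral_finsetSum, integral_finsetSum]
  · exact Finset.sum_congr rfl fun i _ => key i
  · intro i _
    exact integrable_mul_radial (mG' i) (bG' i) (continuous_halfTail hf T)
      (fun t => halfTail_eq_zero hT) hm hm0 hR
  · intro i _
    exact integrable_mul_radial ((mG i).mul (by fun_prop)) (boundedOnBounded_mul (bG i)
      (boundedOnBounded_of_continuous (by fun_prop))) hf hT hm hm0 hR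

end

/-! ### Domination of `x` by the shrinkage estimator, first for continuous profiles, then for all.
-/

section

variable {p n : ℕ} {r r' : ℝ → ℝ}

/-- The estimator `(1 - r (‖x‖²/‖z‖²)) x`. -/
noncomputable def shrinkEst (r : ℝ → ℝ) (y : Euc p × Euc n) : Euc p :=
  (1 - r (‖y.1‖ ^ 2 / ‖y.2‖ ^ 2)) • y.1

theorem measurable_shrinkEst (hr : Measurable r) :
    Measurable (shrinkEst r : Euc p × Euc n → Euc p) :=
  (measurable_const.sub (hr.comp (by fun_prop))).smul measurable_fst

theorem ae_ne_zero_of_pos {d : ℕ} (hd : 1 ≤ d) : ∀ᵐ z : Euc d, z ≠ 0 := by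
  have : Nonempty (Fin d) := ⟨⟨0, hd⟩⟩
  have : Nontrivial (Euc d) := inferInstance
  exact Measure.ae_ne volume 0

theorem integral_shrinkEst_le (hp : 1 ≤ p) (hn : 1 ≤ n) (hr : IsGoodShrinkage p n r r')
    {f : ℝ → ℝ} {T : ℝ} (hf : Continuous f) (hf0 : ∀ s, 0 ≤ f s) (hT : ∀ s, T ≤ s → f s = 0)
    (θ : Euc p) :
    ∫⁻ y : Euc p × Euc n,
        ENNReal.ofReal (‖shrinkEst r y - θ‖ ^ 2 * f (‖y.1 - θ‖ ^ 2 + ‖y.2‖ ^ 2))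
      ≤ ∫⁻ y : Euc p × Euc n,
        ENNReal.ofReal (‖y.1 - θ‖ ^ 2 * f (‖y.1 - θ‖ ^ 2 + ‖y.2‖ ^ 2)) := by
  set m : Euc p × Euc n → ℝ := fun y => ‖y.1 - θ‖ ^ 2 + ‖y.2‖ ^ 2 with hmdef
  set W : Euc p × Euc n → ℝ := fun y => ‖y.1‖ ^ 2 / ‖y.2‖ ^ 2 with hW
  have mW : Measurable W := by rw [hW]; fun_prop
  have w0 : ∀ y, 0 ≤ W y := fun y => by positivity
  have hm : Measurable m := by rw [hmdef]; fun_prop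
  have hm0 : ∀ y, 0 ≤ m y := fun y => by positivity
  have hR : ∀ y, m y < T → ‖y‖ ≤ (‖θ‖ + (T + 1)) + (‖(0 : Euc n)‖ + (T + 1)) := fun y hy => by
    have h1 := norm_le_of_sub_sq_lt (sq_nonneg ‖y.2‖) hy
    have h2 : ‖y.2‖ ≤ ‖(0 : Euc n)‖ + (T + 1) :=
      norm_le_of_sub_sq_lt (u := (0 : Euc n)) (y := y.2) (sq_nonneg ‖y.1 - θ‖)
        (by rw [sub_zero, add_comm]; exact hy)
    rw [Prod.norm_def]
    refine max_le ?_ ?_ <;> linarith [norm_nonneg y.1, norm_nonneg y.2]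
  have hF := continuous_halfTail hf T
  have hF0 : ∀ t, T ≤ t → halfTail f T t = 0 := fun t => halfTail_eq_zero hT
  obtain ⟨B, hB⟩ := hr.bounded
  obtain ⟨C, hC⟩ := hr.bounded_deriv
  have hB0 : 0 ≤ B := by simpa using hB 0 le_rfl
  have hrW : ∀ y, |r (W y)| ≤ 1 := fun y => hr.abs_le_one (w0 y)
  have hwr : ∀ y, |W y * r (W y)| ≤ B := fun y => by
    rw [abs_of_nonneg (mul_nonneg (w0 y) (hr.nonneg _ (w0 y)))]; exact hB _ (w0 y)
  have hwr' : ∀ y, |W y * r' (W y)| ≤ C := fun y => hC _ (w0 y)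
  have mr : Measurable fun y => r (W y) := hr.measurable.comp mW
  have mr' : Measurable fun y => r' (W y) := hr.measurable_deriv.comp mW
  have bc : ∀ {c : ℝ} {h : Euc p × Euc n → ℝ}, (∀ y, |h y| ≤ c) → BoundedOnBounded h :=
    fun hh R => ⟨_, fun y _ => hh y⟩
  set a1 : Euc p × Euc n → ℝ := fun y => r (W y) * inner ℝ y.1 (y.1 - θ) with ha1
  set a2 : Euc p × Euc n → ℝ := fun y => ‖r (W y) • y.1‖ ^ 2 with ha2
  set d1 : Euc p × Euc n → ℝ := fun y => p * r (W y) + 2 * (W y * r' (W y)) with hd1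
  set d2 : Euc p × Euc n → ℝ := fun y => (n - 2) * (W y * r (W y)) * r (W y)
    - 4 * (W y * r (W y)) * (W y * r' (W y)) with hd2
  have I1 : Integrable (fun y => a1 y * f (m y)) := by
    refine integrable_mul_radial (mr.mul (by fun_prop)) (boundedOnBounded_mul (bc hrW)
      (boundedOnBounded_of_continuous (by fun_prop))) hf hT hm hm0 hR
  have ba2 : BoundedOnBounded a2 := by
    have : a2 = fun y => (r (W y) * r (W y)) * ‖y.1‖ ^ 2 := by
      funext y; simp only [ha2]; rw [norm_smul, mul_pow, Real.norm_eq_abs, sq_abs]; ring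
    rw [this]
    exact boundedOnBounded_mul (boundedOnBounded_mul (bc hrW) (bc hrW))
      (boundedOnBounded_of_continuous (by fun_prop))
  have ma2 : Measurable a2 := ((mr.smul measurable_fst).norm).pow_const 2
  have I2 : Integrable (fun y => a2 y * f (m y)) :=
    integrable_mul_radial ma2 ba2 hf hT hm hm0 hR
  have bd1 : ∀ y, |d1 y| ≤ p + 2 * C := fun y => by
    refine (abs_add_le _ _).trans (add_le_add ?_ ?_)
    · rw [abs_mul, Nat.abs_cast]
      exact mul_le_of_le_one_right (Nat.cast_nonneg p) (hrW y)
    · rw [abs_mul, abs_two]; linarith [hwr' y]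
  have bd2 : ∀ y, |d2 y| ≤ |(n : ℝ) - 2| * B + 4 * B * C := fun y => by
    refine (abs_sub _ _).trans (add_le_add ?_ ?_)
    · rw [abs_mul, abs_mul]
      have := mul_le_mul (hwr y) (hrW y) (abs_nonneg _) hB0
      rw [mul_assoc]
      exact mul_le_mul_of_nonneg_left (by linarith) (abs_nonneg _)
    · rw [abs_mul, abs_mul, abs_of_pos (by norm_num : (0 : ℝ) < 4)]
      have := mul_le_mul (hwr y) (hwr' y) (abs_nonneg _) hB0
      linarith
  have D1 : Integrable (fun y => d1 y * halfTail f T (m y)) :=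
    integrable_mul_radial ((mr.const_mul _).add ((mW.mul mr').const_mul _)) (bc bd1) hF hF0
      hm hm0 hR
  have D2 : Integrable (fun y => d2 y * halfTail f T (m y)) :=
    integrable_mul_radial ((((mW.mul mr).const_mul _).mul mr).sub
      (((mW.mul mr).const_mul _).mul (mW.mul mr'))) (bc bd2) hF hF0 hm hm0 hR
  -- The cross term is treated by Stein in `x` with `z` fixed, the quadratic term `E2` by Stein in
  -- `z` with `x` fixed; both end with the same weight `halfTail f T (m y)`.
  have E1 : ∫ y, a1 y * f (m y) = ∫ y, d1 y * halfTail f T (m y) := by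
    rw [Measure.volume_eq_prod] at I1 D1 ⊢
    rw [integral_prod_symm _ I1, integral_prod_symm _ D1]
    refine integral_congr_ae ?_
    filter_upwards [ae_ne_zero_of_pos hn] with z hz
    exact integral_stein_location hr hf hT θ (s := ‖z‖ ^ 2) (by positivity)
  have E2 : ∫ y, a2 y * f (m y) = ∫ y, d2 y * halfTail f T (m y) := by
    rw [Measure.volume_eq_prod] at I2 D2 ⊢
    rw [integral_prod _ I2, integral_prod _ D2]
    refine integral_congr_ae ?_
    filter_upwards [ae_ne_zero_of_pos hp] with x hx
    exact integral_stein_residual hr hf hT hn hx (sq_nonneg ‖x - θ‖)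
  have Ix : Integrable (fun y : Euc p × Euc n => ‖y.1 - θ‖ ^ 2 * f (m y)) :=
    integrable_mul_radial (by fun_prop) (boundedOnBounded_of_continuous (by fun_prop))
      hf hT hm hm0 hR
  have eδ : ∀ y : Euc p × Euc n, ‖shrinkEst r y - θ‖ ^ 2 * f (m y)
      = ‖y.1 - θ‖ ^ 2 * f (m y) + (a2 y * f (m y) - 2 * (a1 y * f (m y))) := fun y => by
    have h1 : shrinkEst r y - θ = (y.1 - θ) - r (W y) • y.1 := by
      simp only [shrinkEst, hW, sub_smul, one_smul]; abel
    rw [h1, norm_sub_sq_real, inner_smul_right, real_inner_comm]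
    simp only [ha1, ha2]; ring
  have Iδ : Integrable (fun y : Euc p × Euc n => ‖shrinkEst r y - θ‖ ^ 2 * f (m y)) := by
    simp only [eδ]
    exact Ix.add (I2.sub (I1.const_mul 2))
  have I12 : Integrable (fun y => a2 y * f (m y) - 2 * (a1 y * f (m y))) :=
    I2.sub (I1.const_mul 2)
  rw [← ofReal_integral_eq_lintegral_ofReal Iδ
      (Eventually.of_forall fun y => mul_nonneg (sq_nonneg _) (hf0 _)),
    ← ofReal_integral_eq_lintegral_ofReal Ix
      (Eventually.of_forall fun y => mul_nonneg (sq_nonneg _) (hf0 _))]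
  refine ENNReal.ofReal_le_ofReal ?_
  simp only [eδ]
  rw [integral_add Ix I12, integral_sub I2 (I1.const_mul 2),
    integral_const_mul, E1, E2, ← integral_const_mul, ← integral_sub D2 (D1.const_mul 2)]
  have : ∫ y, (d2 y * halfTail f T (m y) - 2 * (d1 y * halfTail f T (m y))) ≤ 0 := by
    refine integral_nonpos fun y => ?_
    have h1 := hr.div_nonpos _ (w0 y)
    have h2 := halfTail_nonneg hf0 hT (m y)
    have h3 : d2 y * halfTail f T (m y) - 2 * (d1 y * halfTail f T (m y))
        = (-2 * p * r (W y) - 4 * (W y * r' (W y)) + (n - 2) * (W y * r (W y)) * r (W y)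
          - 4 * (W y * r (W y)) * (W y * r' (W y))) * halfTail f T (m y) := by
      simp only [hd1, hd2]; ring
    rw [h3]
    exact mul_nonpos_of_nonpos_of_nonneg h1 h2
  linarith

/-- An inequality between integrals against `φ ∘ m` that holds for all continuous compactly
supported `φ ≥ 0` holds for all measurable `φ ≥ 0`. -/
theorem lintegral_mul_comp_le_of_continuous {α : Type*} [MeasurableSpace α] {μ : Measure α}
    {A B : α → ℝ≥0∞} {m : α → ℝ} (hA : Measurable A) (hB : Measurable B)
    (hm : Measurable m) (hfin : ∀ T : ℝ, ∫⁻ y in {y | m y ≤ T}, B y ∂μ < ∞)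
    (h : ∀ φ : ℝ → ℝ, Continuous φ → (∀ s, 0 ≤ φ s) → (∃ T, ∀ s, T ≤ s → φ s = 0) →
      ∫⁻ y, A y * ENNReal.ofReal (φ (m y)) ∂μ ≤ ∫⁻ y, B y * ENNReal.ofReal (φ (m y)) ∂μ)
    {φ : ℝ → ℝ≥0∞} (hφ : Measurable φ) :
    ∫⁻ y, A y * φ (m y) ∂μ ≤ ∫⁻ y, B y * φ (m y) ∂μ := by
  have conv : ∀ D : α → ℝ≥0∞, Measurable D → ∀ ψ : ℝ → ℝ≥0∞, Measurable ψ →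
      ∫⁻ y, D y * ψ (m y) ∂μ = ∫⁻ t, ψ t ∂((μ.withDensity D).map m) := fun D hD ψ hψ => by
    rw [lintegral_map hψ hm]
    exact (lintegral_withDensity_eq_lintegral_mul _ hD (hψ.comp hm)).symm
  set νA := (μ.withDensity A).map m
  set νB := (μ.withDensity B).map m
  have hBT : ∀ T : ℝ, νB (Iic T) < ∞ := fun T => by
    rw [Measure.map_apply hm measurableSet_Iic,
      withDensity_apply _ (hm measurableSet_Iic)]
    exact hfin T
  have cmp : ∀ φ : ℝ → ℝ, Continuous φ → (∀ s, 0 ≤ φ s) → (∃ T, ∀ s, T ≤ s → φ s = 0) →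
      ∫⁻ t, ENNReal.ofReal (φ t) ∂νA ≤ ∫⁻ t, ENNReal.ofReal (φ t) ∂νB := fun φ h1 h2 h3 => by
    rw [← conv A hA _ (by fun_prop), ← conv B hB _ (by fun_prop)]
    exact h φ h1 h2 h3
  have finB : IsFiniteMeasureOnCompacts νB := ⟨fun K hK => by
    obtain ⟨T, hT⟩ := hK.bddAbove
    exact (measure_mono fun x hx => hT hx).trans_lt (hBT T)⟩
  -- The pushforwards under `m` are compared as measures on `ℝ`: Urysohn functions and outer
  -- regularity of `νB` give compact sets, inner regularity of `νA` then gives all Borel sets.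
  have hK : ∀ K : Set ℝ, IsCompact K → νA K ≤ νB K := fun K hK => by
    refine le_of_forall_gt fun c hc => ?_
    obtain ⟨U, hKU, hU, hUc⟩ := K.exists_isOpen_lt_of_lt c hc
    obtain ⟨φ, hφ1, hφ0, hφc, hφ01⟩ := exists_continuous_one_zero_of_isCompact hK
      hU.isClosed_compl (disjoint_compl_right_iff_subset.2 hKU)
    obtain ⟨T, hT⟩ := hφc.isCompact.bddAbove
    have h1 := cmp φ φ.continuous (fun s => (hφ01 s).1) ⟨T + 1, fun s hs => by
      by_contra hne
      have := hT (subset_tsupport _ (Function.mem_support.2 hne))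
      linarith⟩
    calc νA K = ∫⁻ t, K.indicator 1 t ∂νA := by rw [lintegral_indicator_one hK.measurableSet]
      _ ≤ ∫⁻ t, ENNReal.ofReal (φ t) ∂νA := lintegral_mono fun t => by
          by_cases ht : t ∈ K
          · simp [ht, hφ1 ht]
          · simp [ht]
      _ ≤ ∫⁻ t, ENNReal.ofReal (φ t) ∂νB := h1
      _ ≤ ∫⁻ t, U.indicator 1 t ∂νB := lintegral_mono fun t => by
          by_cases ht : t ∈ U
          · simpa [ht] using (hφ01 t).2
          · simp [ht, hφ0 (mem_compl ht)]
      _ = νB U := lintegral_indicator_one hU.measurableSet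
      _ < c := hUc
  have finA : IsFiniteMeasureOnCompacts νA := ⟨fun K hK' =>
    (hK K hK').trans_lt hK'.measure_lt_top⟩
  have hle : νA ≤ νB := Measure.le_iff.2 fun s hs => by
    rw [hs.measure_eq_iSup_isCompact]
    exact iSup₂_le fun K hKs => iSup_le fun hKc => (hK K hKc).trans (measure_mono hKs)
  rw [conv A hA φ hφ, conv B hB φ hφ]
  exact lintegral_mono' hle le_rfl

/-- Both risks may be infinite for a general profile, hence extended-valued integrals and the
transfer from continuous compactly supported profiles. Its finiteness condition holds because
`‖x-θ‖²` is bounded on the bounded sets where the radial variable is at most `T`. -/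
theorem lintegral_shrinkEst_le (hp : 1 ≤ p) (hn : 1 ≤ n) (hr : IsGoodShrinkage p n r r')
    {φ : ℝ → ℝ≥0∞} (hφ : Measurable φ) (θ : Euc p) :
    ∫⁻ y : Euc p × Euc n,
        ENNReal.ofReal (‖shrinkEst r y - θ‖ ^ 2) * φ (‖y.1 - θ‖ ^ 2 + ‖y.2‖ ^ 2)
      ≤ ∫⁻ y : Euc p × Euc n,
        ENNReal.ofReal (‖y.1 - θ‖ ^ 2) * φ (‖y.1 - θ‖ ^ 2 + ‖y.2‖ ^ 2) := by
  refine lintegral_mul_comp_le_of_continuous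
    (m := fun y : Euc p × Euc n => ‖y.1 - θ‖ ^ 2 + ‖y.2‖ ^ 2) ?_ (by fun_prop) (by fun_prop)
    (fun T => ?_) (fun φ h1 h2 ⟨T, hT⟩ => ?_) hφ
  · exact (((measurable_shrinkEst hr.measurable).sub_const θ).norm.pow_const 2).ennreal_ofReal
  · have hsub : {y : Euc p × Euc n | ‖y.1 - θ‖ ^ 2 + ‖y.2‖ ^ 2 ≤ T}
        ⊆ Metric.closedBall θ (T + 1) ×ˢ Metric.closedBall 0 (T + 1) := fun y hy => by
      have hy' : ‖y.1 - θ‖ ^ 2 + ‖y.2‖ ^ 2 ≤ T := hy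
      refine ⟨?_, ?_⟩
      · rw [mem_closedBall_iff_norm]
        nlinarith [sq_nonneg (‖y.1 - θ‖ - 1), sq_nonneg ‖y.2‖, norm_nonneg (y.1 - θ)]
      · rw [mem_closedBall_iff_norm, sub_zero]
        nlinarith [sq_nonneg (‖y.2‖ - 1), sq_nonneg ‖y.1 - θ‖, norm_nonneg y.2]
    have hfin : volume {y : Euc p × Euc n | ‖y.1 - θ‖ ^ 2 + ‖y.2‖ ^ 2 ≤ T} < ∞ :=
      (measure_mono hsub).trans_lt
        ((isCompact_closedBall _ _).prod (isCompact_closedBall _ _)).measure_lt_top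
    refine setLIntegral_lt_top_of_le_nnreal hfin.ne ⟨T.toNNReal, fun y hy => ?_⟩
    exact ENNReal.ofReal_le_ofReal (le_trans (by linarith [sq_nonneg ‖y.2‖]) hy)
  · have := integral_shrinkEst_le hp hn hr h1 h2 hT θ
    simpa only [ENNReal.ofReal_mul (sq_nonneg _)] using this

end

/-! ### Minimaxity of `x`, by uniform priors on large balls. -/

section

variable {p n : ℕ}

/-- The constant risk of the estimator `x`. -/
noncomputable def constRisk (p n : ℕ) (f : ℝ → ℝ) : ℝ≥0∞ :=
  ∫⁻ y : Euc p × Euc n, ENNReal.ofReal (‖y.1‖ ^ 2 * f (‖y.1‖ ^ 2 + ‖y.2‖ ^ 2))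

theorem lintegral_comp_smul_of_pos {E : Type*} [NormedAddCommGroup E] [NormedSpace ℝ E]
    [MeasurableSpace E] [BorelSpace E] [FiniteDimensional ℝ E] (μ : Measure E)
    [μ.IsAddHaarMeasure] {c : ℝ} (hc : 0 < c) {g : E → ℝ≥0∞} (hg : Measurable g) :
    ENNReal.ofReal (c ^ Module.finrank ℝ E) * ∫⁻ y, g (c • y) ∂μ = ∫⁻ y, g y ∂μ := by
  have h := lintegral_map (μ := μ) hg (measurable_const_smul c)
  rw [Measure.map_addHaar_smul μ hc.ne', lintegral_smul_measure] at h
  rw [← h, smul_eq_mul, ← mul_assoc, ← ENNReal.ofReal_mul (by positivity),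
    abs_of_nonneg (by positivity), mul_inv_cancel₀ (by positivity), ENNReal.ofReal_one, one_mul]

theorem lintegral_loss_density {f : ℝ → ℝ} (hf : Measurable f) (θ : Euc p) {η : ℝ} (hη : 0 < η) :
    ∫⁻ y : Euc p × Euc n, ENNReal.ofReal (loss y.1 θ η * density f θ η y) = constRisk p n f := by
  set G : Euc p × Euc n → ℝ≥0∞ :=
    fun y => ENNReal.ofReal (‖y.1‖ ^ 2 * f (‖y.1‖ ^ 2 + ‖y.2‖ ^ 2)) with hG
  have mG : Measurable G := by rw [hG]; fun_prop
  have hs : 0 < √η := Real.sqrt_pos.2 hη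
  have e : ∀ y : Euc p × Euc n, ENNReal.ofReal (loss y.1 θ η * density f θ η y)
      = ENNReal.ofReal (√η ^ (p + n)) * G (√η • (y - (θ, 0))) := fun y => by
    rw [hG, ← ENNReal.ofReal_mul (by positivity)]
    congr 1
    have h1 : ‖(√η • (y - (θ, (0 : Euc n)))).1‖ ^ 2 = η * ‖y.1 - θ‖ ^ 2 := by
      rw [Prod.smul_fst, norm_smul, mul_pow, Real.norm_eq_abs, sq_abs, Real.sq_sqrt hη.le]; rfl
    have h2 : ‖(√η • (y - (θ, (0 : Euc n)))).2‖ ^ 2 = η * ‖y.2‖ ^ 2 := by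
      rw [Prod.smul_snd, norm_smul, mul_pow, Real.norm_eq_abs, sq_abs, Real.sq_sqrt hη.le]; simp
    have h3 : η ^ (((p : ℝ) + n) / 2) = √η ^ (p + n) := by
      rw [Real.sqrt_eq_rpow, ← Real.rpow_natCast, ← Real.rpow_mul hη.le]; push_cast; ring_nf
    simp only [h1, h2, loss, density, h3]; ring_nf
  have : (volume : Measure (Euc p × Euc n)).IsAddHaarMeasure :=
    inferInstanceAs ((volume : Measure (Euc p)).prod (volume : Measure (Euc n))).IsAddHaarMeasure
  simp only [e]
  rw [lintegral_const_mul _ (by fun_prop),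
    lintegral_sub_right_eq_self (fun y : Euc p × Euc n => G (√η • y)) (θ, 0)]
  have := lintegral_comp_smul_of_pos (volume : Measure (Euc p × Euc n)) hs mG
  rw [Module.finrank_prod, finrank_euclideanSpace_fin, finrank_euclideanSpace_fin] at this
  exact this

theorem risk_shrinkEst_le {r r' : ℝ → ℝ} (hp : 1 ≤ p) (hn : 1 ≤ n)
    (hr : IsGoodShrinkage p n r r') {f : ℝ → ℝ} (hf : Measurable f) (θ : Euc p) {η : ℝ}
    (hη : 0 < η) : risk f (shrinkEst r : Euc p × Euc n → Euc p) θ η ≤ constRisk p n f := by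
  have e : ∀ (d : Euc p) (y : Euc p × Euc n), ENNReal.ofReal (loss d θ η * density f θ η y)
      = ENNReal.ofReal (‖d - θ‖ ^ 2) * ENNReal.ofReal
        (η * (η ^ (((p : ℝ) + n) / 2) * f (η * (‖y.1 - θ‖ ^ 2 + ‖y.2‖ ^ 2)))) := fun d y => by
    rw [← ENNReal.ofReal_mul (sq_nonneg _), loss, density]; ring_nf
  rw [← lintegral_loss_density hf θ hη, risk]
  simp only [e]
  exact lintegral_shrinkEst_le hp hn hr
    (φ := fun t => ENNReal.ofReal (η * (η ^ (((p : ℝ) + n) / 2) * f (η * t)))) (by fun_prop) θ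

/-- Symmetrization about `x`: no decision does better than `x` against a symmetric weight. -/
theorem setLIntegral_closedBall_le (x d : Euc p) (K : ℝ) {ψ : ℝ → ℝ≥0∞} (hψ : Measurable ψ) :
    ∫⁻ u in Metric.closedBall (0 : Euc p) K, ENNReal.ofReal (‖u‖ ^ 2) * ψ (‖u‖ ^ 2)
      ≤ ∫⁻ θ in Metric.closedBall x K, ENNReal.ofReal (‖d - θ‖ ^ 2) * ψ (‖x - θ‖ ^ 2) := by
  set S : Set (Euc p) := Metric.closedBall 0 K
  have mS : MeasurableSet S := Metric.isClosed_closedBall.measurableSet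
  set J : Euc p → ℝ≥0∞ := fun θ => (Metric.closedBall x K).indicator
    (fun θ => ENNReal.ofReal (‖d - θ‖ ^ 2) * ψ (‖x - θ‖ ^ 2)) θ with hJ
  have hS1 : ∀ u, x + u ∈ Metric.closedBall x K ↔ u ∈ S := fun u => by
    simp [S]
  have hS2 : ∀ u, x - u ∈ Metric.closedBall x K ↔ u ∈ S := fun u => by
    simp [S]
  have e1 : ∫⁻ θ in Metric.closedBall x K, ENNReal.ofReal (‖d - θ‖ ^ 2) * ψ (‖x - θ‖ ^ 2)
      = ∫⁻ u in S, ENNReal.ofReal (‖d - (x + u)‖ ^ 2) * ψ (‖u‖ ^ 2) := by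
    rw [← lintegral_indicator Metric.isClosed_closedBall.measurableSet, ← lintegral_indicator mS,
      ← lintegral_add_left_eq_self _ x]
    refine lintegral_congr fun u => ?_
    by_cases hu : u ∈ S
    · rw [indicator_of_mem hu, indicator_of_mem ((hS1 u).2 hu)]; simp
    · rw [indicator_of_notMem hu, indicator_of_notMem (fun h => hu ((hS1 u).1 h))]
  have e2 : ∫⁻ θ in Metric.closedBall x K, ENNReal.ofReal (‖d - θ‖ ^ 2) * ψ (‖x - θ‖ ^ 2)
      = ∫⁻ u in S, ENNReal.ofReal (‖d - (x - u)‖ ^ 2) * ψ (‖u‖ ^ 2) := by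
    rw [← lintegral_indicator Metric.isClosed_closedBall.measurableSet, ← lintegral_indicator mS,
      ← lintegral_sub_left_eq_self _ x]
    refine lintegral_congr fun u => ?_
    by_cases hu : u ∈ S
    · rw [indicator_of_mem hu, indicator_of_mem ((hS2 u).2 hu)]; simp
    · rw [indicator_of_notMem hu, indicator_of_notMem (fun h => hu ((hS2 u).1 h))]
  have h2 : 2 * ∫⁻ u in S, ENNReal.ofReal (‖u‖ ^ 2) * ψ (‖u‖ ^ 2)
      ≤ 2 * ∫⁻ θ in Metric.closedBall x K, ENNReal.ofReal (‖d - θ‖ ^ 2) * ψ (‖x - θ‖ ^ 2) := by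
    calc _ = ∫⁻ u in S, ENNReal.ofReal (2 * ‖u‖ ^ 2) * ψ (‖u‖ ^ 2) := by
          rw [← lintegral_const_mul _ (by fun_prop)]
          refine lintegral_congr fun u => ?_
          rw [ENNReal.ofReal_mul two_pos.le, ENNReal.ofReal_ofNat, mul_assoc]
      _ ≤ ∫⁻ u in S, (ENNReal.ofReal (‖d - (x + u)‖ ^ 2) * ψ (‖u‖ ^ 2)
            + ENNReal.ofReal (‖d - (x - u)‖ ^ 2) * ψ (‖u‖ ^ 2)) := by
          refine lintegral_mono fun u => ?_
          rw [← add_mul, ← ENNReal.ofReal_add (sq_nonneg _) (sq_nonneg _)]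
          gcongr
          have h := parallelogram_law_with_norm ℝ (d - x) u
          rw [show d - (x + u) = d - x - u by abel, show d - (x - u) = d - x + u by abel]
          nlinarith [mul_self_nonneg ‖d - x‖]
      _ = _ := by
          rw [lintegral_add_left (by fun_prop), ← e1, ← e2, two_mul]
  exact (ENNReal.mul_le_mul_iff_right (by simp) (by simp)).1 h2

/-- The maximal risk dominates the average over `θ` uniform on a ball of radius `R + K`, at `η = 1`.
For `x` in the ball of radius `R` the `θ` within `K` of `x` all lie in that ball, and against this
symmetric set no decision beats `x`. -/
theorem volume_closedBall_mul_le_maxRisk {f : ℝ → ℝ} (hf : Measurable f)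
    {δ : Euc p × Euc n → Euc p} (hδ : Measurable δ) {R K : ℝ} :
    volume (Metric.closedBall (0 : Euc p) R) *
      ∫⁻ z : Euc n, ∫⁻ u in Metric.closedBall (0 : Euc p) K,
        ENNReal.ofReal (‖u‖ ^ 2) * ENNReal.ofReal (f (‖u‖ ^ 2 + ‖z‖ ^ 2))
      ≤ maxRisk f δ * volume (Metric.closedBall (0 : Euc p) (R + K)) := by
  set B : Set (Euc p) := Metric.closedBall 0 (R + K)
  set H : Euc p → Euc p × Euc n → ℝ≥0∞ := fun θ y =>
    ENNReal.ofReal (‖δ y - θ‖ ^ 2) * ENNReal.ofReal (f (‖y.1 - θ‖ ^ 2 + ‖y.2‖ ^ 2)) with hH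
  have mH : Measurable (Function.uncurry H) := by
    change Measurable fun q : Euc p × (Euc p × Euc n) => ENNReal.ofReal (‖δ q.2 - q.1‖ ^ 2) *
      ENNReal.ofReal (f (‖q.2.1 - q.1‖ ^ 2 + ‖q.2.2‖ ^ 2))
    have h1 : Measurable fun q : Euc p × (Euc p × Euc n) => δ q.2 := hδ.comp measurable_snd
    have h2 : Measurable fun q : Euc p × (Euc p × Euc n) => δ q.2 - q.1 := h1.sub measurable_fst
    exact (h2.norm.pow_const 2).ennreal_ofReal.mul (by fun_prop)
  have h1 : ∫⁻ θ in B, ∫⁻ y, H θ y ≤ maxRisk f δ * volume B := by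
    rw [← setLIntegral_const]
    refine lintegral_mono fun θ => ?_
    have : ∫⁻ y, H θ y = risk f δ θ 1 := by
      refine lintegral_congr fun y => ?_
      simp only [hH, loss, density, Real.one_rpow, one_mul]
      rw [← ENNReal.ofReal_mul (sq_nonneg _)]
    rw [this]
    exact le_iSup_of_le θ (le_iSup_of_le 1 (le_iSup_of_le one_pos le_rfl))
  refine le_trans ?_ h1
  rw [lintegral_lintegral_swap mH.aemeasurable, Measure.volume_eq_prod,
    lintegral_prod _ (by exact (mH.comp measurable_swap).lintegral_prod_right'.aemeasurable),
    mul_comm, ← setLIntegral_const]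
  refine le_trans ?_ (setLIntegral_le_lintegral (Metric.closedBall 0 R) _)
  refine setLIntegral_mono' Metric.isClosed_closedBall.measurableSet fun x hx => ?_
  refine lintegral_mono fun z => ?_
  refine (setLIntegral_closedBall_le x (δ (x, z)) K
    (ψ := fun t => ENNReal.ofReal (f (t + ‖z‖ ^ 2))) (by fun_prop)).trans ?_
  refine lintegral_mono_set (Metric.closedBall_subset_closedBall' ?_)
  have : dist x 0 ≤ R := hx
  linarith

/-- In the previous bound the volume ratio `((R+K)/R)^p` tends to `1` as `R → ∞` with `K` fixed;
monotone convergence in `K` then recovers the full risk of `x`, finite or not. -/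
theorem constRisk_le_maxRisk {f : ℝ → ℝ} (hf : Measurable f)
    {δ : Euc p × Euc n → Euc p} (hδ : Measurable δ) : constRisk p n f ≤ maxRisk f δ := by
  set VK : ℕ → ℝ≥0∞ := fun K => ∫⁻ z : Euc n, ∫⁻ u in Metric.closedBall (0 : Euc p) K,
        ENNReal.ofReal (‖u‖ ^ 2) * ENNReal.ofReal (f (‖u‖ ^ 2 + ‖z‖ ^ 2)) with hVK
  have hle : ∀ K, VK K ≤ maxRisk f δ := fun K => by
    have ht : Tendsto (fun R : ℝ => maxRisk f δ * ENNReal.ofReal (((R + K) / R) ^ p)) atTop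
        (𝓝 (maxRisk f δ * ENNReal.ofReal (1 ^ p))) := by
      refine ENNReal.Tendsto.const_mul (ENNReal.tendsto_ofReal (Tendsto.pow ?_ p))
        (Or.inl (by simp))
      have : Tendsto (fun R : ℝ => 1 + K / R) atTop (𝓝 (1 + 0)) :=
        tendsto_const_nhds.add (tendsto_const_nhds.div_atTop tendsto_id)
      rw [add_zero] at this
      refine this.congr' ?_
      filter_upwards [eventually_gt_atTop 0] with R hR
      field_simp
    rw [one_pow, ENNReal.ofReal_one, mul_one] at ht
    refine ge_of_tendsto ht ?_
    filter_upwards [eventually_gt_atTop 0] with R hR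
    have h := volume_closedBall_mul_le_maxRisk hf hδ (R := R) (K := K)
    rw [Measure.addHaar_closedBall _ _ hR.le, Measure.addHaar_closedBall _ _ (by positivity),
      finrank_euclideanSpace_fin] at h
    have hv0 : volume (Metric.ball (0 : Euc p) 1) ≠ 0 := (Metric.measure_ball_pos _ _ one_pos).ne'
    have hv1 : volume (Metric.ball (0 : Euc p) 1) ≠ ∞ := measure_ball_lt_top.ne
    have h2 : ENNReal.ofReal (R ^ p) * VK K ≤ maxRisk f δ * ENNReal.ofReal ((R + K) ^ p) := by
      rw [← ENNReal.mul_le_mul_iff_left hv0 hv1]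
      calc _ = ENNReal.ofReal (R ^ p) * volume (Metric.ball (0 : Euc p) 1) * VK K := by ring
        _ ≤ _ := h
        _ = _ := by ring
    have hRp : ENNReal.ofReal (R ^ p) ≠ 0 := by
      simpa using pow_pos hR p
    rw [← ENNReal.mul_le_mul_iff_right hRp ENNReal.ofReal_ne_top]
    refine h2.trans (le_of_eq ?_)
    rw [mul_left_comm, ← ENNReal.ofReal_mul (by positivity)]
    congr 2
    rw [← mul_pow]; field_simp
  have hV : constRisk p n f = ⨆ K, VK K := by
    have mono : Monotone fun (K : ℕ) => fun y : Euc p × Euc n =>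
        (Metric.closedBall (0 : Euc p) K).indicator (fun u => ENNReal.ofReal (‖u‖ ^ 2) *
          ENNReal.ofReal (f (‖u‖ ^ 2 + ‖y.2‖ ^ 2))) y.1 := fun K L hKL y =>
      indicator_le_indicator_of_subset (Metric.closedBall_subset_closedBall (by exact_mod_cast hKL))
        (fun _ => zero_le) _
    have hm : ∀ K : ℕ, Measurable fun y : Euc p × Euc n =>
        (Metric.closedBall (0 : Euc p) K).indicator (fun u => ENNReal.ofReal (‖u‖ ^ 2) *
          ENNReal.ofReal (f (‖u‖ ^ 2 + ‖y.2‖ ^ 2))) y.1 := fun K => by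
      have : Measurable (((Metric.closedBall (0 : Euc p) K) ×ˢ (univ : Set (Euc n))).indicator
          fun y : Euc p × Euc n => ENNReal.ofReal (‖y.1‖ ^ 2) *
            ENNReal.ofReal (f (‖y.1‖ ^ 2 + ‖y.2‖ ^ 2))) :=
        Measurable.indicator (by fun_prop)
          (Metric.isClosed_closedBall.measurableSet.prod MeasurableSet.univ)
      convert! this using 2 with y
      simp [indicator]
    have e : ∀ K : ℕ, VK K = ∫⁻ y : Euc p × Euc n, (Metric.closedBall (0 : Euc p) K).indicator
        (fun u => ENNReal.ofReal (‖u‖ ^ 2) * ENNReal.ofReal (f (‖u‖ ^ 2 + ‖y.2‖ ^ 2))) y.1 :=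
      fun K => by
        rw [Measure.volume_eq_prod, lintegral_prod_symm _ (hm K).aemeasurable]
        refine lintegral_congr fun z => ?_
        rw [← lintegral_indicator Metric.isClosed_closedBall.measurableSet]
    simp only [e]
    rw [← lintegral_iSup hm mono]
    refine lintegral_congr fun y => ?_
    obtain ⟨K, hK⟩ := exists_nat_ge ‖y.1‖
    rw [ENNReal.ofReal_mul (sq_nonneg _)]
    refine le_antisymm (le_iSup_of_le K ?_) (iSup_le fun K => indicator_le_self _ _ _)
    rw [indicator_of_mem (by simpa using hK)]
  rw [hV]
  exact iSup_le hle

theorem isMinimax_of_eq_shrinkEst {r r' : ℝ → ℝ} (hp : 1 ≤ p) (hn : 1 ≤ n)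
    (hr : IsGoodShrinkage p n r r') {f : ℝ → ℝ} (hf : Measurable f)
    {δ : Euc p × Euc n → Euc p} (hδ : Measurable δ)
    (h : ∀ x : Euc p, ∀ z : Euc n, z ≠ 0 → δ (x, z) = shrinkEst r (x, z)) : IsMinimax f δ := by
  refine ⟨hδ, fun δ' hδ' => le_trans ?_ (constRisk_le_maxRisk hf hδ')⟩
  refine iSup_le fun θ => iSup_le fun η => iSup_le fun hη => ?_
  refine le_trans (le_of_eq ?_) (risk_shrinkEst_le hp hn hr hf θ hη)
  have hae : ∀ᵐ y : Euc p × Euc n, y.2 ≠ 0 :=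
    Measure.quasiMeasurePreserving_snd.ae (ae_ne_zero_of_pos hn)
  refine lintegral_congr_ae ?_
  filter_upwards [hae] with y hy
  rw [h y.1 y.2 hy]

end

/-! ### Mean squared distance, gamma mixtures and Gaussian second moments. -/

section

variable {p n : ℕ}

/-- The mean is the unique minimizer of the mean squared distance. -/
theorem lintegral_sq_mean_lt {Ω : Type*} [MeasurableSpace Ω] {ω : Measure Ω} [IsFiniteMeasure ω]
    (hω : ω ≠ 0) {X : Ω → Euc p} (hX : Measurable X)
    (h2 : ∫⁻ q, ENNReal.ofReal (‖(0 : Euc p) - X q‖ ^ 2) ∂ω < ∞) {d : Euc p}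
    (hd : d ≠ (ω.real univ)⁻¹ • ∫ q, X q ∂ω) :
    ∫⁻ q, ENNReal.ofReal (‖(ω.real univ)⁻¹ • ∫ q, X q ∂ω - X q‖ ^ 2) ∂ω
      < ∫⁻ q, ENNReal.ofReal (‖d - X q‖ ^ 2) ∂ω := by
  set c : Euc p := (ω.real univ)⁻¹ • ∫ q, X q ∂ω with hc
  have hpos : 0 < ω.real univ := by
    rw [measureReal_def]
    exact ENNReal.toReal_pos (by simpa using hω) (measure_ne_top _ _)
  have hL : MemLp X 2 ω := by
    rw [memLp_two_iff_integrable_sq_norm hX.aestronglyMeasurable]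
    refine ⟨(hX.norm.pow_const 2).aestronglyMeasurable, ?_⟩
    rw [hasFiniteIntegral_iff_ofReal (Eventually.of_forall fun q => sq_nonneg _)]
    simpa using h2
  have iX : Integrable X ω := hL.integrable (by norm_num)
  have iD : ∀ v : Euc p, Integrable (fun q => ‖v - X q‖ ^ 2) ω := fun v =>
    (memLp_two_iff_integrable_sq_norm (by fun_prop)).1 ((memLp_const v).sub hL)
  have e : ∀ v : Euc p, ∫⁻ q, ENNReal.ofReal (‖v - X q‖ ^ 2) ∂ω
      = ENNReal.ofReal (∫ q, ‖v - X q‖ ^ 2 ∂ω) := fun v =>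
    (ofReal_integral_eq_lintegral_ofReal (iD v) (Eventually.of_forall fun q => sq_nonneg _)).symm
  have hcross : ∫ q, inner ℝ (d - c) (c - X q) ∂ω = 0 := by
    have icx : Integrable (fun q => c - X q) ω := (integrable_const c).sub iX
    rw [integral_inner icx,
      integral_sub (integrable_const c) iX, integral_const, hc, smul_smul,
      mul_inv_cancel₀ hpos.ne', one_smul, sub_self, inner_zero_right]
  have iin : Integrable (fun q => inner ℝ (d - c) (c - X q)) ω :=
    ((integrable_const c).sub iX).const_inner (d - c)
  have key : ∫ q, ‖d - X q‖ ^ 2 ∂ω = ∫ q, ‖c - X q‖ ^ 2 ∂ω + ‖d - c‖ ^ 2 * ω.real univ := by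
    have e1 : ∀ q, ‖d - X q‖ ^ 2
        = ‖c - X q‖ ^ 2 + (2 * inner ℝ (d - c) (c - X q) + ‖d - c‖ ^ 2) := fun q => by
      rw [show d - X q = (d - c) + (c - X q) by abel, norm_add_sq_real]; ring
    have i2 : Integrable (fun q => 2 * inner ℝ (d - c) (c - X q) + ‖d - c‖ ^ 2) ω :=
      (iin.const_mul 2).add (integrable_const _)
    simp only [e1]
    rw [integral_add (iD c) i2, integral_add (iin.const_mul 2) (integrable_const _),
      integral_const_mul, hcross, integral_const, smul_eq_mul]
    ring
  have hdc : 0 < ‖d - c‖ ^ 2 * ω.real univ := by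
    have : d - c ≠ 0 := sub_ne_zero.2 hd
    positivity
  rw [e, e, key]
  refine (ENNReal.ofReal_lt_ofReal_iff ?_).2 (by linarith)
  have : 0 ≤ ∫ q, ‖c - X q‖ ^ 2 ∂ω := integral_nonneg fun q => sq_nonneg _
  linarith

theorem lintegral_gamma {k A : ℝ} (hk : 0 < k) (hA : 0 < A) :
    ∫⁻ u in Ioi (0 : ℝ), ENNReal.ofReal (u ^ (k - 1) * Real.exp (-(A * u)))
      = ENNReal.ofReal (Real.Gamma k * A ^ (-k)) := by
  have hi : IntegrableOn (fun u : ℝ => u ^ (k - 1) * Real.exp (-(A * u))) (Ioi 0) := by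
    have := integrableOn_rpow_mul_exp_neg_mul_rpow (s := k - 1) (p := 1) (b := A) (by linarith)
      one_pos hA
    simpa only [Real.rpow_one, neg_mul] using this
  rw [← ofReal_integral_eq_lintegral_ofReal hi ((ae_restrict_iff' measurableSet_Ioi).2
      (Eventually.of_forall fun u hu => mul_nonneg (Real.rpow_nonneg (le_of_lt hu) _)
        (Real.exp_pos _).le)), Real.integral_rpow_mul_exp_neg_mul_Ioi hk hA,
    one_div, Real.inv_rpow hA.le, Real.rpow_neg hA.le, mul_comm]

/-- The substitution `u = t/(1-t)`, chosen because `1/(1+u) = 1 - t` will be the factor multiplying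
`x` in the Gaussian centre. -/
theorem lintegral_Ioi_eq_lintegral_Ioo (h : ℝ → ℝ≥0∞) :
    ∫⁻ u in Ioi (0 : ℝ), h u
      = ∫⁻ t in Ioo (0 : ℝ) 1, ENNReal.ofReal (1 / (1 - t) ^ 2) * h (t / (1 - t)) := by
  have himg : (fun t : ℝ => t / (1 - t)) '' Ioo 0 1 = Ioi 0 := by
    ext u
    constructor
    · rintro ⟨t, ht, rfl⟩
      exact div_pos ht.1 (by linarith [ht.2])
    · intro hu
      have hu : 0 < u := hu
      refine ⟨u / (1 + u), ⟨by positivity, (div_lt_one (by positivity)).2 (by linarith)⟩, ?_⟩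
      have : 1 - u / (1 + u) = 1 / (1 + u) := by field_simp; ring
      simp only [this]; field_simp
  rw [← himg, lintegral_image_eq_lintegral_abs_deriv_mul measurableSet_Ioo
    (f' := fun t => 1 / (1 - t) ^ 2)]
  · refine setLIntegral_congr_fun measurableSet_Ioo fun t ht => ?_
    rw [abs_of_nonneg (by positivity)]
  · intro t ht
    have h1 : HasDerivAt (fun t : ℝ => 1 - t) (-1) t := by
      simpa using (hasDerivAt_id t).const_sub 1
    have h2 := (hasDerivAt_id t).div h1 (by linarith [ht.2])
    refine HasDerivAt.hasDerivWithinAt ?_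
    convert! h2 using 1
    simp
  · intro t ht u hu htu
    have h1 : 1 - t ≠ 0 := by linarith [ht.2]
    have h2 : 1 - u ≠ 0 := by linarith [hu.2]
    simp only at htu
    rw [div_eq_div_iff h1 h2] at htu
    linarith

/-- The power `R^(-m)` is a gamma integral in `η`, and `A^(-k)` is one whose variable is scaled by
the same `η`. With `A = ‖θ‖²` and `R = ‖x-θ‖² + s` the exponent becomes `η` times one quadratic in
`θ`. -/
theorem gamma_mixture {k m A R : ℝ} (hk : 0 < k) (hm : 0 < m) (hA : 0 < A) (hR : 0 < R) :
    ENNReal.ofReal (Real.Gamma k * Real.Gamma m) * ENNReal.ofReal (A ^ (-k) * R ^ (-m))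
      = ∫⁻ t in Ioo (0 : ℝ) 1, ∫⁻ η in Ioi (0 : ℝ), ENNReal.ofReal
          (t ^ (k - 1) * (1 - t) ^ (-k - 1) *
            (η ^ (m + k - 1) * Real.exp (-(η * (R + t / (1 - t) * A))))) := by
  rw [lintegral_lintegral_swap (by fun_prop)]
  have inner : ∀ η ∈ Ioi (0 : ℝ), ∫⁻ t in Ioo (0 : ℝ) 1, ENNReal.ofReal
          (t ^ (k - 1) * (1 - t) ^ (-k - 1) *
            (η ^ (m + k - 1) * Real.exp (-(η * (R + t / (1 - t) * A)))))
      = ENNReal.ofReal (Real.Gamma k * A ^ (-k)) *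
        ENNReal.ofReal (η ^ (m - 1) * Real.exp (-(R * η))) := fun η hη => by
    have hη : 0 < η := hη
    have h := lintegral_gamma hk (mul_pos hη hA)
    rw [lintegral_Ioi_eq_lintegral_Ioo] at h
    have e1 : ENNReal.ofReal (Real.Gamma k * A ^ (-k)) *
        ENNReal.ofReal (η ^ (m - 1) * Real.exp (-(R * η)))
        = ENNReal.ofReal (η ^ (m + k - 1) * Real.exp (-(R * η))) *
          ENNReal.ofReal (Real.Gamma k * (η * A) ^ (-k)) := by
      rw [← ENNReal.ofReal_mul (by positivity), ← ENNReal.ofReal_mul (by positivity)]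
      congr 1
      rw [Real.mul_rpow hη.le hA.le, show m - 1 = m + k - 1 + -k by ring, Real.rpow_add hη]
      ring
    rw [e1, ← h, ← lintegral_const_mul _ (by fun_prop)]
    refine setLIntegral_congr_fun measurableSet_Ioo fun t ht => ?_
    have ht1 : 0 < 1 - t := by linarith [ht.2]
    have ht0 : 0 < t := ht.1
    rw [← ENNReal.ofReal_mul (by positivity), ← ENNReal.ofReal_mul (by positivity)]
    congr 1
    rw [show -(η * (R + t / (1 - t) * A)) = -(R * η) + -(η * A * (t / (1 - t))) by ring,
      Real.exp_add, Real.div_rpow ht0.le ht1.le,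
      show -k - 1 = -(k - 1) + -(2 : ℕ) by push_cast; ring, Real.rpow_add ht1,
      Real.rpow_neg ht1.le, Real.rpow_neg ht1.le, Real.rpow_natCast]
    field_simp
  rw [setLIntegral_congr_fun measurableSet_Ioi inner, lintegral_const_mul _ (by fun_prop),
    lintegral_gamma hm hR, ← ENNReal.ofReal_mul, ← ENNReal.ofReal_mul]
  · congr 1; ring
  · have := Real.Gamma_pos_of_pos hk; positivity
  · have := Real.Gamma_pos_of_pos hk
    have := Real.Gamma_pos_of_pos hm; positivity

theorem two_mul_ofReal (a : ℝ) : 2 * ENNReal.ofReal a = ENNReal.ofReal (2 * a) := by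
  rw [ENNReal.ofReal_mul two_pos.le, ENNReal.ofReal_ofNat]

/-- `∫ e^{-‖u‖²} du`. -/
noncomputable def gaussMass (p : ℕ) : ℝ≥0∞ := ∫⁻ u : Euc p, ENNReal.ofReal (Real.exp (-‖u‖ ^ 2))

/-- `∫ ‖u‖² e^{-‖u‖²} du`. -/
noncomputable def gaussSecond (p : ℕ) : ℝ≥0∞ :=
  ∫⁻ u : Euc p, ENNReal.ofReal (‖u‖ ^ 2) * ENNReal.ofReal (Real.exp (-‖u‖ ^ 2))

theorem gaussMass_lt_top (p : ℕ) : gaussMass p < ∞ := by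
  have h := GaussianFourier.integrable_cexp_neg_mul_sq_norm_add (V := Euc p) (b := 1)
    (by simp) 0 0
  have h2 := h.norm
  refine (hasFiniteIntegral_iff_ofReal (f := fun u : Euc p => Real.exp (-‖u‖ ^ 2))
    (Eventually.of_forall fun u => (Real.exp_pos _).le)).1 ?_
  refine (h2.congr (Eventually.of_forall fun u => ?_)).2
  simp [Complex.norm_exp, ← Complex.ofReal_pow]

theorem gaussMass_ne_zero (p : ℕ) : gaussMass p ≠ 0 := by
  rw [gaussMass, Ne, lintegral_eq_zero_iff (by fun_prop)]
  intro h
  have : ∀ᵐ _ : Euc p, False := by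
    filter_upwards [h] with u hu
    simp only [Pi.zero_apply, ENNReal.ofReal_eq_zero] at hu
    exact absurd (Real.exp_pos (-‖u‖ ^ 2)) (not_lt.2 hu)
  rw [eventually_false_iff_eq_bot, ae_eq_bot] at this
  exact NeZero.ne _ this

theorem gaussian_second_moment (d c : Euc p) {β : ℝ} (hβ : 0 < β) :
    ∫⁻ θ : Euc p, ENNReal.ofReal (‖d - θ‖ ^ 2) * ENNReal.ofReal (Real.exp (-(β * ‖θ - c‖ ^ 2)))
      = ENNReal.ofReal (β ^ (-(p : ℝ) / 2)) * (ENNReal.ofReal (‖d - c‖ ^ 2) * gaussMass p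
        + ENNReal.ofReal β⁻¹ * gaussSecond p) := by
  have hs : 0 < √β := Real.sqrt_pos.2 hβ
  have hs2 : √β ^ 2 = β := Real.sq_sqrt hβ.le
  set E : Euc p → ℝ≥0∞ := fun u => ENNReal.ofReal (Real.exp (-(β * ‖u‖ ^ 2))) with hE
  have mE : Measurable E := by rw [hE]; fun_prop
  have e1 : ∫⁻ θ : Euc p,
      ENNReal.ofReal (‖d - θ‖ ^ 2) * ENNReal.ofReal (Real.exp (-(β * ‖θ - c‖ ^ 2)))
      = ∫⁻ u : Euc p, ENNReal.ofReal (‖d - c - u‖ ^ 2) * E u := by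
    rw [← lintegral_add_left_eq_self _ c]
    refine lintegral_congr fun u => ?_
    simp [hE, sub_sub]
  -- Averaging over `u` and `-u` removes the cross term through the parallelogram law, without any
  -- integrability argument.
  have e2 : ∫⁻ u : Euc p, ENNReal.ofReal (‖d - c - u‖ ^ 2) * E u
      = ∫⁻ u : Euc p, ENNReal.ofReal (‖d - c + u‖ ^ 2) * E u := by
    rw [← lintegral_neg_eq_self]
    refine lintegral_congr fun u => ?_
    simp [hE]
  have e3 : ∫⁻ u : Euc p, ENNReal.ofReal (‖d - c - u‖ ^ 2) * E u
      = ∫⁻ u : Euc p, (ENNReal.ofReal (‖d - c‖ ^ 2) * E u + ENNReal.ofReal (‖u‖ ^ 2) * E u) := by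
    have : 2 * ∫⁻ u : Euc p, ENNReal.ofReal (‖d - c - u‖ ^ 2) * E u
        = 2 * ∫⁻ u : Euc p,
          (ENNReal.ofReal (‖d - c‖ ^ 2) * E u + ENNReal.ofReal (‖u‖ ^ 2) * E u) := by
      rw [two_mul]
      nth_rewrite 2 [e2]
      rw [← lintegral_add_left (by fun_prop), ← lintegral_const_mul _ (by fun_prop)]
      refine lintegral_congr fun u => ?_
      rw [← add_mul, ← add_mul, ← mul_assoc, ← ENNReal.ofReal_add (sq_nonneg _) (sq_nonneg _),
        ← ENNReal.ofReal_add (sq_nonneg _) (sq_nonneg _), two_mul_ofReal]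
      congr 2
      have h := parallelogram_law_with_norm ℝ (d - c) u
      simp only [sq]
      linarith
    exact (ENNReal.mul_right_inj (by simp) (by simp)).1 this
  have hb : ENNReal.ofReal (β ^ (-(p : ℝ) / 2)) * ENNReal.ofReal (√β ^ p) = 1 := by
    rw [← ENNReal.ofReal_mul (by positivity), Real.sqrt_eq_rpow, ← Real.rpow_natCast,
      ← Real.rpow_mul hβ.le, ← Real.rpow_add hβ]
    ring_nf; simp
  have f1 : ENNReal.ofReal (√β ^ p) * ∫⁻ u : Euc p, E u = gaussMass p := by
    have h := lintegral_comp_smul_of_pos (volume : Measure (Euc p)) hs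
      (g := fun u => ENNReal.ofReal (Real.exp (-‖u‖ ^ 2))) (by fun_prop)
    rw [finrank_euclideanSpace_fin] at h
    rw [gaussMass, ← h]
    congr 1
    refine lintegral_congr fun u => ?_
    simp only [hE]
    rw [norm_smul, mul_pow, Real.norm_eq_abs, sq_abs, hs2]
  have f2 : ENNReal.ofReal (√β ^ p) * ∫⁻ u : Euc p, ENNReal.ofReal (‖u‖ ^ 2) * E u
      = ENNReal.ofReal β⁻¹ * gaussSecond p := by
    have h := lintegral_comp_smul_of_pos (volume : Measure (Euc p)) hs
      (g := fun u => ENNReal.ofReal (‖u‖ ^ 2) * ENNReal.ofReal (Real.exp (-‖u‖ ^ 2)))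
      (by fun_prop)
    rw [finrank_euclideanSpace_fin] at h
    rw [gaussSecond, ← h, mul_left_comm, ← lintegral_const_mul (ENNReal.ofReal β⁻¹) (by fun_prop)]
    congr 1
    refine lintegral_congr fun u => ?_
    simp only [hE]
    rw [norm_smul, mul_pow, Real.norm_eq_abs, sq_abs, hs2, ENNReal.ofReal_mul hβ.le,
      ← mul_assoc, ← mul_assoc, ← ENNReal.ofReal_mul (inv_nonneg.2 hβ.le),
      inv_mul_cancel₀ hβ.ne', ENNReal.ofReal_one, one_mul]
  rw [e1, e3, lintegral_add_left (by fun_prop), lintegral_const_mul _ mE, ← f1, ← f2]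
  set P := ∫⁻ u : Euc p, E u
  set Q := ∫⁻ u : Euc p, ENNReal.ofReal (‖u‖ ^ 2) * E u
  calc _ = 1 * (ENNReal.ofReal (‖d - c‖ ^ 2) * P + Q) := (one_mul _).symm
    _ = _ := by rw [← hb]; ring

theorem gaussSecond_lt_top (p : ℕ) : gaussSecond p < ∞ := by
  have hle : ∀ u : Euc p, ENNReal.ofReal (‖u‖ ^ 2) * ENNReal.ofReal (Real.exp (-‖u‖ ^ 2))
      ≤ 2 * ENNReal.ofReal (Real.exp (-((1 / 2) * ‖u‖ ^ 2))) := fun u => by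
    rw [two_mul_ofReal, ← ENNReal.ofReal_mul (sq_nonneg _)]
    refine ENNReal.ofReal_le_ofReal ?_
    have h1 := Real.add_one_le_exp ((1 / 2) * ‖u‖ ^ 2)
    have h2 : Real.exp (-((1 / 2) * ‖u‖ ^ 2))
        = Real.exp (-‖u‖ ^ 2) * Real.exp ((1 / 2) * ‖u‖ ^ 2) := by
      rw [← Real.exp_add]; ring_nf
    rw [h2]
    nlinarith [Real.exp_pos (-‖u‖ ^ 2)]
  refine (lintegral_mono hle).trans_lt ?_
  rw [lintegral_const_mul _ (by fun_prop)]
  refine ENNReal.mul_lt_top (by simp) ?_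
  have h := GaussianFourier.integrable_cexp_neg_mul_sq_norm_add (V := Euc p) (b := 1 / 2)
    (by simp) 0 0
  refine (hasFiniteIntegral_iff_ofReal (f := fun u : Euc p => Real.exp (-((1 / 2) * ‖u‖ ^ 2)))
    (Eventually.of_forall fun u => (Real.exp_pos _).le)).1 ?_
  refine (h.norm.congr (Eventually.of_forall fun u => ?_)).2
  simp [Complex.norm_exp, ← Complex.ofReal_pow]

end

/-! ### Gaussian mixture form of the posterior of the location. -/

section

variable {p n : ℕ}

theorem sq_complete (x θ : Euc p) {t : ℝ} (ht : t < 1) (s : ℝ) :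
    (‖x - θ‖ ^ 2 + s) + t / (1 - t) * ‖θ‖ ^ 2
      = 1 / (1 - t) * ‖θ - (1 - t) • x‖ ^ 2 + (s + t * ‖x‖ ^ 2) := by
  have h1 : 1 - t ≠ 0 := by linarith
  rw [norm_sub_sq_real, norm_sub_sq_real, inner_smul_right, norm_smul, mul_pow, Real.norm_eq_abs,
    sq_abs, real_inner_comm]
  field_simp
  ring

/-- After completing the square, `θ` is Gaussian about `(1-t)x` with precision proportional to
`η/(1-t)`. Its normalization contributes `(1-t)^(p/2)`, which turns `(1-t)^(-k-1)` into
`(1-t)^(p/2-k-1)` and lowers the power of `η` by `p/2`; the variance term does not involve `d`. -/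
theorem lintegral_sq_mul_mixture (x d : Euc p) {k N s t η : ℝ} (ht : t ∈ Ioo (0 : ℝ) 1)
    (hη : 0 < η) :
    ∫⁻ θ : Euc p, ENNReal.ofReal (‖d - θ‖ ^ 2) * ENNReal.ofReal
        (t ^ (k - 1) * (1 - t) ^ (-k - 1) * (η ^ (N + p / 2 - 1) *
          Real.exp (-(η * ((‖x - θ‖ ^ 2 + s) + t / (1 - t) * ‖θ‖ ^ 2)))))
      = ENNReal.ofReal (betaWeight k (p / 2 - k - 1) t) *
        (ENNReal.ofReal (‖d - (1 - t) • x‖ ^ 2) * gaussMass p *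
            ENNReal.ofReal (η ^ (N - 1) * Real.exp (-((s + t * ‖x‖ ^ 2) * η)))
          + ENNReal.ofReal (1 - t) * gaussSecond p *
            ENNReal.ofReal (η ^ (N - 1 - 1) * Real.exp (-((s + t * ‖x‖ ^ 2) * η)))) := by
  have ht0 : 0 < t := ht.1
  have ht1 : 0 < 1 - t := by linarith [ht.2]
  have hβ : 0 < η * (1 / (1 - t)) := by positivity
  set S : ℝ := s + t * ‖x‖ ^ 2
  have e1 : ∀ θ : Euc p, ENNReal.ofReal (‖d - θ‖ ^ 2) * ENNReal.ofReal
        (t ^ (k - 1) * (1 - t) ^ (-k - 1) * (η ^ (N + p / 2 - 1) *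
          Real.exp (-(η * ((‖x - θ‖ ^ 2 + s) + t / (1 - t) * ‖θ‖ ^ 2)))))
      = ENNReal.ofReal (t ^ (k - 1) * (1 - t) ^ (-k - 1) * η ^ (N + p / 2 - 1)
          * Real.exp (-(S * η))) * (ENNReal.ofReal (‖d - θ‖ ^ 2) *
            ENNReal.ofReal (Real.exp (-(η * (1 / (1 - t)) * ‖θ - (1 - t) • x‖ ^ 2)))) :=
    fun θ => by
      have h1 : t ^ (k - 1) * (1 - t) ^ (-k - 1) * (η ^ (N + p / 2 - 1) *
          Real.exp (-(η * ((‖x - θ‖ ^ 2 + s) + t / (1 - t) * ‖θ‖ ^ 2))))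
          = t ^ (k - 1) * (1 - t) ^ (-k - 1) * η ^ (N + p / 2 - 1) * Real.exp (-(S * η))
            * Real.exp (-(η * (1 / (1 - t)) * ‖θ - (1 - t) • x‖ ^ 2)) := by
        rw [sq_complete x θ ht.2 s, show -(η * (1 / (1 - t) * ‖θ - (1 - t) • x‖ ^ 2 + S))
          = -(S * η) + -(η * (1 / (1 - t)) * ‖θ - (1 - t) • x‖ ^ 2) by ring, Real.exp_add]
        ring
      rw [h1, ENNReal.ofReal_mul (by positivity)]
      ring
  simp only [e1]
  rw [lintegral_const_mul _ (by fun_prop), gaussian_second_moment d _ hβ]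
  have a1 : t ^ (k - 1) * (1 - t) ^ (-k - 1) * η ^ (N + p / 2 - 1) * Real.exp (-(S * η))
        * (η * (1 / (1 - t))) ^ (-(p : ℝ) / 2)
      = betaWeight k (p / 2 - k - 1) t * (η ^ (N - 1) * Real.exp (-(S * η))) := by
    rw [Real.mul_rpow hη.le (by positivity), one_div, Real.inv_rpow ht1.le,
      ← Real.rpow_neg ht1.le, betaWeight,
      show (p : ℝ) / 2 - k - 1 = (-k - 1) + -(-(p : ℝ) / 2) by ring, Real.rpow_add ht1,
      show N - 1 = (N + p / 2 - 1) + -(p : ℝ) / 2 by ring, Real.rpow_add hη]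
    ring
  have a2 : η ^ (N - 1) * (η * (1 / (1 - t)))⁻¹ = (1 - t) * η ^ (N - 1 - 1) := by
    rw [Real.rpow_sub_one hη.ne' (N - 1)]; field_simp
  have hbw := betaWeight_pos (k := k) (b := p / 2 - k - 1) ht
  rw [← mul_assoc, ← ENNReal.ofReal_mul (by positivity), a1, ENNReal.ofReal_mul hbw.le, mul_assoc,
    mul_add]
  congr 2
  · ring
  · rw [← mul_assoc, ← ENNReal.ofReal_mul (by positivity),
      show η ^ (N - 1) * Real.exp (-(S * η)) * (η * (1 / (1 - t)))⁻¹
        = η ^ (N - 1) * (η * (1 / (1 - t)))⁻¹ * Real.exp (-(S * η)) by ring, a2,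
      mul_assoc (1 - t), ENNReal.ofReal_mul ht1.le]
    ring

theorem lintegral_sq_mul_weight (hp : 1 ≤ p) (x d : Euc p) {k m N s : ℝ} (hk : 0 < k) (hm : 0 < m)
    (hN : 1 < N) (hs : 0 < s) (hmk : m + k = N + p / 2) :
    ENNReal.ofReal (Real.Gamma k * Real.Gamma m) * ∫⁻ θ : Euc p, ENNReal.ofReal (‖d - θ‖ ^ 2) *
        ENNReal.ofReal ((‖θ‖ ^ 2) ^ (-k) * (‖x - θ‖ ^ 2 + s) ^ (-m))
      = ∫⁻ t in Ioo (0 : ℝ) 1, ENNReal.ofReal (betaWeight k (p / 2 - k - 1) t) *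
        (ENNReal.ofReal (‖d - (1 - t) • x‖ ^ 2) * gaussMass p *
            ENNReal.ofReal (Real.Gamma N * (s + t * ‖x‖ ^ 2) ^ (-N))
          + ENNReal.ofReal (1 - t) * gaussSecond p *
            ENNReal.ofReal (Real.Gamma (N - 1) * (s + t * ‖x‖ ^ 2) ^ (-(N - 1)))) := by
  set H : Euc p → ℝ → ℝ → ℝ≥0∞ := fun θ t η => ENNReal.ofReal (‖d - θ‖ ^ 2) * ENNReal.ofReal
        (t ^ (k - 1) * (1 - t) ^ (-k - 1) * (η ^ (N + p / 2 - 1) *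
          Real.exp (-(η * ((‖x - θ‖ ^ 2 + s) + t / (1 - t) * ‖θ‖ ^ 2))))) with hH
  have e1 : ENNReal.ofReal (Real.Gamma k * Real.Gamma m) * ∫⁻ θ : Euc p,
        ENNReal.ofReal (‖d - θ‖ ^ 2) *
        ENNReal.ofReal ((‖θ‖ ^ 2) ^ (-k) * (‖x - θ‖ ^ 2 + s) ^ (-m))
      = ∫⁻ θ : Euc p, ∫⁻ t in Ioo (0 : ℝ) 1, ∫⁻ η in Ioi (0 : ℝ), H θ t η := by
    rw [← lintegral_const_mul _ (by fun_prop)]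
    refine lintegral_congr_ae ?_
    filter_upwards [ae_ne_zero_of_pos hp] with θ hθ
    have hg := gamma_mixture hk hm (A := ‖θ‖ ^ 2) (R := ‖x - θ‖ ^ 2 + s) (by positivity)
      (by positivity)
    rw [mul_left_comm, hg, hmk, ← lintegral_const_mul _
      (Measurable.lintegral_prod_right' (f := fun q : ℝ × ℝ => ENNReal.ofReal
        (q.1 ^ (k - 1) * (1 - q.1) ^ (-k - 1) * (q.2 ^ (N + p / 2 - 1) *
          Real.exp (-(q.2 * ((‖x - θ‖ ^ 2 + s) + q.1 / (1 - q.1) * ‖θ‖ ^ 2))))))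
        (by fun_prop))]
    refine lintegral_congr fun t => ?_
    rw [← lintegral_const_mul _ (by fun_prop)]
  have mH : Measurable fun q : (Euc p × ℝ) × ℝ => H q.1.1 q.1.2 q.2 := by
    rw [hH]; fun_prop
  rw [e1, lintegral_lintegral_swap (mH.lintegral_prod_right').aemeasurable]
  refine setLIntegral_congr_fun measurableSet_Ioo fun t ht => ?_
  have mHt : Measurable fun q : Euc p × ℝ => H q.1 t q.2 := by
    rw [hH]; fun_prop
  rw [lintegral_lintegral_swap mHt.aemeasurable,
    setLIntegral_congr_fun measurableSet_Ioi fun η hη =>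
      lintegral_sq_mul_mixture x d (k := k) (N := N) (s := s) ht hη]
  have hS : 0 < s + t * ‖x‖ ^ 2 := by
    have : 0 ≤ t * ‖x‖ ^ 2 := mul_nonneg ht.1.le (sq_nonneg _)
    linarith
  rw [lintegral_const_mul _ (by fun_prop), lintegral_add_left (by fun_prop),
    lintegral_const_mul _ (by fun_prop), lintegral_const_mul _ (by fun_prop),
    lintegral_gamma (by linarith) hS, lintegral_gamma (by linarith) hS]

/-- The posterior second moments of `θ` about `d`, up to a factor and an additive constant, are
those of `(1 - t) x` with `t` from the beta mixture. -/
theorem exists_lintegral_sq_mul_weight_eq (hp : 1 ≤ p) (x : Euc p) {k m N s : ℝ} (hk : 0 < k)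
    (hkp : k < p / 2) (hm : 0 < m) (hN : 1 < N) (hs : 0 < s) (hmk : m + k = N + p / 2) :
    ∃ A K : ℝ≥0∞, A ≠ 0 ∧ A ≠ ∞ ∧ K ≠ ∞ ∧ ∀ d : Euc p,
      ∫⁻ θ : Euc p, ENNReal.ofReal (‖d - θ‖ ^ 2) *
        ENNReal.ofReal ((‖θ‖ ^ 2) ^ (-k) * (‖x - θ‖ ^ 2 + s) ^ (-m))
      = A * (∫⁻ t in Ioo (0 : ℝ) 1, ENNReal.ofReal (betaWeight k (p / 2 - k - 1) t *
          (1 + ‖x‖ ^ 2 / s * t) ^ (-N)) * ENNReal.ofReal (‖d - (1 - t) • x‖ ^ 2)) + K := by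
  have hGk := Real.Gamma_pos_of_pos hk
  have hGm := Real.Gamma_pos_of_pos hm
  have hGN := Real.Gamma_pos_of_pos (show 0 < N by linarith)
  have hGN1 := Real.Gamma_pos_of_pos (show 0 < N - 1 by linarith)
  set c : ℝ≥0∞ := ENNReal.ofReal (Real.Gamma k * Real.Gamma m)
  have hc0 : c ≠ 0 := by simpa [c] using mul_pos hGk hGm
  have hc1 : c ≠ ∞ := ENNReal.ofReal_ne_top
  set K0 : ℝ≥0∞ := ∫⁻ t in Ioo (0 : ℝ) 1, ENNReal.ofReal (betaWeight k (p / 2 - k - 1) t) *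
    (ENNReal.ofReal (1 - t) * gaussSecond p *
      ENNReal.ofReal (Real.Gamma (N - 1) * (s + t * ‖x‖ ^ 2) ^ (-(N - 1)))) with hK0
  have mbw := measurable_betaWeight k (p / 2 - k - 1)
  have ibw := integrableOn_betaWeight hk (show -1 < (p : ℝ) / 2 - k - 1 by linarith)
  have hK0fin : K0 ≠ ∞ := by
    have hle : K0 ≤ ∫⁻ t in Ioo (0 : ℝ) 1, ENNReal.ofReal (betaWeight k (p / 2 - k - 1) t) *
        (1 * gaussSecond p * ENNReal.ofReal (Real.Gamma (N - 1) * s ^ (-(N - 1)))) := by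
      refine setLIntegral_mono' measurableSet_Ioo fun t ht => ?_
      refine mul_le_mul' le_rfl (mul_le_mul' (mul_le_mul' ?_ le_rfl)
        (ENNReal.ofReal_le_ofReal (mul_le_mul_of_nonneg_left ?_ hGN1.le)))
      · rw [← ENNReal.ofReal_one]
        exact ENNReal.ofReal_le_ofReal (by linarith [ht.1])
      · refine Real.rpow_le_rpow_of_nonpos hs ?_ (by linarith)
        have : 0 ≤ t * ‖x‖ ^ 2 := mul_nonneg ht.1.le (sq_nonneg _)
        linarith
    refine ne_top_of_le_ne_top ?_ hle
    rw [lintegral_mul_const _ mbw.ennreal_ofReal]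
    refine ENNReal.mul_ne_top ?_ (ENNReal.mul_ne_top (by simpa using (gaussSecond_lt_top p).ne)
      ENNReal.ofReal_ne_top)
    exact ((hasFiniteIntegral_iff_ofReal ((ae_restrict_iff' measurableSet_Ioo).2
      (Eventually.of_forall fun t ht => (betaWeight_pos ht).le))).1 ibw.2).ne
  refine ⟨c⁻¹ * (gaussMass p * ENNReal.ofReal (Real.Gamma N * s ^ (-N))), c⁻¹ * K0, ?_, ?_, ?_,
    fun d => ?_⟩
  · refine mul_ne_zero (ENNReal.inv_ne_zero.2 hc1) (mul_ne_zero (gaussMass_ne_zero p) ?_)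
    simpa using mul_pos hGN (Real.rpow_pos_of_pos hs (-N))
  · exact ENNReal.mul_ne_top (ENNReal.inv_ne_top.2 hc0)
      (ENNReal.mul_ne_top (gaussMass_lt_top p).ne ENNReal.ofReal_ne_top)
  · exact ENNReal.mul_ne_top (ENNReal.inv_ne_top.2 hc0) hK0fin
  · have h := lintegral_sq_mul_weight hp x d hk hm hN hs hmk
    have e : ∀ t ∈ Ioo (0 : ℝ) 1, ENNReal.ofReal (betaWeight k (p / 2 - k - 1) t) *
        (ENNReal.ofReal (‖d - (1 - t) • x‖ ^ 2) * gaussMass p *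
            ENNReal.ofReal (Real.Gamma N * (s + t * ‖x‖ ^ 2) ^ (-N))
          + ENNReal.ofReal (1 - t) * gaussSecond p *
            ENNReal.ofReal (Real.Gamma (N - 1) * (s + t * ‖x‖ ^ 2) ^ (-(N - 1))))
        = gaussMass p * ENNReal.ofReal (Real.Gamma N * s ^ (-N)) *
            (ENNReal.ofReal (betaWeight k (p / 2 - k - 1) t * (1 + ‖x‖ ^ 2 / s * t) ^ (-N)) *
              ENNReal.ofReal (‖d - (1 - t) • x‖ ^ 2))
          + ENNReal.ofReal (betaWeight k (p / 2 - k - 1) t) *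
            (ENNReal.ofReal (1 - t) * gaussSecond p *
            ENNReal.ofReal (Real.Gamma (N - 1) * (s + t * ‖x‖ ^ 2) ^ (-(N - 1)))) := by
      intro t ht
      have h1 : 0 ≤ 1 + ‖x‖ ^ 2 / s * t := by have := ht.1; positivity
      have h2 : Real.Gamma N * (s + t * ‖x‖ ^ 2) ^ (-N)
          = Real.Gamma N * s ^ (-N) * (1 + ‖x‖ ^ 2 / s * t) ^ (-N) := by
        rw [show s + t * ‖x‖ ^ 2 = s * (1 + ‖x‖ ^ 2 / s * t) by field_simp,
          Real.mul_rpow hs.le h1]; ring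
      rw [h2, ENNReal.ofReal_mul (by positivity), ENNReal.ofReal_mul (betaWeight_pos ht).le]
      ring
    rw [setLIntegral_congr_fun measurableSet_Ioo e, lintegral_add_right _ (by fun_prop),
      lintegral_const_mul _ (by fun_prop), ← hK0] at h
    rw [mul_assoc, ← mul_add, ← h, ← mul_assoc, ENNReal.inv_mul_cancel hc0 hc1, one_mul]

end

/-! ### Elimination of the scale and identification of the generalized Bayes estimator. -/

section

variable {p n : ℕ}

theorem lintegral_Ioi_comp_mul {R : ℝ} (hR : 0 < R) {G : ℝ → ℝ≥0∞} (hG : Measurable G) :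
    ∫⁻ η in Ioi (0 : ℝ), G (R * η) = ENNReal.ofReal R⁻¹ * ∫⁻ t in Ioi (0 : ℝ), G t := by
  have h := lintegral_comp_smul_of_pos (volume : Measure ℝ) hR
    (g := (Ioi (0 : ℝ)).indicator G) (hG.indicator measurableSet_Ioi)
  rw [Module.finrank_self, pow_one, lintegral_indicator measurableSet_Ioi] at h
  have e : ∫⁻ y : ℝ, (Ioi (0 : ℝ)).indicator G (R • y) = ∫⁻ η in Ioi (0 : ℝ), G (R * η) := by
    rw [← lintegral_indicator measurableSet_Ioi]
    refine lintegral_congr fun y => ?_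
    by_cases hy : 0 < y
    · rw [indicator_of_mem (show R • y ∈ Ioi 0 from mul_pos hR hy),
        indicator_of_mem (show y ∈ Ioi 0 from hy), smul_eq_mul]
    · rw [indicator_of_notMem (show R • y ∉ Ioi 0 from fun h => hy (pos_of_mul_pos_right h hR.le)),
        indicator_of_notMem (show y ∉ Ioi 0 from hy)]
  rw [← h, e, ← mul_assoc, ← ENNReal.ofReal_mul (by positivity), inv_mul_cancel₀ hR.ne',
    ENNReal.ofReal_one, one_mul]

/-- The moment `∫₀^∞ t^τ f(t) dt`. -/
noncomputable def tailMoment (f : ℝ → ℝ) (τ : ℝ) : ℝ≥0∞ :=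
  ∫⁻ t in Ioi (0 : ℝ), ENNReal.ofReal (t ^ τ * f t)

theorem tailMoment_lt_top {a e : ℝ} {f : ℝ → ℝ} (hf0 : ∀ t, 0 ≤ t → 0 ≤ f t)
    (hM : MomentCondition p n a e f) : tailMoment f (((n : ℝ) + p) / 2 - a + e) < ∞ :=
  (hasFiniteIntegral_iff_ofReal ((ae_restrict_iff' measurableSet_Ioi).2
    (Eventually.of_forall fun t ht => mul_nonneg (Real.rpow_nonneg (le_of_lt ht) _)
      (hf0 t (le_of_lt ht))))).1 hM.2

/-- Otherwise `f = 0` almost everywhere on `(0,∞)`, and this must be carried to `ℝ^p × ℝ^n`. Instead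
of polar coordinates, the scale invariance of the risk of `x` is used: it equals its own average
over `η ∈ (0,1)`, and after exchanging integrals the `η`-integral vanishes for almost every `y`. -/
theorem tailMoment_ne_zero (hp : 1 ≤ p) {f : ℝ → ℝ} (hf : IsErrorDensity p n f) (τ : ℝ) :
    tailMoment f τ ≠ 0 := by
  have mf := hf.measurable
  intro h0
  rw [tailMoment, lintegral_eq_zero_iff (by fun_prop)] at h0
  have h1 : ∫⁻ t in Ioi (0 : ℝ), ENNReal.ofReal (f t) = 0 := by
    rw [lintegral_eq_zero_iff (by fun_prop)]
    filter_upwards [h0, ae_restrict_mem measurableSet_Ioi] with t ht ht0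
    have h2 := Real.rpow_pos_of_pos ht0 τ
    simp only [Pi.zero_apply, ENNReal.ofReal_eq_zero] at ht ⊢
    exact nonpos_of_mul_nonpos_right ht h2
  have hm0 : ∀ᵐ y : Euc p × Euc n, y.1 ≠ 0 :=
    Measure.quasiMeasurePreserving_fst.ae (ae_ne_zero_of_pos hp)
  have h2 : constRisk p n f = 0 := by
    have mL : Measurable fun q : ℝ × (Euc p × Euc n) =>
        ENNReal.ofReal (loss q.2.1 0 q.1 * density f 0 q.1 q.2) := by
      unfold loss density; fun_prop
    calc constRisk p n f = ∫⁻ η in Ioo (0 : ℝ) 1, constRisk p n f := by simp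
      _ = ∫⁻ η in Ioo (0 : ℝ) 1, ∫⁻ y : Euc p × Euc n,
            ENNReal.ofReal (loss y.1 0 η * density f 0 η y) :=
          setLIntegral_congr_fun measurableSet_Ioo fun η hη =>
            (lintegral_loss_density mf 0 hη.1).symm
      _ = ∫⁻ y : Euc p × Euc n, ∫⁻ η in Ioo (0 : ℝ) 1,
            ENNReal.ofReal (loss y.1 0 η * density f 0 η y) :=
          lintegral_lintegral_swap mL.aemeasurable
      _ = ∫⁻ y : Euc p × Euc n, 0 := by
          refine lintegral_congr_ae ?_
          filter_upwards [hm0] with y hy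
          have hR : 0 < ‖y.1 - 0‖ ^ 2 + ‖y.2‖ ^ 2 := by
            rw [sub_zero]; positivity
          have h3 := lintegral_Ioi_comp_mul hR (G := fun t => ENNReal.ofReal (f t)) (by fun_prop)
          rw [h1, mul_zero, lintegral_eq_zero_iff (by fun_prop)] at h3
          have mLy : Measurable fun η => ENNReal.ofReal (loss y.1 0 η * density f 0 η y) :=
            mL.comp measurable_prodMk_right
          rw [lintegral_eq_zero_iff mLy]
          filter_upwards [ae_mono (Measure.restrict_mono_set volume Ioo_subset_Ioi_self) h3,
            ae_restrict_mem measurableSet_Ioo] with η hη hη0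
          simp only [Pi.zero_apply, ENNReal.ofReal_eq_zero] at hη ⊢
          have hη1 := hη0.1
          rw [loss, density, ← mul_assoc, mul_comm η (_ + _)]
          exact mul_nonpos_of_nonneg_of_nonpos (by positivity) hη
      _ = 0 := lintegral_zero
  rw [constRisk, lintegral_eq_zero_iff (by fun_prop)] at h2
  have h3 : ∫⁻ y : Euc p × Euc n, ENNReal.ofReal (f (‖y.1‖ ^ 2 + ‖y.2‖ ^ 2)) = 0 := by
    rw [lintegral_eq_zero_iff (by fun_prop)]
    filter_upwards [h2, hm0] with y hy hy0
    simp only [Pi.zero_apply, ENNReal.ofReal_eq_zero] at hy ⊢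
    exact nonpos_of_mul_nonpos_right hy (by positivity)
  rw [hf.lintegral_eq_one] at h3
  exact one_ne_zero h3

theorem posteriorLoss_eq {a e : ℝ} {f : ℝ → ℝ} (hf : Measurable f) (x d : Euc p) {z : Euc n}
    (hz : z ≠ 0) :
    posteriorLoss f (prior a e) (x, z) d = tailMoment f (((n : ℝ) + p) / 2 - a + e) *
      ∫⁻ θ : Euc p, ENNReal.ofReal (‖d - θ‖ ^ 2) * ENNReal.ofReal
        ((‖θ‖ ^ 2) ^ (-((p : ℝ) / 2 + a + 1)) *
          (‖x - θ‖ ^ 2 + ‖z‖ ^ 2) ^ (-(((n : ℝ) + p) / 2 - a + e + 1))) := by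
  set τ : ℝ := ((n : ℝ) + p) / 2 - a + e with hτ
  rw [posteriorLoss, ← lintegral_const_mul _ (by fun_prop)]
  refine lintegral_congr fun θ => ?_
  set R : ℝ := ‖x - θ‖ ^ 2 + ‖z‖ ^ 2 with hRdef
  have hR : 0 < R := by positivity
  have e1 : ∀ η ∈ Ioi (0 : ℝ),
      ENNReal.ofReal (loss d θ η * posterior f (prior a e) (x, z) θ η)
      = ENNReal.ofReal (‖d - θ‖ ^ 2 * ((‖θ‖ ^ 2) ^ (-((p : ℝ) / 2 + a + 1)) * R ^ (-τ))) *
        ENNReal.ofReal ((R * η) ^ τ * f (R * η)) := fun η hη => by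
    have hη : 0 < η := hη
    rw [← ENNReal.ofReal_mul (by positivity)]
    congr 1
    have h1 : ‖θ‖ ^ (-2 * ((p : ℝ) / 2 + a + 1)) = (‖θ‖ ^ 2) ^ (-((p : ℝ) / 2 + a + 1)) := by
      rw [← Real.rpow_natCast, ← Real.rpow_mul (norm_nonneg _)]; push_cast; ring_nf
    have h2 : η * (η ^ (((p : ℝ) + n) / 2) * η ^ (-a - 1 + e)) = η ^ τ := by
      have := Real.rpow_add hη 1 (((p : ℝ) + n) / 2 + (-a - 1 + e))
      rw [Real.rpow_one] at this
      rw [← Real.rpow_add hη, ← this, hτ]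
      congr 1; ring
    have h3 : R ^ (-τ) * (R * η) ^ τ = η ^ τ := by
      rw [Real.mul_rpow hR.le hη.le, ← mul_assoc, ← Real.rpow_add hR, neg_add_cancel,
        Real.rpow_zero, one_mul]
    calc loss d θ η * posterior f (prior a e) (x, z) θ η
        = ‖d - θ‖ ^ 2 * (‖θ‖ ^ (-2 * ((p : ℝ) / 2 + a + 1))) *
          (η * (η ^ (((p : ℝ) + n) / 2) * η ^ (-a - 1 + e))) * f (R * η) := by
          rw [loss, posterior, density, prior, mul_comm R η]; ring
      _ = _ := by rw [h1, h2, ← h3]; ring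
  rw [setLIntegral_congr_fun measurableSet_Ioi e1, lintegral_const_mul _ (by fun_prop),
    lintegral_Ioi_comp_mul hR (G := fun t => ENNReal.ofReal (t ^ τ * f t)) (by fun_prop),
    ← mul_assoc, ← ENNReal.ofReal_mul (by positivity), ← ENNReal.ofReal_mul (by positivity),
    mul_comm, tailMoment]
  congr 2
  rw [neg_add τ 1, Real.rpow_add hR, Real.rpow_neg_one]
  ring

theorem mean_withDensity {Ω : Type*} [MeasurableSpace Ω] {μ : Measure Ω} {g : Ω → ℝ}
    (hg : Measurable g) (h0 : ∀ᵐ q ∂μ, 0 ≤ g q) (X : Ω → Euc p) :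
    ((μ.withDensity fun q => ENNReal.ofReal (g q)).real univ)⁻¹ •
        ∫ q, X q ∂(μ.withDensity fun q => ENNReal.ofReal (g q))
      = (∫ q, g q ∂μ)⁻¹ • ∫ q, g q • X q ∂μ := by
  rw [measureReal_def, withDensity_apply _ MeasurableSet.univ, setLIntegral_univ,
    ← integral_eq_lintegral_of_nonneg_ae h0 hg.aestronglyMeasurable,
    integral_withDensity_eq_integral_toReal_smul hg.ennreal_ofReal
      (Eventually.of_forall fun _ => ENNReal.ofReal_lt_top)]
  congr 1
  refine integral_congr_ae ?_
  filter_upwards [h0] with q hq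
  rw [ENNReal.toReal_ofReal hq]

theorem mean_beta_mixture (x : Euc p) {k b N w : ℝ} (hk : 0 < k) (hb : -1 < b) (hN : 0 ≤ N)
    (hw : 0 ≤ w) :
    (∫ t in Ioo (0 : ℝ) 1, betaWeight k b t * (1 + w * t) ^ (-N))⁻¹ •
        ∫ t in Ioo (0 : ℝ) 1, (betaWeight k b t * (1 + w * t) ^ (-N)) • ((1 - t) • x)
      = (1 - shrink k b N w) • x := by
  have hw' : -(1 / 2) < w := by linarith
  have i0 := integrableOn_betaInt hk hb hN hw'
  have i1 := integrableOn_betaInt (k := k + 1) (by linarith) hb hN hw'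
  have h0 := betaInt_pos hk hb hN hw'
  have e : ∫ t in Ioo (0 : ℝ) 1, (betaWeight k b t * (1 + w * t) ^ (-N)) • ((1 - t) • x)
      = (betaInt k b N w - betaInt (k + 1) b N w) • x := by
    unfold betaInt
    rw [← integral_sub i0 i1, ← integral_smul_const]
    refine setIntegral_congr_fun measurableSet_Ioo fun t ht => ?_
    simp only [smul_smul, betaWeight_succ ht]
    congr 1; ring
  rw [e, smul_smul, shrink]
  congr 1
  change (betaInt k b N w)⁻¹ * _ = _
  field_simp

theorem measurable_genBayes {a e : ℝ} {f : ℝ → ℝ} (hf : Measurable f) :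
    Measurable (genBayes f (prior a e) : Euc p × Euc n → Euc p) := by
  have h1 : Measurable fun q : (Euc p × Euc n) × (Euc p × ℝ) =>
      q.2.2 * posterior f (prior a e) q.1 q.2.1 q.2.2 := by
    unfold posterior density prior; fun_prop
  have h2 : Measurable fun q : (Euc p × Euc n) × (Euc p × ℝ) =>
      (q.2.2 * posterior f (prior a e) q.1 q.2.1 q.2.2) • q.2.1 := h1.smul (by fun_prop)
  exact (h1.stronglyMeasurable.integral_prod_right'.measurable).inv.smul
    h2.stronglyMeasurable.integral_prod_right'.measurable

/-- The posterior loss is expressed in two ways: as the second moment about `d` under the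
`η`-weighted posterior `ω`, and as an increasing affine function of the second moment under the beta
mixture `ω'`. Each has its mean as unique minimizer, so the two means coincide and the mean of `ω`
need not be computed. -/
theorem genBayes_spec (hp : 1 ≤ p) {a e N : ℝ} {f : ℝ → ℝ} (hf : IsErrorDensity p n f)
    (hM : MomentCondition p n a e f) (ha : -(p : ℝ) / 2 - 1 < a) (ha1 : a < -1)
    (hN : N = ((p : ℝ) + n) / 2 + e + 2) (hN1 : 1 < N) (x : Euc p) {z : Euc n} (hz : z ≠ 0) :
    genBayes f (prior a e) (x, z) = shrinkEst (shrink ((p : ℝ) / 2 + a + 1) (-a - 2) N) (x, z) ∧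
      ∀ d, d ≠ genBayes f (prior a e) (x, z) →
        posteriorLoss f (prior a e) (x, z) (genBayes f (prior a e) (x, z))
          < posteriorLoss f (prior a e) (x, z) d := by
  have mf := hf.measurable
  set k : ℝ := (p : ℝ) / 2 + a + 1 with hk
  set m : ℝ := ((n : ℝ) + p) / 2 - a + e + 1 with hm
  have hk0 : 0 < k := by rw [hk]; linarith
  have hs : 0 < ‖z‖ ^ 2 := by positivity
  have hw : 0 ≤ ‖x‖ ^ 2 / ‖z‖ ^ 2 := by positivity
  have hm0 : 0 < m := by
    have : (0 : ℝ) ≤ p := Nat.cast_nonneg p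
    rw [hm]; linarith
  obtain ⟨A, K, hA0, hA1, hK, hQ⟩ := exists_lintegral_sq_mul_weight_eq hp x (N := N)
    (s := ‖z‖ ^ 2) hk0 (by rw [hk]; linarith) hm0 hN1 hs (by rw [hm, hk, hN]; ring)
  rw [show (p : ℝ) / 2 - k - 1 = -a - 2 by rw [hk]; ring] at hQ
  set C := tailMoment f (((n : ℝ) + p) / 2 - a + e) with hC
  have hC0 : C ≠ 0 := tailMoment_ne_zero hp hf _
  have hC1 : C ≠ ∞ := (tailMoment_lt_top hf.nonneg hM).ne
  -- the mixing measure
  set g' : ℝ → ℝ := fun t => betaWeight k (-a - 2) t * (1 + ‖x‖ ^ 2 / ‖z‖ ^ 2 * t) ^ (-N) with hg'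
  have mg' : Measurable g' := (measurable_betaWeight _ _).mul (by fun_prop)
  have hg'0 : ∀ᵐ t ∂(volume.restrict (Ioo (0 : ℝ) 1)), 0 ≤ g' t :=
    (ae_restrict_iff' measurableSet_Ioo).2 (Eventually.of_forall fun t ht =>
      mul_nonneg (betaWeight_pos ht).le (Real.rpow_nonneg (by have := ht.1; positivity) _))
  set ω' : Measure ℝ := (volume.restrict (Ioo (0 : ℝ) 1)).withDensity
    fun t => ENNReal.ofReal (g' t) with hω'
  have hig' := integrableOn_betaInt (b := -a - 2) (N := N) hk0 (by linarith) (by linarith)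
    (show -(1 / 2) < ‖x‖ ^ 2 / ‖z‖ ^ 2 by linarith)
  have huniv' : ω' univ = ENNReal.ofReal (betaInt k (-a - 2) N (‖x‖ ^ 2 / ‖z‖ ^ 2)) := by
    rw [hω', withDensity_apply _ MeasurableSet.univ, setLIntegral_univ, betaInt,
      ofReal_integral_eq_lintegral_ofReal hig' hg'0]
  have fin' : IsFiniteMeasure ω' := ⟨by rw [huniv']; exact ENNReal.ofReal_lt_top⟩
  have hω'0 : ω' ≠ 0 := fun h => by
    have h1 := betaInt_pos (b := -a - 2) (N := N) hk0 (by linarith) (by linarith)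
      (show -(1 / 2) < ‖x‖ ^ 2 / ‖z‖ ^ 2 by linarith)
    rw [h] at huniv'
    simp only [Measure.coe_zero, Pi.zero_apply] at huniv'
    exact absurd (ENNReal.ofReal_eq_zero.1 huniv'.symm) (not_le.2 h1)
  have hX' : Measurable fun t : ℝ => (1 - t) • x := by fun_prop
  have hQ' : ∀ d : Euc p, ∫⁻ t in Ioo (0 : ℝ) 1, ENNReal.ofReal (g' t) *
      ENNReal.ofReal (‖d - (1 - t) • x‖ ^ 2) = ∫⁻ t, ENNReal.ofReal (‖d - (1 - t) • x‖ ^ 2) ∂ω' :=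
    fun d => (lintegral_withDensity_eq_lintegral_mul _ mg'.ennreal_ofReal (by fun_prop)).symm
  have hfin' : ∀ d : Euc p, ∫⁻ t, ENNReal.ofReal (‖d - (1 - t) • x‖ ^ 2) ∂ω' < ∞ := fun d => by
    have hac : ∀ᵐ t ∂ω', t ∈ Ioo (0 : ℝ) 1 :=
      (withDensity_absolutelyContinuous _ _).ae_le (ae_restrict_mem measurableSet_Ioo)
    calc _ ≤ ∫⁻ t, ENNReal.ofReal ((‖d‖ + ‖x‖) ^ 2) ∂ω' := by
          refine lintegral_mono_ae ?_
          filter_upwards [hac] with t ht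
          refine ENNReal.ofReal_le_ofReal (pow_le_pow_left₀ (norm_nonneg _) ?_ 2)
          refine (norm_sub_le _ _).trans (add_le_add le_rfl ?_)
          rw [norm_smul, Real.norm_eq_abs, abs_of_nonneg (by linarith [ht.2])]
          exact mul_le_of_le_one_left (norm_nonneg _) (by linarith [ht.1])
      _ < ∞ := by
          rw [lintegral_const]
          exact ENNReal.mul_lt_top ENNReal.ofReal_lt_top (measure_lt_top _ _)
  set v : Euc p := shrinkEst (shrink k (-a - 2) N) (x, z) with hv
  have hmean' : (ω'.real univ)⁻¹ • ∫ t, (1 - t) • x ∂ω' = v := by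
    rw [hω', mean_withDensity mg' hg'0]
    exact mean_beta_mixture x hk0 (by linarith) (by linarith) hw
  have hmin' : ∀ d, d ≠ v → ∫⁻ t, ENNReal.ofReal (‖v - (1 - t) • x‖ ^ 2) ∂ω'
      < ∫⁻ t, ENNReal.ofReal (‖d - (1 - t) • x‖ ^ 2) ∂ω' := fun d hd => by
    have := lintegral_sq_mean_lt hω'0 hX' (hfin' 0) (d := d) (by rwa [hmean'])
    rwa [hmean'] at this
  -- the posterior
  have hloss : ∀ d, posteriorLoss f (prior a e) (x, z) d
      = C * (A * (∫⁻ t, ENNReal.ofReal (‖d - (1 - t) • x‖ ^ 2) ∂ω') + K) := fun d => by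
    rw [posteriorLoss_eq mf x d hz, hQ d, hQ' d]
  set g : Euc p × ℝ → ℝ := fun q => q.2 * posterior f (prior a e) (x, z) q.1 q.2 with hg
  have mg : Measurable g := by
    rw [hg]; unfold posterior density prior; fun_prop
  set μ : Measure (Euc p × ℝ) := (volume : Measure (Euc p)).prod (volume.restrict (Ioi (0 : ℝ)))
    with hμ
  have hg0 : ∀ᵐ q ∂μ, 0 ≤ g q := by
    have : ∀ᵐ q ∂μ, q.2 ∈ Ioi (0 : ℝ) :=
      Measure.quasiMeasurePreserving_snd.ae (ae_restrict_mem measurableSet_Ioi)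
    filter_upwards [this] with q hq
    have hq : 0 < q.2 := hq
    have h1 := hf.nonneg (q.2 * (‖x - q.1‖ ^ 2 + ‖z‖ ^ 2)) (by positivity)
    simp only [hg, posterior, density, prior]
    positivity
  set ω : Measure (Euc p × ℝ) := μ.withDensity fun q => ENNReal.ofReal (g q) with hω
  have hlossω : ∀ d, posteriorLoss f (prior a e) (x, z) d
      = ∫⁻ q, ENNReal.ofReal (‖d - q.1‖ ^ 2) ∂ω := fun d => by
    have h1 := lintegral_withDensity_eq_lintegral_mul μ mg.ennreal_ofReal
      (g := fun q => ENNReal.ofReal (‖d - q.1‖ ^ 2)) (by fun_prop)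
    rw [hω, h1, hμ, lintegral_prod _ ((mg.ennreal_ofReal.mul (by fun_prop)).aemeasurable)]
    refine lintegral_congr fun θ => lintegral_congr fun η => ?_
    simp only [Pi.mul_apply]
    rw [mul_comm (ENNReal.ofReal (g (θ, η))), ← ENNReal.ofReal_mul (sq_nonneg _), loss, hg]
    congr 1; ring
  have hfin : ∀ d, ∫⁻ q, ENNReal.ofReal (‖d - q.1‖ ^ 2) ∂ω < ∞ := fun d => by
    rw [← hlossω, hloss]
    exact ENNReal.mul_lt_top hC1.lt_top (ENNReal.add_lt_top.2
      ⟨ENNReal.mul_lt_top hA1.lt_top (hfin' d), hK.lt_top⟩)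
  obtain ⟨d1, hd1⟩ : ∃ d1 : Euc p, d1 ≠ 0 := by
    have : Nonempty (Fin p) := ⟨⟨0, hp⟩⟩
    exact exists_ne 0
  -- Finite second moments about two distinct points `0` and `d1` bound the total mass, since `‖d1‖²
  -- ≤ 2(‖θ‖² + ‖d1 - θ‖²)`.
  have finω : IsFiniteMeasure ω := ⟨by
    have hle : ENNReal.ofReal (‖d1‖ ^ 2) * ω univ
        ≤ 2 * (∫⁻ q, ENNReal.ofReal (‖(0 : Euc p) - q.1‖ ^ 2) ∂ω
          + ∫⁻ q, ENNReal.ofReal (‖d1 - q.1‖ ^ 2) ∂ω) := by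
      rw [← lintegral_const, ← lintegral_add_left (by fun_prop),
        ← lintegral_const_mul _ (by fun_prop)]
      refine lintegral_mono fun q => ?_
      simp only
      rw [← ENNReal.ofReal_add (sq_nonneg _) (sq_nonneg _), two_mul_ofReal]
      refine ENNReal.ofReal_le_ofReal ?_
      have h1 := norm_sub_le (d1 - q.1) (0 - q.1)
      rw [show d1 - q.1 - (0 - q.1) = d1 by abel] at h1
      nlinarith [sq_nonneg (‖(0 : Euc p) - q.1‖ - ‖d1 - q.1‖), norm_nonneg d1]
    have h2 : ENNReal.ofReal (‖d1‖ ^ 2) * ω univ < ∞ := hle.trans_lt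
      (ENNReal.mul_lt_top (by simp) (ENNReal.add_lt_top.2 ⟨hfin 0, hfin d1⟩))
    have hpos : ENNReal.ofReal (‖d1‖ ^ 2) ≠ 0 := by
      have : 0 < ‖d1‖ ^ 2 := by positivity
      exact (ENNReal.ofReal_pos.2 this).ne'
    exact ENNReal.lt_top_of_mul_ne_top_right h2.ne hpos⟩
  have hstrict : ∀ d, d ≠ v →
      posteriorLoss f (prior a e) (x, z) v < posteriorLoss f (prior a e) (x, z) d := fun d hd => by
    rw [hloss, hloss]
    refine (ENNReal.mul_lt_mul_iff_right hC0 hC1).2 ?_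
    exact ENNReal.add_lt_add_right hK ((ENNReal.mul_lt_mul_iff_right hA0 hA1).2 (hmin' d hd))
  have hω0 : ω ≠ 0 := fun h => by
    obtain ⟨d, hd⟩ : ∃ d : Euc p, d ≠ v := by
      have : Nonempty (Fin p) := ⟨⟨0, hp⟩⟩
      exact exists_ne v
    have := hstrict d hd
    rw [hlossω, hlossω, h] at this
    simp at this
  have hgB : genBayes f (prior a e) (x, z) = (ω.real univ)⁻¹ • ∫ q, q.1 ∂ω := by
    rw [hω, mean_withDensity mg hg0]
    rfl
  have hstrictω : ∀ d, d ≠ genBayes f (prior a e) (x, z) →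
      posteriorLoss f (prior a e) (x, z) (genBayes f (prior a e) (x, z))
          < posteriorLoss f (prior a e) (x, z) d := fun d hd => by
    rw [hlossω, hlossω, hgB]
    exact lintegral_sq_mean_lt hω0 measurable_fst (hfin 0) (by rwa [← hgB])
  refine ⟨?_, hstrictω⟩
  by_contra hne
  exact lt_asymm (hstrict _ hne) (hstrictω v (Ne.symm hne))

end

/-! ### Translation of the sufficient conditions into conditions on `a` and `e`. -/

section

variable {p n : ℕ}

theorem isGeneralizedBayes_and_isMinimax_of_isGoodShrinkage (hp : 1 ≤ p) (hn : 1 ≤ n)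
    {a e N : ℝ} (ha : -(p : ℝ) / 2 - 1 < a) (ha1 : a < -1)
    (hN : N = ((p : ℝ) + n) / 2 + e + 2) (hN1 : 1 < N)
    (hgood : IsGoodShrinkage p n (shrink ((p : ℝ) / 2 + a + 1) (-a - 2) N)
      (shrinkDeriv ((p : ℝ) / 2 + a + 1) (-a - 2) N))
    {f : ℝ → ℝ} (hf : IsErrorDensity p n f) (hM : MomentCondition p n a e f) :
    IsGeneralizedBayes (p := p) (n := n) f (prior a e) (genBayes f (prior a e)) ∧
      IsMinimax (p := p) (n := n) f (genBayes f (prior a e)) :=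
  ⟨fun x _ hz d hd => (genBayes_spec hp hf hM ha ha1 hN hN1 x hz).2 d hd,
    isMinimax_of_eq_shrinkEst hp hn hgood hf.measurable (measurable_genBayes hf.measurable)
      fun x _ hz => (genBayes_spec hp hf hM ha ha1 hN hN1 x hz).1⟩

theorem isGoodShrinkage_of_le_neg_two {a e N : ℝ} (ha : -(p : ℝ) / 2 - 1 < a) (ha2 : a ≤ -2)
    (hN : N = ((p : ℝ) + n) / 2 + e + 2) (hq : 0 < (n : ℝ) / 2 + e - a)
    (h : ((p : ℝ) / 2 + a + 1) * (n + 2) ≤ 2 * ((p : ℝ) - 2) * ((n : ℝ) / 2 + e - a)) :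
    IsGoodShrinkage p n (shrink ((p : ℝ) / 2 + a + 1) (-a - 2) N)
      (shrinkDeriv ((p : ℝ) / 2 + a + 1) (-a - 2) N) := by
  have e1 : N = ((p : ℝ) / 2 + a + 1) + 1 + ((n : ℝ) / 2 + e - a) := by rw [hN]; ring
  rw [e1]
  exact isGoodShrinkage_of_nonneg (by linarith) (by linarith) hq h

theorem le_uStar_iff (hp : 3 ≤ p) {a e : ℝ} :
    a ≤ uStar p n e ↔
      ((p : ℝ) / 2 + a + 1) * (n + 2) ≤ 2 * ((p : ℝ) - 2) * ((n : ℝ) / 2 + e - a) := by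
  have hp' : (3 : ℝ) ≤ p := by exact_mod_cast hp
  have hn' : (0 : ℝ) < (n : ℝ) + 2 := by positivity
  have hc : cConst p n * ((n : ℝ) + 2) = 2 * ((p : ℝ) - 2) := by
    unfold cConst; field_simp
  have hc0 : 0 ≤ cConst p n := div_nonneg (by linarith) hn'.le
  rw [uStar, le_div_iff₀ (by linarith), ← hc, ← sub_nonneg,
    ← sub_nonneg (b := ((p : ℝ) / 2 + a + 1) * _)]
  have key : cConst p n * ((n : ℝ) + 2) * ((n : ℝ) / 2 + e - a)
      - ((p : ℝ) / 2 + a + 1) * (n + 2)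
      = ((n : ℝ) + 2) * (cConst p n * ((n : ℝ) / 2 + e) - (p : ℝ) / 2 - 1
        - a * (1 + cConst p n)) := by ring
  rw [key]
  exact (mul_nonneg_iff_of_pos_left hn').symm

/-- The values of `g` in terms of `a + 2`. -/
theorem g_eq (e a : ℝ) : g p n e a =
    (2 * p + n - 2 + 2 * (2 * e + n / 2 + 3)) * (a + 2) ^ 2
      + (p * (2 * p + n - 2) + 2 * (p - 1) * (2 * e + n / 2 + 3)) * (a + 2)
      - (p - 2) * (2 * e + n / 2 + 3) := by
  unfold g; ring

/-- With `s = a + 2 = -b`, `h = p/2 - 1` and `k = h + s`, the requirement of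
`isGoodShrinkage_of_neg` is `k(n + 2 + 4L) ≤ 4(h - L)X`, and the difference of the two sides is
exactly `-g(a)`. It remains to show `X > 0`, for which `L < h` is established first. -/
theorem isGoodShrinkage_of_g_nonpos (hp : 3 ≤ p) {a e N : ℝ} (he : -(n : ℝ) / 4 - 3 / 2 < e)
    (ha : -2 ≤ a) (ha1 : a < -1) (hg : g p n e a ≤ 0)
    (hN : N = ((p : ℝ) + n) / 2 + e + 2) :
    IsGoodShrinkage p n (shrink ((p : ℝ) / 2 + a + 1) (-a - 2) N)
      (shrinkDeriv ((p : ℝ) / 2 + a + 1) (-a - 2) N) := by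
  have hp' : (3 : ℝ) ≤ p := by exact_mod_cast hp
  have hn' : (0 : ℝ) ≤ n := n.cast_nonneg
  obtain ⟨E, hE⟩ : ∃ E, E = 2 * e + (n : ℝ) / 2 + 3 := ⟨_, rfl⟩
  obtain ⟨s, hs⟩ : ∃ s, s = a + 2 := ⟨_, rfl⟩
  obtain ⟨h, hh⟩ : ∃ h, h = (p : ℝ) / 2 - 1 := ⟨_, rfl⟩
  obtain ⟨q, hq⟩ : ∃ q, q = (n : ℝ) / 2 + e - a := ⟨_, rfl⟩
  obtain ⟨L, hL⟩ : ∃ L, L = -(-a - 2) * (((p : ℝ) / 2 + a + 1) + 1) / (1 + (-a - 2)) := ⟨_, rfl⟩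
  obtain ⟨X, hX⟩ : ∃ X, X = (1 + (-a - 2)) * q + (-a - 2) * ((p : ℝ) / 2 + a + 1) := ⟨_, rfl⟩
  have hEpos : 0 < E := by linarith
  have hs0 : 0 ≤ s := by linarith
  have hs1 : 0 < 1 - s := by linarith
  have hh0 : 0 < h := by linarith
  have hk : (p : ℝ) / 2 + a + 1 = h + s := by rw [hh, hs]; ring
  have hLs : L * (1 - s) = s * (h + s + 1) := by
    rw [hL, hk, show 1 + (-a - 2) = 1 - s by rw [hs]; ring, show -(-a - 2) = s by rw [hs]; ring]
    field_simp
  have hgE : g p n e a = (2 * p + n - 2 + 2 * E) * s ^ 2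
      + (p * (2 * p + n - 2) + 2 * (p - 1) * E) * s - (p - 2) * E := by
    rw [g_eq, hE, hs]
  -- This is `L < h` multiplied by `1 - s`. For `s > 0`, `2E` times the difference of the sides is
  -- `g(a)` minus a positive quantity.
  have hquad : s * (h + s + 1) < h * (1 - s) := by
    have hT : 0 < 2 * (p : ℝ) + n - 2 := by linarith
    rcases hs0.eq_or_lt with h0 | h0
    · rw [← h0]; linarith
    · have h1 : 0 < (2 * (p : ℝ) + n - 2) * (s ^ 2 + p * s) := by positivity
      have h2 : 2 * E * (s * (h + s + 1) - h * (1 - s)) < 0 := by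
        rw [hh]
        have : 2 * E * (s * ((p : ℝ) / 2 - 1 + s + 1) - ((p : ℝ) / 2 - 1) * (1 - s))
          = g p n e a - (2 * (p : ℝ) + n - 2) * (s ^ 2 + p * s) := by rw [hgE]; ring
        rw [this]; linarith
      have h3 := neg_of_mul_neg_right h2 (by positivity)
      linarith
  have hLh : L < h := by
    have : L * (1 - s) < h * (1 - s) := by rw [hLs]; exact hquad
    exact lt_of_mul_lt_mul_right this hs1.le
  have hL0 : 0 ≤ L := by
    have : 0 ≤ L * (1 - s) := by rw [hLs]; positivity
    exact nonneg_of_mul_nonneg_left this hs1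
  have hXs : X = (1 - s) * q - s * (h + s) := by
    rw [hX, hk, hs]; ring
  have hqE : 4 * q = 2 * E + n + 2 - 4 * s := by rw [hq, hE, hs]; ring
  have hid : -g p n e a = 4 * (h - L) * X - (h + s) * (n + 2 + 4 * L) := by
    have hqe : q = (2 * E + n + 2 - 4 * s) / 4 := by linarith
    have hp2 : (p : ℝ) = 2 * h + 2 := by linarith
    rw [hgE, hXs, hqe, hp2]
    linear_combination (2 * E + n + 2 - 4 * s + 4 * (h + s)) * hLs
  have hkpos : 0 < h + s := by linarith
  have hineq : (h + s) * (n + 2 + 4 * L) ≤ 4 * (h - L) * X := by linarith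
  have hXpos : 0 < X := by
    have h1 : 0 < (h + s) * (n + 2 + 4 * L) := by positivity
    exact pos_of_mul_pos_right (h1.trans_le hineq) (by linarith)
  have hqpos : 0 < q := by
    have h1 : 0 ≤ s * (h + s) := by positivity
    have h2 : 0 < (1 - s) * q := by linarith
    exact pos_of_mul_pos_right h2 hs1.le
  have e1 : N = ((p : ℝ) / 2 + a + 1) + 1 + q := by rw [hN, hq]; ring
  rw [e1]
  refine isGoodShrinkage_of_neg (L := L) (by linarith) (by linarith) (by linarith) hqpos hL
    (hX ▸ hXpos) ?_
  rw [← hX, hk]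
  have : 2 * ((p : ℝ) - 2) - 4 * L = 4 * (h - L) := by rw [hh]; ring
  rw [this]
  exact hineq

/-- A quadratic `A t² + B t + C` with `A > 0` that is negative at `u` and positive at `v > u` has
exactly two real zeros, the larger one lying between `u` and `v`. -/
theorem exists_roots_quadratic {A B C u v : ℝ} (hA : 0 < A) (huv : u < v)
    (hu : A * u ^ 2 + B * u + C < 0) (hv : 0 < A * v ^ 2 + B * v + C) :
    ∃ r s : ℝ, r < u ∧ u < s ∧ s < v ∧
      ∀ t, A * t ^ 2 + B * t + C = A * (t - r) * (t - s) := by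
  have hcont : ContinuousOn (fun t : ℝ => A * t ^ 2 + B * t + C) (Icc u v) := by fun_prop
  obtain ⟨s, ⟨hs1, hs2⟩, hs⟩ := intermediate_value_Ioo huv.le hcont ⟨hu, hv⟩
  have hfac : ∀ t, A * t ^ 2 + B * t + C = A * (t - (-B / A - s)) * (t - s) := by
    intro t
    have e1 : A * (t - (-B / A - s)) = A * t + B + A * s := by field_simp; ring
    rw [e1]
    simp only at hs
    linear_combination hs
  refine ⟨-B / A - s, s, ?_, hs1, hs2, hfac⟩
  rw [hfac u] at hu
  have h1 : 0 < A * (u - (-B / A - s)) := by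
    by_contra hcon
    exact absurd hu (not_lt.2 (mul_nonneg_of_nonpos_of_nonpos (not_lt.1 hcon) (by linarith)))
  have := pos_of_mul_pos_right h1 hA.le
  linarith

end

end SphericalModel

theorem mainTheorem4 (p n : ℕ) (hp : 3 ≤ p) (hn : 1 ≤ n) (e : ℝ) :
    ((-(p : ℝ) / 2 - (n : ℝ) / 2 - 1 < e ∧ e ≤ -(n : ℝ) / 4 - 3 / 2) →
      ∀ a : ℝ, -(p : ℝ) / 2 - 1 < a → a ≤ SphericalModel.uStar p n e →
        ∀ f : ℝ → ℝ, SphericalModel.IsErrorDensity p n f →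
          SphericalModel.MomentCondition p n a e f →
            SphericalModel.IsGeneralizedBayes (p := p) (n := n) f (SphericalModel.prior a e)
                (SphericalModel.genBayes f (SphericalModel.prior a e)) ∧
              SphericalModel.IsMinimax (p := p) (n := n) f
                (SphericalModel.genBayes f (SphericalModel.prior a e)))
    ∧
    ((-(n : ℝ) / 4 - 3 / 2 < e ∧ 2 ≤ n) →
      ∃ r aStar : ℝ, r < aStar ∧ {t : ℝ | SphericalModel.g p n e t = 0} = {r, aStar} ∧
        -2 < aStar ∧ aStar < -1 ∧
        ∀ a : ℝ, -(p : ℝ) / 2 - 1 < a → a ≤ aStar →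
          ∀ f : ℝ → ℝ, SphericalModel.IsErrorDensity p n f →
            SphericalModel.MomentCondition p n a e f →
              SphericalModel.IsGeneralizedBayes (p := p) (n := n) f (SphericalModel.prior a e)
                  (SphericalModel.genBayes f (SphericalModel.prior a e)) ∧
                SphericalModel.IsMinimax (p := p) (n := n) f
                  (SphericalModel.genBayes f (SphericalModel.prior a e))) := by
  have hp' : (3 : ℝ) ≤ p := by exact_mod_cast hp
  have hn' : (1 : ℝ) ≤ n := by exact_mod_cast hn
  constructor
  · rintro ⟨he1, he2⟩ a ha hau f hf hM
    have h := (SphericalModel.le_uStar_iff hp).1 hau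
    have hq : 0 < (n : ℝ) / 2 + e - a := by
      have h1 : 0 < ((p : ℝ) / 2 + a + 1) * ((n : ℝ) + 2) :=
        mul_pos (by linarith) (by linarith)
      exact pos_of_mul_pos_right (h1.trans_le h) (by linarith)
    -- If `a > -2`, then `e ≤ -n/4 - 3/2` gives `n/2 + e - a ≤ (n+2)/4`, and the bound from `u_*`
    -- would force `p/2 + a + 1 ≤ p/2 - 1`.
    have ha2 : a ≤ -2 := by
      by_contra hcon
      push Not at hcon
      have h1 := mul_pos (show 0 < a + 2 by linarith) (show 0 < (n : ℝ) + 2 by linarith)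
      have h2 : ((p : ℝ) - 2) * ((n : ℝ) / 2 + e - a) ≤ ((p : ℝ) - 2) * (((n : ℝ) + 2) / 4) :=
        mul_le_mul_of_nonneg_left (by linarith) (by linarith)
      linarith
    exact SphericalModel.isGeneralizedBayes_and_isMinimax_of_isGoodShrinkage (by omega) hn ha
      (by linarith) rfl (by linarith)
      (SphericalModel.isGoodShrinkage_of_le_neg_two ha ha2 rfl hq h) hf hM
  · rintro ⟨he, -⟩
    have hgdef : ∀ t, SphericalModel.g p n e t = (2 * p + 2 * n + 4 * e + 4) * t ^ 2
        + (2 * (p : ℝ) ^ 2 + 2 * p * n + 12 * p + 7 * n + 4 * (p + 3) * e + 10) * t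
        + (4 * (p : ℝ) ^ 2 + 7 / 2 * p * n + 6 * (p + 2) * e + 7 * n + 13 * p + 10) := by
      intro t; unfold SphericalModel.g; ring
    have hA : 0 < 2 * (p : ℝ) + 2 * n + 4 * e + 4 := by linarith
    have hE : 0 < 2 * e + (n : ℝ) / 2 + 3 := by linarith
    have hm2 : SphericalModel.g p n e (-2) < 0 := by
      rw [SphericalModel.g_eq]
      have := mul_pos (show 0 < (p : ℝ) - 2 by linarith) hE
      linarith
    have hm1 : 0 < SphericalModel.g p n e (-1) := by
      rw [SphericalModel.g_eq]
      have h1 := mul_pos (show 0 < (p : ℝ) + 2 by linarith) hE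
      have h2 := mul_pos (show 0 < (p : ℝ) + 1 by linarith)
        (show 0 < 2 * (p : ℝ) + n - 2 by linarith)
      linarith
    obtain ⟨r, s, hr, hs2, hs1, hfac⟩ := SphericalModel.exists_roots_quadratic hA
      (show (-2 : ℝ) < -1 by norm_num) (hgdef _ ▸ hm2) (hgdef _ ▸ hm1)
    refine ⟨r, s, hr.trans hs2, ?_, hs2, hs1, ?_⟩
    · ext t
      simp only [mem_ofPred_eq, mem_insert_iff, mem_singleton_iff]
      rw [hgdef, hfac]
      simp [hA.ne', sub_eq_zero]
    · intro a ha has f hf hM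
      refine SphericalModel.isGeneralizedBayes_and_isMinimax_of_isGoodShrinkage (by omega) hn ha
        (by linarith) rfl (by linarith) ?_ hf hM
      -- For `a ≤ -2` the assumption on `e` gives `n/2 + e - a ≥ (n+2)/4`, which already implies the
      -- condition of the case `b ≥ 0`. For `a ≥ -2` the point lies between the two zeros, as the
      -- smaller one is below `-2`.
      rcases le_total a (-2) with ha2 | ha2
      · refine SphericalModel.isGoodShrinkage_of_le_neg_two ha ha2 rfl (by linarith) ?_
        have h1 := mul_nonneg (show 0 ≤ -2 - a by linarith) (show 0 ≤ (n : ℝ) + 2 by linarith)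
        have h2 : ((p : ℝ) - 2) * (((n : ℝ) + 2) / 4) ≤ ((p : ℝ) - 2) * ((n : ℝ) / 2 + e - a) :=
          mul_le_mul_of_nonneg_left (by linarith) (by linarith)
        linarith
      · refine SphericalModel.isGoodShrinkage_of_g_nonpos hp he ha2 (by linarith) ?_ rfl
        rw [hgdef, hfac]
        exact mul_nonpos_of_nonneg_of_nonpos (mul_nonneg hA.le (by linarith)) (by linarith)
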